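/- Let $J=[a,b)$ with $a<b$ real, and consider the following groups (under composition). - $\mathcal G^+(J)$, the group of interval exchange transformations (IETs): bijections $f$ of $J$ for which there is a finite partition of $J$ into half-open intervals $[c,d)$ such that $f$ is a translation on each of them. - $\mathcal A^+(J)$, the group of affine interval exchange transformations: the same with "orientation preserving affine map $x\mapsto \lambda x+\beta$, $\lambda>0$" in place of "translation". - $\mathcal{PC}^+(J)$, the group of generalised interval exchange transformations: the same with "orientation preserving homeomorphism onto its image" in place of "translation". - $\mathcal G(J)$, the group of interval exchange transformations with flips: the group of bijections $f$ of $J$ for which $J$ can be cut, up to finitely many points, into finitely many disjoint open intervals on each of which $f$ has the form $x\mapsto \pm x+\beta$, modulo the normal subgroup of bijections of $J$ with finite support (those that move only finitely many points). Then the groups $\mathcal A^+(J)$, $\mathcal{PC}^+(J)$ and $\mathcal G(J)$ are simple. The group $\mathcal G^+(J)$ is not simple, but its commutator subgroup $[\mathcal G^+(J),\mathcal G^+(J)]$ is simple. -/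

import Mathlib

namespace IntervalExchange

/-- A nonempty half-open interval `[c, d)` contained in `J = [a, b)`, as a set of points of `J`. -/
def IsHalfOpenPiece {a b : ℝ} (s : Set (Set.Ico a b)) : Prop :=
  ∃ c d : ℝ, c < d ∧ Subtype.val '' s = Set.Ico c d

/-- A single point of `J = [a, b)`, or a nonempty open interval `(c, d)` contained in `J`. -/
def IsPointOrOpenPiece {a b : ℝ} (s : Set (Set.Ico a b)) : Prop :=
  (∃ x, s = {x}) ∨ ∃ c d : ℝ, c < d ∧ Subtype.val '' s = Set.Ioo c d

/-- `f` is a translation on `s`. -/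
def IsTranslationOn {a b : ℝ} (f : Equiv.Perm (Set.Ico a b)) (s : Set (Set.Ico a b)) : Prop :=
  ∃ β : ℝ, ∀ x ∈ s, (f x : ℝ) = x + β

/-- `f` is an orientation preserving affine map on `s`. -/
def IsPosAffineOn {a b : ℝ} (f : Equiv.Perm (Set.Ico a b)) (s : Set (Set.Ico a b)) : Prop :=
  ∃ l β : ℝ, 0 < l ∧ ∀ x ∈ s, (f x : ℝ) = l * x + β

/-- `f` is continuous and strictly increasing on `s`; for a half-open interval `s` this says that
`f` restricts to an orientation preserving homeomorphism of `s` onto a half-open interval. -/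
def IsIncreasingHomeoOn {a b : ℝ} (f : Equiv.Perm (Set.Ico a b)) (s : Set (Set.Ico a b)) : Prop :=
  ContinuousOn f s ∧ StrictMonoOn f s

/-- `f` is an affine map of slope `1` or `-1` on `s`. -/
def IsIsometricAffineOn {a b : ℝ} (f : Equiv.Perm (Set.Ico a b)) (s : Set (Set.Ico a b)) : Prop :=
  ∃ l β : ℝ, (l = 1 ∨ l = -1) ∧ ∀ x ∈ s, (f x : ℝ) = l * x + β

/-- There is a finite partition of `J = [a, b)` into sets satisfying `Piece` such that on each set
of the partition the bijection `f` of `J` has the property `Local`. -/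
def IsPiecewise {a b : ℝ} (Piece : Set (Set.Ico a b) → Prop)
    (Local : Equiv.Perm (Set.Ico a b) → Set (Set.Ico a b) → Prop)
    (f : Equiv.Perm (Set.Ico a b)) : Prop :=
  ∃ S : Set (Set (Set.Ico a b)), S.Finite ∧ Setoid.IsPartition S ∧ ∀ s ∈ S, Piece s ∧ Local f s

section Closure

variable {a b : ℝ} {Piece : Set (Set.Ico a b) → Prop}
  {Local : Equiv.Perm (Set.Ico a b) → Set (Set.Ico a b) → Prop}

theorem IsPiecewise.one
    (hP : ∃ S : Set (Set (Set.Ico a b)), S.Finite ∧ Setoid.IsPartition S ∧ ∀ s ∈ S, Piece s)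
    (hone : ∀ s, Local 1 s) : IsPiecewise Piece Local 1 := by
  obtain ⟨S, h1, h2, h3⟩ := hP
  exact ⟨S, h1, h2, fun s hs => ⟨h3 s hs, hone s⟩⟩

theorem IsPiecewise.inv
    (hinv : ∀ f s, Piece s → Local f s → Piece (f '' s) ∧ Local f⁻¹ (f '' s))
    {f : Equiv.Perm (Set.Ico a b)} (hf : IsPiecewise Piece Local f) :
    IsPiecewise Piece Local f⁻¹ := by
  obtain ⟨S, h1, ⟨h2, h2'⟩, h3⟩ := hf
  refine ⟨(fun s => f '' s) '' S, h1.image _, ⟨?_, fun y => ?_⟩, ?_⟩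
  · rintro ⟨s, hs, h⟩
    rw [Set.image_eq_empty] at h
    exact h2 (h ▸ hs)
  · obtain ⟨s, ⟨hs, hx⟩, hu⟩ := h2' (f⁻¹ y)
    refine ⟨f '' s, ⟨⟨s, hs, rfl⟩, ⟨_, hx, by simp⟩⟩, ?_⟩
    rintro _ ⟨⟨t, ht, rfl⟩, ⟨x, hxt, rfl⟩⟩
    rw [hu t ⟨ht, by simpa using hxt⟩]
  · rintro _ ⟨s, hs, rfl⟩
    exact hinv f s (h3 s hs).1 (h3 s hs).2

theorem IsPiecewise.mul
    (hinter : ∀ s t, Piece s → Piece t → (s ∩ t).Nonempty → Piece (s ∩ t))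
    (hmono : ∀ f s t, t ⊆ s → Local f s → Local f t)
    (hinv : ∀ f s, Piece s → Local f s → Piece (f '' s) ∧ Local f⁻¹ (f '' s))
    (hcomp : ∀ f g s, Local g s → Local f (g '' s) → Local (f * g) s)
    {f g : Equiv.Perm (Set.Ico a b)} (hf : IsPiecewise Piece Local f)
    (hg : IsPiecewise Piece Local g) : IsPiecewise Piece Local (f * g) := by
  obtain ⟨T, T1, ⟨T2, T2'⟩, T3⟩ := hf
  obtain ⟨S, S1, ⟨S2, S2'⟩, S3⟩ := hg
  refine ⟨Set.image2 (fun s t => s ∩ g ⁻¹' t) S T \ {∅}, (S1.image2 _ T1).sdiff,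
    ⟨fun h => h.2 rfl, fun x => ?_⟩, ?_⟩
  · obtain ⟨s, ⟨hs, hx⟩, hu⟩ := S2' x
    obtain ⟨t, ⟨ht, hx'⟩, hu'⟩ := T2' (g x)
    refine ⟨s ∩ g ⁻¹' t, ⟨⟨⟨s, hs, t, ht, rfl⟩, ?_⟩, hx, hx'⟩, ?_⟩
    · exact Set.Nonempty.ne_empty ⟨x, hx, hx'⟩
    · rintro _ ⟨⟨⟨s', hs', t', ht', rfl⟩, _⟩, h1, h2⟩
      rw [hu s' ⟨hs', h1⟩, hu' t' ⟨ht', h2⟩]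
  · rintro _ ⟨⟨s, hs, t, ht, rfl⟩, hne⟩
    have hne' : (s ∩ g ⁻¹' t).Nonempty := Set.nonempty_iff_ne_empty.2 hne
    have himg : g '' (s ∩ g ⁻¹' t) = g '' s ∩ t := Set.image_inter_preimage _ _ _
    obtain ⟨p1, l1⟩ := hinv g s (S3 s hs).1 (S3 s hs).2
    have p2 : Piece (g '' s ∩ t) :=
      hinter _ _ p1 (T3 t ht).1 (by rw [← himg]; exact hne'.image _)
    have l2 : Local g⁻¹ (g '' s ∩ t) := hmono _ _ _ Set.inter_subset_left l1
    have p3 := (hinv _ _ p2 l2).1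
    have hback : (g⁻¹ : Equiv.Perm (Set.Ico a b)) '' (g '' s ∩ t) = s ∩ g ⁻¹' t := by
      rw [← himg, ← Set.image_comp]
      convert Set.image_id _ using 2
      ext x
      simp
    rw [hback] at p3
    refine ⟨p3, hcomp _ _ _ (hmono _ _ _ Set.inter_subset_left (S3 s hs).2) ?_⟩
    rw [himg]
    exact hmono _ _ _ Set.inter_subset_right (T3 t ht).2

end Closure

section Pieces

variable {a b : ℝ}

theorem exists_halfOpen_partition : ∃ S : Set (Set (Set.Ico a b)),
    S.Finite ∧ Setoid.IsPartition S ∧ ∀ s ∈ S, IsHalfOpenPiece s := by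
  by_cases hab : a < b
  · refine ⟨{Set.univ}, Set.finite_singleton _, ⟨?_, fun x => ⟨Set.univ, by simp⟩⟩, ?_⟩
    · intro h
      have : (∅ : Set (Set.Ico a b)) = Set.univ := h
      exact absurd (this ▸ Set.mem_univ (⟨a, le_refl a, hab⟩ : Set.Ico a b)) (by simp)
    · rintro _ rfl
      exact ⟨a, b, hab, by rw [Set.image_univ, Subtype.range_coe]⟩
  · refine ⟨∅, Set.finite_empty, ⟨by simp, fun x => ?_⟩, by simp⟩
    exact absurd (x.2.1.trans_lt x.2.2) hab

theorem exists_pointOrOpen_partition : ∃ S : Set (Set (Set.Ico a b)),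
    S.Finite ∧ Setoid.IsPartition S ∧ ∀ s ∈ S, IsPointOrOpenPiece s := by
  by_cases hab : a < b
  · let p : Set.Ico a b := ⟨a, le_refl a, hab⟩
    refine ⟨{{p}, {p}ᶜ}, by simp, ⟨?_, fun x => ?_⟩, ?_⟩
    · rintro (h | h)
      · exact absurd h.symm (by simp)
      · have h' : ({p}ᶜ : Set (Set.Ico a b)) = ∅ := h.symm
        have hq : (⟨(a + b) / 2, by constructor <;> linarith⟩ : Set.Ico a b) ∈
            ({p}ᶜ : Set (Set.Ico a b)) := by
          intro hq
          have : (a + b) / 2 = a := congrArg Subtype.val hq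
          linarith
        rw [h'] at hq
        exact hq
    · by_cases hx : x = p
      · refine ⟨{p}, by simp [hx], ?_⟩
        rintro t ⟨(rfl | rfl), h⟩
        · rfl
        · exact absurd hx h
      · refine ⟨{p}ᶜ, by simp [hx], ?_⟩
        rintro t ⟨(rfl | rfl), h⟩
        · exact absurd h hx
        · rfl
    · rintro t (rfl | rfl)
      · exact Or.inl ⟨p, rfl⟩
      · refine Or.inr ⟨a, b, hab, ?_⟩
        ext y
        constructor
        · rintro ⟨x, hx, rfl⟩
          exact ⟨lt_of_le_of_ne x.2.1 fun h => hx (Subtype.ext h.symm), x.2.2⟩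
        · rintro ⟨h1, h2⟩
          exact ⟨⟨y, h1.le, h2⟩, fun h => h1.ne' (congrArg Subtype.val h), rfl⟩
  · refine ⟨∅, Set.finite_empty, ⟨by simp, fun x => ?_⟩, by simp⟩
    exact absurd (x.2.1.trans_lt x.2.2) hab

theorem IsHalfOpenPiece.inter {s t : Set (Set.Ico a b)} (hs : IsHalfOpenPiece s)
    (ht : IsHalfOpenPiece t) (hne : (s ∩ t).Nonempty) : IsHalfOpenPiece (s ∩ t) := by
  obtain ⟨c, d, -, h⟩ := hs
  obtain ⟨c', d', -, h'⟩ := ht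
  have e : Subtype.val '' (s ∩ t) = Set.Ico (max c c') (min d d') := by
    rw [Set.image_inter Subtype.val_injective, h, h', Set.Ico_inter_Ico]
  refine ⟨_, _, ?_, e⟩
  rw [← Set.nonempty_Ico, ← e]
  exact hne.image _

theorem IsPointOrOpenPiece.inter {s t : Set (Set.Ico a b)} (hs : IsPointOrOpenPiece s)
    (ht : IsPointOrOpenPiece t) (hne : (s ∩ t).Nonempty) : IsPointOrOpenPiece (s ∩ t) := by
  rcases hs with ⟨x, rfl⟩ | ⟨c, d, -, h⟩
  · exact Or.inl ⟨x, (Set.singleton_inter_nonempty.1 hne |> fun h =>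
      Set.inter_eq_left.2 (Set.singleton_subset_iff.2 h))⟩
  rcases ht with ⟨x, rfl⟩ | ⟨c', d', -, h'⟩
  · exact Or.inl ⟨x, (Set.inter_singleton_nonempty.1 hne |> fun h =>
      Set.inter_eq_right.2 (Set.singleton_subset_iff.2 h))⟩
  have e : Subtype.val '' (s ∩ t) = Set.Ioo (max c c') (min d d') := by
    rw [Set.image_inter Subtype.val_injective, h, h', Set.Ioo_inter_Ioo]
  refine Or.inr ⟨_, _, ?_, e⟩
  rw [← Set.nonempty_Ioo, ← e]
  exact hne.image _

theorem val_image_image {f : Equiv.Perm (Set.Ico a b)} {s : Set (Set.Ico a b)} {l β : ℝ}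
    (h : ∀ x ∈ s, (f x : ℝ) = l * x + β) :
    Subtype.val '' (f '' s) = (fun y : ℝ => l * y + β) '' (Subtype.val '' s) := by
  rw [← Set.image_comp, ← Set.image_comp]
  exact Set.image_congr h

theorem IsPosAffineOn.inv (f : Equiv.Perm (Set.Ico a b)) (s : Set (Set.Ico a b))
    (hs : IsHalfOpenPiece s) (hf : IsPosAffineOn f s) :
    IsHalfOpenPiece (f '' s) ∧ IsPosAffineOn f⁻¹ (f '' s) := by
  obtain ⟨c, d, hcd, h⟩ := hs
  obtain ⟨l, β, hl, hx⟩ := hf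
  refine ⟨⟨l * c + β, l * d + β, by gcongr, ?_⟩, l⁻¹, -(l⁻¹ * β), inv_pos.2 hl, ?_⟩
  · rw [val_image_image hx, h]
    exact Set.image_affine_Ico hl β c d
  · rintro _ ⟨x, hxs, rfl⟩
    rw [hx x hxs]
    simp
    field_simp
    ring

theorem IsTranslationOn.inv (f : Equiv.Perm (Set.Ico a b)) (s : Set (Set.Ico a b))
    (hs : IsHalfOpenPiece s) (hf : IsTranslationOn f s) :
    IsHalfOpenPiece (f '' s) ∧ IsTranslationOn f⁻¹ (f '' s) := by
  obtain ⟨β, hx⟩ := hf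
  refine ⟨(IsPosAffineOn.inv f s hs ⟨1, β, one_pos, by simpa using hx⟩).1, -β, ?_⟩
  rintro _ ⟨x, hxs, rfl⟩
  rw [hx x hxs]
  simp

theorem IsIsometricAffineOn.inv (f : Equiv.Perm (Set.Ico a b)) (s : Set (Set.Ico a b))
    (hs : IsPointOrOpenPiece s) (hf : IsIsometricAffineOn f s) :
    IsPointOrOpenPiece (f '' s) ∧ IsIsometricAffineOn f⁻¹ (f '' s) := by
  obtain ⟨l, β, hl, hx⟩ := hf
  refine ⟨?_, l, -(l * β), hl, ?_⟩
  · rcases hs with ⟨x, rfl⟩ | ⟨c, d, hcd, h⟩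
    · exact Or.inl ⟨f x, by simp⟩
    · right
      rw [val_image_image hx, h]
      rcases hl with rfl | rfl
      · exact ⟨c + β, d + β, by gcongr, by simp⟩
      · refine ⟨β - d, β - c, by gcongr, ?_⟩
        rw [← Set.image_const_sub_Ioo]
        exact Set.image_congr fun y _ => by ring
  · rintro _ ⟨x, hxs, rfl⟩
    rw [hx x hxs]
    rcases hl with rfl | rfl <;> simp

theorem IsIncreasingHomeoOn.inv (f : Equiv.Perm (Set.Ico a b)) (s : Set (Set.Ico a b))
    (hs : IsHalfOpenPiece s) (hf : IsIncreasingHomeoOn f s) :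
    IsHalfOpenPiece (f '' s) ∧ IsIncreasingHomeoOn f⁻¹ (f '' s) := by
  obtain ⟨c, d, hcd, h⟩ := hs
  obtain ⟨hc, hm⟩ := hf
  have hmem : ∀ x : Set.Ico a b, x ∈ s ↔ (x : ℝ) ∈ Set.Ico c d := fun x => by
    rw [← h, Subtype.val_injective.mem_set_image]
  have hso : s.OrdConnected := ⟨fun x hx y hy z hz => by
    rw [hmem] at *
    exact ⟨hx.1.trans hz.1, lt_of_le_of_lt (show (z : ℝ) ≤ y from hz.2) hy.2⟩⟩
  have hpre : IsPreconnected s := by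
    rw [← Topology.IsInducing.subtypeVal.isPreconnected_image, h]
    exact isPreconnected_Ico
  have him : (Subtype.val '' (f '' s)).OrdConnected :=
    ((hpre.image f hc).image _ continuous_subtype_val.continuousOn).ordConnected
  have hfo : (f '' s).OrdConnected := ⟨fun x hx y hy z hz => by
    obtain ⟨w, hw, hwz⟩ := him.out ⟨x, hx, rfl⟩ ⟨y, hy, rfl⟩ (show (z : ℝ) ∈ _ from hz)
    rwa [← Subtype.ext hwz]⟩
  obtain ⟨p, hp, hpc⟩ : c ∈ Subtype.val '' s := by rw [h]; exact ⟨le_rfl, hcd⟩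
  have hleast : ∀ x ∈ s, p ≤ x := fun x hx => by
    have := ((hmem x).1 hx).1
    rw [← hpc] at this
    exact this
  refine ⟨⟨f p, sSup (Subtype.val '' (f '' s)), ?_, ?_⟩, ?_, ?_⟩
  all_goals
    have hbdd : BddAbove (Subtype.val '' (f '' s)) := ⟨b, by
      rintro _ ⟨x, -, rfl⟩
      exact x.2.2.le⟩
    have hnomax : ∀ x ∈ s, ((f x : Set.Ico a b) : ℝ) < sSup (Subtype.val '' (f '' s)) := by
      intro x hx
      have hxd := ((hmem x).1 hx).2
      have hxc := ((hmem x).1 hx).1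
      obtain ⟨y, hy, hyd⟩ : (x + d) / 2 ∈ Subtype.val '' s := by
        rw [h]; constructor <;> linarith
      have hxy : x < y := by
        show (x : ℝ) < y
        rw [hyd]; linarith
      exact lt_of_lt_of_le (hm hx hy hxy) (le_csSup hbdd ⟨_, ⟨y, hy, rfl⟩, rfl⟩)
  · exact hnomax p hp
  · ext y
    constructor
    · rintro ⟨_, ⟨x, hx, rfl⟩, rfl⟩
      exact ⟨hm.monotoneOn hp hx (hleast x hx), hnomax x hx⟩
    · rintro ⟨h1, h2⟩
      obtain ⟨z, hz, hyz⟩ := exists_lt_of_lt_csSup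
        (((Set.nonempty_of_mem hp).image f).image Subtype.val) h2
      exact him.out ⟨_, ⟨p, hp, rfl⟩, rfl⟩ hz ⟨h1, hyz.le⟩
  · rw [continuousOn_iff_continuous_domRestrict]
    have e := (hm.orderIso f s).symm.continuous
    have e' := (continuous_subtype_val (p := (· ∈ s))).comp e
    refine e'.congr ?_
    intro y
    obtain ⟨z, rfl⟩ := (hm.orderIso f s).surjective y
    have hz : ((hm.orderIso f s z : f '' s) : Set.Ico a b) = f z := rfl
    simp [hz]
  · rintro _ ⟨x, hx, rfl⟩ _ ⟨y, hy, rfl⟩ hxy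
    simpa using (hm.lt_iff_lt hx hy).1 hxy

end Pieces

/-- The group `𝒢⁺(J)` of interval exchange transformations of `J = [a, b)`: bijections of `J` that
are translations on each interval of a finite partition of `J` into half-open intervals. -/
def iet (a b : ℝ) : Subgroup (Equiv.Perm (Set.Ico a b)) where
  carrier := {f | IsPiecewise IsHalfOpenPiece IsTranslationOn f}
  one_mem' := IsPiecewise.one exists_halfOpen_partition fun _ => ⟨0, by simp⟩
  mul_mem' := IsPiecewise.mul (fun _ _ => IsHalfOpenPiece.inter)
    (fun _ _ _ hts ⟨β, h⟩ => ⟨β, fun x hx => h x (hts hx)⟩) IsTranslationOn.inv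
    (fun f g s ⟨β, h⟩ ⟨β', h'⟩ => ⟨β + β', fun x hx => by
      rw [Equiv.Perm.mul_apply, h' _ ⟨x, hx, rfl⟩, h x hx]; ring⟩)
  inv_mem' := IsPiecewise.inv IsTranslationOn.inv

/-- The group `𝒜⁺(J)` of affine interval exchange transformations of `J = [a, b)`: bijections of `J`
that are orientation preserving affine maps on each interval of a finite partition of `J` into
half-open intervals. -/
def affineIET (a b : ℝ) : Subgroup (Equiv.Perm (Set.Ico a b)) where
  carrier := {f | IsPiecewise IsHalfOpenPiece IsPosAffineOn f}
  one_mem' := IsPiecewise.one exists_halfOpen_partition fun _ => ⟨1, 0, by simp⟩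
  mul_mem' := IsPiecewise.mul (fun _ _ => IsHalfOpenPiece.inter)
    (fun _ _ _ hts ⟨l, β, hl, h⟩ => ⟨l, β, hl, fun x hx => h x (hts hx)⟩) IsPosAffineOn.inv
    (fun f g s ⟨l, β, hl, h⟩ ⟨l', β', hl', h'⟩ =>
      ⟨l' * l, l' * β + β', mul_pos hl' hl, fun x hx => by
        rw [Equiv.Perm.mul_apply, h' _ ⟨x, hx, rfl⟩, h x hx]; ring⟩)
  inv_mem' := IsPiecewise.inv IsPosAffineOn.inv

/-- The group `𝒫𝒞⁺(J)` of generalised interval exchange transformations of `J = [a, b)`: bijections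
of `J` that restrict to an orientation preserving homeomorphism (onto its image) on each interval of
a finite partition of `J` into half-open intervals. -/
def generalisedIET (a b : ℝ) : Subgroup (Equiv.Perm (Set.Ico a b)) where
  carrier := {f | IsPiecewise IsHalfOpenPiece IsIncreasingHomeoOn f}
  one_mem' := IsPiecewise.one exists_halfOpen_partition fun _ =>
    ⟨continuousOn_id, fun _ _ _ _ h => h⟩
  mul_mem' := IsPiecewise.mul (fun _ _ => IsHalfOpenPiece.inter)
    (fun _ _ _ hts h => ⟨h.1.mono hts, h.2.mono hts⟩) IsIncreasingHomeoOn.inv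
    (fun _ _ s h h' => ⟨h'.1.comp h.1 (Set.mapsTo_image _ s),
      h'.2.comp h.2 (Set.mapsTo_image _ s)⟩)
  inv_mem' := IsPiecewise.inv IsIncreasingHomeoOn.inv

/-- The group of interval exchange transformations with flips of `J = [a, b)`, as bijections of `J`:
`J` is a finite union of points and disjoint open intervals, on each of which the map is affine of
slope `1` or `-1`. -/
def flipBijections (a b : ℝ) : Subgroup (Equiv.Perm (Set.Ico a b)) where
  carrier := {f | IsPiecewise IsPointOrOpenPiece IsIsometricAffineOn f}
  one_mem' := IsPiecewise.one exists_pointOrOpen_partition fun _ => ⟨1, 0, by simp⟩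
  mul_mem' := IsPiecewise.mul (fun _ _ => IsPointOrOpenPiece.inter)
    (fun _ _ _ hts ⟨l, β, hl, h⟩ => ⟨l, β, hl, fun x hx => h x (hts hx)⟩) IsIsometricAffineOn.inv
    (fun f g s ⟨l, β, hl, h⟩ ⟨l', β', hl', h'⟩ =>
      ⟨l' * l, l' * β + β', by rcases hl with rfl | rfl <;> rcases hl' with rfl | rfl <;> simp,
        fun x hx => by
          rw [Equiv.Perm.mul_apply, h' _ ⟨x, hx, rfl⟩, h x hx]; ring⟩)
  inv_mem' := IsPiecewise.inv IsIsometricAffineOn.inv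

/-- The bijections of `J = [a, b)` with finite support, that is, moving only finitely many points. -/
def finiteSupport (a b : ℝ) : Subgroup (Equiv.Perm (Set.Ico a b)) where
  carrier := {f | {x | f x ≠ x}.Finite}
  one_mem' := by simp
  mul_mem' := fun {f g} hf hg => (hf.union hg).subset fun x hx => by
    by_contra h
    simp only [Set.mem_union, Set.mem_ofPred_eq, not_or, not_not] at h
    exact hx (by rw [Equiv.Perm.mul_apply, h.2, h.1])
  inv_mem' := fun {f} hf => hf.subset fun x hx h => hx (by rw [Equiv.Perm.inv_eq_iff_eq, h])

instance finiteSupport_normal (a b : ℝ) : (finiteSupport a b).Normal :=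
  ⟨fun f hf g => (Set.Finite.image g hf).subset fun x hx =>
    ⟨g⁻¹ x, fun h => hx (by
      rw [Equiv.Perm.mul_apply, Equiv.Perm.mul_apply, h]
      exact g.apply_symm_apply x), by simp⟩⟩

/-- The group `𝒢(J)` of classes, modulo bijections with finite support, of interval exchange
transformations with flips of `J = [a, b)`. -/
def flipIET (a b : ℝ) : Subgroup (Equiv.Perm (Set.Ico a b) ⧸ finiteSupport a b) :=
  (flipBijections a b).map (QuotientGroup.mk' (finiteSupport a b))

end IntervalExchange

/-! Extending by the identity turns every group into a subgroup of `Perm ℝ`, where affine maps of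
the line, which need not preserve `[a, b)`, can serve as conjugators. Write D for the commutator
subgroup of 𝒢⁺ (`derivedIET`). Each simplicity claim has the same shape: a nontrivial normal
subgroup contains D, and then contains everything.

Reaching D (`derivedIET_le_of_displaced`). A nontrivial element g of M, or one of infinite support
in the case of flips, displaces some interval I. If u, v in D are supported in I, then gug⁻¹
commutes with both, so [[g, u], v] = [u⁻¹, v] lies in M. For exchanges of equally long intervals
this gives products of two "transpositions" sharing a letter. By halving, M contains every exchange
inside I, by conjugation every short exchange, and by subdivision every exchange. The exchanges
generate a normal subgroup S of 𝒢⁺. Insertion sort shows that rotations, which swap two adjacent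
intervals, generate 𝒢⁺, and so do the short ones. Two short rotations commute modulo S, because an
exchange moves one off the support of the other. So 𝒢⁺/S is abelian and D ≤ S ≤ M. Only
normalisation by D was used, whence D itself is simple.

From D to 𝒜⁺ (`affineIET_le_of_derivedIET_le`). An affine exchange of two disjoint intervals is a
commutator with an element of D, hence lies in M. So modulo M a map may be carried affinely to a
disjoint place. The class r(u, v) of a short rotation is therefore invariant under doubling both
lengths, yet additive in each length, so r = r⁴. Thus r³ = 1, and r(u, v) = r(u/3, v)³ = 1. A
two-piece affine "bump" is, up to rotations, a product of two bumps of the same shape and half the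
size. All these have one class φ, so φ = φ² and φ = 1. Sorting reduces any element to an increasing
one, which is a product of bumps.

From 𝒜⁺ to 𝒫𝒞⁺ (`generalisedIET_le_of_affineIET_le`). For an increasing f supported in a fundamental
interval of a contraction L towards b, the infinite product F = f · LfL⁻¹ · L²fL⁻² ⋯ satisfies F = f
· LFL⁻¹. This displays f as a commutator of F with an affine element. Fragmentation reduces an
increasing homeomorphism to such f.

From D to 𝒢 (`flipBijections_le_of_derivedIET_le`). Off a finite set a flip is a conjugate of an
exchange, and a rotation is a product of three flips; sorting again does the rest.

𝒢⁺ is not simple: for a ℚ-linear form φ the integral of φ(f x - x) is a homomorphism, because f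
preserves Lebesgue measure. It is nonzero on a suitable rotation, so D is a proper normal subgroup,
and D is nontrivial. -/

open Equiv Set
open scoped commutatorElement

namespace IntervalExchange

/-! ### Permutations with prescribed support, and exchanges of two disjoint sets. -/

section Permutations

variable {X : Type*}

theorem inv_apply_self (f : Perm X) (x : X) : f⁻¹ (f x) = x := f.symm_apply_apply x

theorem apply_inv_self (f : Perm X) (x : X) : f (f⁻¹ x) = x := f.apply_symm_apply x

theorem commute_of_fixed {f g : Perm X} {s : Set X} (hf : ∀ x ∉ s, f x = x)
    (hg : ∀ x ∈ s, g x = x) : Commute f g :=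
  Perm.Disjoint.commute fun x => by
    by_cases hx : x ∈ s
    · exact Or.inr (hg x hx)
    · exact Or.inl (hf x hx)

theorem inv_apply_of_fixed {f : Perm X} {x : X} (h : f x = x) : f⁻¹ x = x := by
  rw [Perm.inv_eq_iff_eq, h]

/-- The quotient l⁻¹k is the identity on a set carrying the support of f, so it commutes with f.
This later allows an affine map of the line to be replaced by an element of the group. -/
theorem conj_eq_of_eqOn {f k l : Perm X} {s : Set X} (hf : ∀ x ∉ s, f x = x)
    (h : ∀ x ∈ s, k x = l x) : k * f * k⁻¹ = l * f * l⁻¹ := by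
  have hc : Commute f (l⁻¹ * k) := commute_of_fixed hf fun x hx => by
    rw [Perm.mul_apply, h x hx, inv_apply_self]
  have e : k = l * (l⁻¹ * k) := by group
  calc k * f * k⁻¹ = l * (l⁻¹ * k * f) * k⁻¹ := by group
    _ = l * (f * (l⁻¹ * k)) * k⁻¹ := by rw [hc.eq]
    _ = l * f * l⁻¹ := by group

theorem mem_of_fixed_compl {f : Perm X} {s : Set X} (hf : ∀ x ∉ s, f x = x) {x : X}
    (hx : x ∈ s) : f x ∈ s := by
  by_contra h
  exact h (by rwa [f.injective (hf _ h)])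

theorem mem_of_fixed_compl_iff {f : Perm X} {s : Set X} (hf : ∀ x ∉ s, f x = x) {x : X} :
    f x ∈ s ↔ x ∈ s :=
  ⟨fun h => by
    by_contra hx
    exact hx (by rwa [hf x hx] at h), mem_of_fixed_compl hf⟩

theorem conj_fixed {f k : Perm X} {s t : Set X} (hf : ∀ x ∉ s, f x = x)
    (hk : ∀ x ∈ s, k x ∈ t) : ∀ x ∉ t, (k * f * k⁻¹) x = x := fun x hx => by
  have : f (k⁻¹ x) = k⁻¹ x := hf _ fun h => hx (by simpa using hk _ h)
  rw [Perm.mul_apply, Perm.mul_apply, this, apply_inv_self]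

open Classical in
/-- The involution exchanging `s` and `g '' s` by means of `g` (the identity when these two sets
are not disjoint). -/
noncomputable def swapOn (g : Perm X) (s : Set X) : Perm X :=
  if h : ∀ x ∈ s, g x ∉ s then
    Function.Involutive.toPerm
      (fun x => if x ∈ s then g x else if g.symm x ∈ s then g.symm x else x) (fun x => by
        by_cases hx : x ∈ s
        · simp [hx, h x hx]
        · by_cases hx' : g.symm x ∈ s
          · simp [hx, hx']
          · simp [hx, hx'])
  else 1

open Classical in
theorem swapOn_apply {g : Perm X} {s : Set X} (h : ∀ x ∈ s, g x ∉ s) (x : X) :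
    swapOn g s x = if x ∈ s then g x else if g.symm x ∈ s then g.symm x else x := by
  rw [swapOn, dif_pos h]
  rfl

theorem swapOn_apply_of_mem {g : Perm X} {s : Set X} (h : ∀ x ∈ s, g x ∉ s) {x : X}
    (hx : x ∈ s) : swapOn g s x = g x := by
  simp [swapOn_apply h, hx]

theorem swapOn_apply_image {g : Perm X} {s : Set X} (h : ∀ x ∈ s, g x ∉ s) {x : X}
    (hx : x ∈ s) : swapOn g s (g x) = x := by
  simp [swapOn_apply h, hx, h x hx]

theorem swapOn_apply_of_notMem {g : Perm X} {s : Set X} {x : X}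
    (hx : x ∉ s) (hx' : ∀ y ∈ s, g y ≠ x) : swapOn g s x = x := by
  have : g.symm x ∉ s := fun hs => hx' _ hs (by simp)
  by_cases h : ∀ x ∈ s, g x ∉ s
  · simp [swapOn_apply h, hx, this]
  · simp [swapOn, dif_neg h]

theorem eq_swapOn {f g : Perm X} {s : Set X} (h : ∀ x ∈ s, g x ∉ s)
    (h1 : ∀ x ∈ s, f x = g x) (h2 : ∀ x ∈ s, f (g x) = x)
    (h3 : ∀ x ∉ s, (∀ y ∈ s, g y ≠ x) → f x = x) : f = swapOn g s := by
  ext x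
  by_cases hx : x ∈ s
  · rw [h1 x hx, swapOn_apply_of_mem h hx]
  · by_cases hx' : ∃ y ∈ s, g y = x
    · obtain ⟨y, hy, rfl⟩ := hx'
      rw [h2 y hy, swapOn_apply_image h hy]
    · push Not at hx'
      rw [h3 x hx hx', swapOn_apply_of_notMem hx hx']

theorem swapOn_mul_self (g : Perm X) (s : Set X) : swapOn g s * swapOn g s = 1 := by
  by_cases h : ∀ x ∈ s, g x ∉ s
  · ext x
    simp only [swapOn, dif_pos h]
    exact Function.Involutive.toPerm_involutive _ x
  · simp [swapOn, dif_neg h]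

theorem swapOn_inv (g : Perm X) (s : Set X) : (swapOn g s)⁻¹ = swapOn g s :=
  inv_eq_of_mul_eq_one_left (swapOn_mul_self g s)

/-- An exchange is determined by its values on s and on the image of s, so an intertwining relation
on s alone suffices. -/
theorem conj_swapOn {k g g' : Perm X} {s : Set X} (h : ∀ x ∈ s, g x ∉ s)
    (hk : ∀ x ∈ s, k (g x) = g' (k x)) : k * swapOn g s * k⁻¹ = swapOn g' (k '' s) := by
  have h' : ∀ x ∈ k '' s, g' x ∉ k '' s := by
    rintro _ ⟨x, hx, rfl⟩ ⟨y, hy, hxy⟩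
    rw [← hk x hx] at hxy
    exact h x hx (k.injective hxy ▸ hy)
  apply eq_swapOn h'
  · rintro _ ⟨x, hx, rfl⟩
    simp [swapOn_apply_of_mem h hx, hk x hx]
  · rintro _ ⟨x, hx, rfl⟩
    rw [← hk x hx]
    simp [swapOn_apply_image h hx]
  · intro x hx hx'
    have : swapOn g s (k⁻¹ x) = k⁻¹ x := swapOn_apply_of_notMem
      (fun hs => hx ⟨_, hs, by simp⟩) fun y hy e => hx' (k y) ⟨y, hy, rfl⟩ (by
        rw [← hk y hy, e, apply_inv_self])
    rw [Perm.mul_apply, Perm.mul_apply, this, apply_inv_self]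

theorem swapOn_union {g : Perm X} {s t : Set X} (h : ∀ x ∈ s ∪ t, g x ∉ s ∪ t)
    (hst : ∀ x ∈ s, x ∉ t) : swapOn g (s ∪ t) = swapOn g s * swapOn g t := by
  have hs : ∀ x ∈ s, g x ∉ s := fun x hx h' => h x (Or.inl hx) (Or.inl h')
  have ht : ∀ x ∈ t, g x ∉ t := fun x hx h' => h x (Or.inr hx) (Or.inr h')
  have hs' : ∀ x ∈ s, g x ∉ t := fun x hx h' => h x (Or.inl hx) (Or.inr h')
  have ht' : ∀ x ∈ t, g x ∉ s := fun x hx h' => h x (Or.inr hx) (Or.inl h')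
  symm
  apply eq_swapOn h
  · rintro x (hx | hx)
    · rw [Perm.mul_apply, swapOn_apply_of_notMem (hst x hx) fun y hy e => ht' y hy (e ▸ hx),
        swapOn_apply_of_mem hs hx]
    · rw [Perm.mul_apply, swapOn_apply_of_mem ht hx, swapOn_apply_of_notMem (ht' x hx)]
      exact fun y hy e => hst y hy (g.injective e ▸ hx)
  · rintro x (hx | hx)
    · rw [Perm.mul_apply, swapOn_apply_of_notMem (hs' x hx)
        (fun y hy e => hst x hx (g.injective e ▸ hy)), swapOn_apply_image hs hx]
    · rw [Perm.mul_apply, swapOn_apply_image ht hx, swapOn_apply_of_notMem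
        (fun h' => hst x h' hx) fun y hy e => hs' y hy (e ▸ hx)]
  · intro x hx hx'
    rw [Perm.mul_apply, swapOn_apply_of_notMem (fun h' => hx (Or.inr h'))
      (fun y hy => hx' y (Or.inr hy)), swapOn_apply_of_notMem (fun h' => hx (Or.inl h'))
      (fun y hy => hx' y (Or.inl hy))]

end Permutations

/-! ### Induction over subintervals and over finite sets of cut points. -/

section Induction

/-- Compactness of `[a, b]` in the form of a supremum argument: the local property on the left shows
that the supremum is attained, the one on the right that it is b. -/
theorem interval_induction {a b : ℝ} (hab : a < b) (Q : ℝ → ℝ → Prop)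
    (hadd : ∀ x y z, a ≤ x → x < y → y < z → z ≤ b → Q x y → Q y z → Q x z)
    (hr : ∀ x, a ≤ x → x < b → ∃ y, x < y ∧ y ≤ b ∧ ∀ z, x < z → z ≤ y → Q x z)
    (hl : ∀ x, a < x → x ≤ b → ∃ y, y < x ∧ a ≤ y ∧ ∀ z, y ≤ z → z < x → Q z x) : Q a b := by
  set S : Set ℝ := {x | a < x ∧ x ≤ b ∧ Q a x} with hS
  obtain ⟨y0, h1, h2, h3⟩ := hr a le_rfl hab
  have hy0 : y0 ∈ S := ⟨h1, h2, h3 y0 h1 le_rfl⟩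
  have hbdd : BddAbove S := ⟨b, fun x hx => hx.2.1⟩
  set s := sSup S with hs
  have has : a < s := h1.trans_le (le_csSup hbdd hy0)
  have hsb : s ≤ b := csSup_le ⟨y0, hy0⟩ fun x hx => hx.2.1
  have hQs : Q a s := by
    obtain ⟨y, hys, hay, hy⟩ := hl s has hsb
    obtain ⟨z, hz, hyz⟩ := exists_lt_of_lt_csSup ⟨y0, hy0⟩ hys
    rcases (le_csSup hbdd hz).lt_or_eq with h | h
    · exact hadd a z s le_rfl hz.1 h hsb hz.2.2 (hy z hyz.le h)
    · have hz' : z = s := h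
      rw [← hz']; exact hz.2.2
  rcases hsb.lt_or_eq with h | h
  · obtain ⟨y, hy, hyb, h'⟩ := hr s has.le h
    have : y ∈ S := ⟨has.trans hy, hyb, hadd a s y le_rfl has hy hyb hQs (h' y hy le_rfl)⟩
    exact absurd (le_csSup hbdd this) (not_le.2 hy)
  · rwa [h] at hQs

/-- The new point is the next cut point, or b. Its being one of these lets the greedy arguments
below advance from cut point to cut point. -/
theorem exists_gap_right {P : Set ℝ} (hP : P.Finite) (x : ℝ) {b : ℝ} (hb : x < b) :
    ∃ y, x < y ∧ y ≤ b ∧ (y ∈ P ∨ y = b) ∧ ∀ p ∈ P, p ≤ x ∨ y ≤ p := by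
  obtain ⟨m, hm, h⟩ := ((hP.subset (inter_subset_left (t := Ioi x))).union
    (finite_singleton b)).exists_minimalFor id _ ⟨b, Or.inr rfl⟩
  refine ⟨m, ?_, ?_, hm.imp_left And.left, fun p hp => ?_⟩
  · rcases hm with hm | rfl
    · exact hm.2
    · exact hb
  · by_contra hlt
    exact hlt (h (Or.inr rfl) (not_le.1 hlt).le)
  · rcases le_or_gt p x with hpx | hpx
    · exact Or.inl hpx
    · right
      by_contra hlt
      exact hlt (h (Or.inl ⟨hp, hpx⟩) (not_le.1 hlt).le)

theorem exists_gap_left {P : Set ℝ} (hP : P.Finite) (x : ℝ) {a : ℝ} (ha : a < x) :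
    ∃ y, y < x ∧ a ≤ y ∧ ∀ p ∈ P, p ≤ y ∨ x ≤ p := by
  obtain ⟨y, h1, h2, -, h3⟩ := exists_gap_right (hP.image Neg.neg) (-x) (neg_lt_neg ha)
  refine ⟨-y, by linarith, by linarith, fun p hp => ?_⟩
  rcases h3 (-p) ⟨p, hp, rfl⟩ with h | h
  · right; linarith
  · left; linarith

/-- The condition on P says that no cut point lies strictly between c and d; near any point, on
either side, this holds because P is finite. -/
theorem gap_induction {a b : ℝ} (hab : a < b) {P : Set ℝ} (hP : P.Finite) (Q : ℝ → ℝ → Prop)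
    (hadd : ∀ x y z, a ≤ x → x < y → y < z → z ≤ b → Q x y → Q y z → Q x z)
    (h : ∀ c d, a ≤ c → c < d → d ≤ b → (∀ p ∈ P, p ≤ c ∨ d ≤ p) → Q c d) : Q a b := by
  refine interval_induction hab Q hadd (fun x hx hxb => ?_) fun x hx hxb => ?_
  · obtain ⟨y, h1, h2, -, h3⟩ := exists_gap_right hP x hxb
    refine ⟨y, h1, h2, fun z hz hzy => h x z hx hz (hzy.trans h2) fun p hp => ?_⟩
    exact (h3 p hp).imp_right hzy.trans
  · obtain ⟨y, h1, h2, h3⟩ := exists_gap_left hP x hx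
    refine ⟨y, h1, h2, fun z hz hzx => h z x (h2.trans hz) hzx hxb fun p hp => ?_⟩
    exact (h3 p hp).imp_left fun h => h.trans hz

end Induction

/-! ### Partitions into pieces replaced by finite sets of cut points. -/

section Membership

variable {a b : ℝ}

theorem exists_partition_of_gap {Good : Set (Ico a b) → Prop} {P : Set ℝ} (hP : P.Finite)
    (h : ∀ c d, a ≤ c → c < d → d ≤ b → (∀ p ∈ P, p ≤ c ∨ d ≤ p) →
      ∃ S : Set (Set (Ico a b)), S.Finite ∧ ⋃₀ S = {x | c ≤ x.1 ∧ x.1 < d} ∧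
        S.PairwiseDisjoint id ∧ ∀ s ∈ S, s.Nonempty ∧ Good s) :
    ∃ S : Set (Set (Ico a b)), S.Finite ∧ Setoid.IsPartition S ∧ ∀ s ∈ S, Good s := by
  by_cases hab : a < b
  · obtain ⟨S, h1, h2, h3, h4⟩ := gap_induction hab hP (fun c d =>
      ∃ S : Set (Set (Ico a b)), S.Finite ∧ ⋃₀ S = {x | c ≤ x.1 ∧ x.1 < d} ∧
        S.PairwiseDisjoint id ∧ ∀ s ∈ S, s.Nonempty ∧ Good s) (by
        rintro x y z hx hxy hyz hz ⟨S, h1, h2, h3, h4⟩ ⟨T, g1, g2, g3, g4⟩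
        refine ⟨S ∪ T, h1.union g1, ?_, ?_, ?_⟩
        · rw [sUnion_union, h2, g2]
          ext w
          simp only [mem_union, mem_ofPred_eq]
          constructor
          · rintro (h | h) <;> constructor <;> linarith [h.1, h.2]
          · rintro ⟨h, h'⟩
            rcases lt_or_ge w.1 y with hw | hw
            · exact Or.inl ⟨h, hw⟩
            · exact Or.inr ⟨hw, h'⟩
        · rw [pairwiseDisjoint_union]
          refine ⟨h3, g3, fun s hs t ht _ => ?_⟩
          change Disjoint s t
          rw [Set.disjoint_left]
          intro w hws hwt
          have e1 : w ∈ ⋃₀ S := ⟨s, hs, hws⟩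
          have e2 : w ∈ ⋃₀ T := ⟨t, ht, hwt⟩
          rw [h2] at e1
          rw [g2] at e2
          exact absurd e1.2 (not_lt.2 e2.1)
        · rintro s (hs | hs)
          exacts [h4 s hs, g4 s hs]) h
    refine ⟨S, h1, ⟨fun h0 => (h4 _ h0).1.ne_empty rfl, fun x => ?_⟩, fun s hs => (h4 s hs).2⟩
    have hx : x ∈ ⋃₀ S := by rw [h2]; exact x.2
    obtain ⟨s, hs, hxs⟩ := hx
    refine ⟨s, ⟨hs, hxs⟩, ?_⟩
    rintro t ⟨ht, hxt⟩
    by_contra hne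
    exact Set.disjoint_left.1 (h3 ht hs hne) hxt hxs
  · refine ⟨∅, finite_empty, ⟨by simp, fun x => ?_⟩, by simp⟩
    exact absurd (x.2.1.trans_lt x.2.2) hab

theorem image_val_setOf_Ico {c d : ℝ} (hc : a ≤ c) (hd : d ≤ b) :
    Subtype.val '' {x : Ico a b | c ≤ x.1 ∧ x.1 < d} = Ico c d := by
  ext y
  constructor
  · rintro ⟨x, hx, rfl⟩
    exact hx
  · rintro ⟨h1, h2⟩
    exact ⟨⟨y, hc.trans h1, h2.trans_le hd⟩, ⟨h1, h2⟩, rfl⟩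

theorem image_val_setOf_Ioo {c d : ℝ} (hc : a ≤ c) (hd : d ≤ b) :
    Subtype.val '' {x : Ico a b | c < x.1 ∧ x.1 < d} = Ioo c d := by
  ext y
  constructor
  · rintro ⟨x, hx, rfl⟩
    exact hx
  · rintro ⟨h1, h2⟩
    exact ⟨⟨y, hc.trans h1.le, h2.trans_le hd⟩, ⟨h1, h2⟩, rfl⟩

theorem mem_of_image_val {s : Set (Ico a b)} {t : Set ℝ} (h : Subtype.val '' s = t)
    {x : Ico a b} : x ∈ s ↔ x.1 ∈ t := by
  rw [← h, Subtype.val_injective.mem_set_image]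

/-- The endpoints of the pieces serve as cut points. Conversely, the gaps between consecutive cut
points form a partition. Cut sets may be enlarged freely, which partitions do not allow. -/
theorem isPiecewise_halfOpen_iff {Local : Perm (Ico a b) → Set (Ico a b) → Prop}
    (hmono : ∀ f s t, t ⊆ s → Local f s → Local f t) (f : Perm (Ico a b)) :
    IsPiecewise IsHalfOpenPiece Local f ↔ ∃ P : Set ℝ, P.Finite ∧ ∀ c d, a ≤ c → c < d → d ≤ b →
      (∀ p ∈ P, p ≤ c ∨ d ≤ p) → Local f {x | c ≤ x.1 ∧ x.1 < d} := by
  constructor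
  · rintro ⟨S, h1, ⟨-, h2⟩, h3⟩
    choose! u v huv hs using fun s hs => (h3 s hs).1
    refine ⟨u '' S ∪ v '' S, (h1.image _).union (h1.image _), fun c d hc hcd hd hp => ?_⟩
    -- The piece through the midpoint contains all of `[c, d)`, since its endpoints are cut points.
    obtain ⟨s, ⟨hsS, hx⟩, -⟩ := h2 ⟨(c + d) / 2, by constructor <;> linarith⟩
    rw [mem_of_image_val (hs s hsS)] at hx
    obtain ⟨hx1, hx2⟩ := hx
    simp only at hx1 hx2
    refine hmono f s _ (fun x hx => (mem_of_image_val (hs s hsS)).2 ?_) (h3 s hsS).2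
    have e1 := hp (u s) (Or.inl ⟨s, hsS, rfl⟩)
    have e2 := hp (v s) (Or.inr ⟨s, hsS, rfl⟩)
    constructor
    · rcases e1 with e | e <;> linarith [hx.1]
    · rcases e2 with e | e <;> linarith [hx.2]
  · rintro ⟨P, hP, h⟩
    refine exists_partition_of_gap hP fun c d hc hcd hd hp => ⟨{{x | c ≤ x.1 ∧ x.1 < d}},
      finite_singleton _, by simp, by simp, ?_⟩
    rintro _ rfl
    exact ⟨⟨⟨c, hc, hcd.trans_le hd⟩, le_rfl, hcd⟩, ⟨c, d, hcd, image_val_setOf_Ico hc hd⟩,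
      h c d hc hcd hd hp⟩

theorem isPiecewise_pointOrOpen_iff {Local : Perm (Ico a b) → Set (Ico a b) → Prop}
    (hmono : ∀ f s t, t ⊆ s → Local f s → Local f t) (hpt : ∀ f x, Local f {x})
    (f : Perm (Ico a b)) :
    IsPiecewise IsPointOrOpenPiece Local f ↔ ∃ P : Set ℝ, P.Finite ∧ ∀ c d, a ≤ c → c < d →
      d ≤ b → (∀ p ∈ P, p ≤ c ∨ d ≤ p) → Local f {x | c < x.1 ∧ x.1 < d} := by
  constructor
  · rintro ⟨S, h1, ⟨-, h2⟩, h3⟩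
    -- A one-point piece contributes its point as a cut point, so it cannot contain the midpoint of
    -- a gap; the remaining values are dummies.
    have : ∀ s, ∃ u v : ℝ, s ∈ S → (∃ x, s = {x} ∧ x.1 = u) ∨ Subtype.val '' s = Ioo u v := by
      intro s
      by_cases hs : s ∈ S
      · rcases (h3 s hs).1 with ⟨x, hx⟩ | ⟨c, d, -, h⟩
        · exact ⟨x, 0, fun _ => Or.inl ⟨x, hx, rfl⟩⟩
        · exact ⟨c, d, fun _ => Or.inr h⟩
      · exact ⟨0, 0, fun h => absurd h hs⟩
    choose u v hs using this
    refine ⟨u '' S ∪ v '' S, (h1.image _).union (h1.image _), fun c d hc hcd hd hp => ?_⟩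
    obtain ⟨s, ⟨hsS, hx⟩, -⟩ := h2 ⟨(c + d) / 2, by constructor <;> linarith⟩
    have e1 := hp (u s) (Or.inl ⟨s, hsS, rfl⟩)
    have e2 := hp (v s) (Or.inr ⟨s, hsS, rfl⟩)
    rcases hs s hsS with ⟨x, h, h'⟩ | h
    · rw [h] at hx
      rw [← h', ← mem_singleton_iff.1 hx] at e1
      simp only at e1
      rcases e1 with e | e <;> linarith
    · rw [mem_of_image_val h] at hx
      obtain ⟨hx1, hx2⟩ := hx
      simp only at hx1 hx2
      refine hmono f s _ (fun x hx => (mem_of_image_val h).2 ?_) (h3 s hsS).2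
      constructor
      · rcases e1 with e | e <;> linarith [hx.1]
      · rcases e2 with e | e <;> linarith [hx.2]
  · rintro ⟨P, hP, h⟩
    refine exists_partition_of_gap hP fun c d hc hcd hd hp =>
      ⟨{{⟨c, hc, hcd.trans_le hd⟩}, {x | c < x.1 ∧ x.1 < d}}, by simp, ?_, ?_, ?_⟩
    · ext x
      simp only [sUnion_insert, sUnion_singleton, mem_union, mem_singleton_iff, mem_ofPred_eq,
        Subtype.ext_iff]
      constructor
      · rintro (h | h)
        · exact ⟨h.ge, by linarith⟩
        · exact ⟨h.1.le, h.2⟩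
      · rintro ⟨h1, h2⟩
        rcases h1.lt_or_eq with h | h
        · exact Or.inr ⟨h, h2⟩
        · exact Or.inl h.symm
    · have hdis : Disjoint ({⟨c, hc, hcd.trans_le hd⟩} : Set (Ico a b))
          {x | c < x.1 ∧ x.1 < d} := by simp
      exact pairwise_pair.2 fun _ => ⟨hdis, hdis.symm⟩
    · rintro _ (rfl | rfl)
      · exact ⟨⟨_, rfl⟩, Or.inl ⟨_, rfl⟩, hpt _ _⟩
      · exact ⟨⟨⟨(c + d) / 2, by constructor <;> linarith⟩, by constructor <;> simp only <;> linarith⟩,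
          Or.inr ⟨c, d, hcd, image_val_setOf_Ioo hc hd⟩, h c d hc hcd hd hp⟩

end Membership

/-! ### Passage from bijections of `[a, b)` to permutations of the line. -/

section Extension

variable {a b : ℝ}

open Classical in
/-- Extension of a bijection of `[a, b)` to a bijection of the line, by the identity. -/
noncomputable def extend (a b : ℝ) : Perm (Ico a b) →* Perm ℝ := Perm.ofSubtype

theorem extend_apply (f : Perm (Ico a b)) (x : Ico a b) : extend a b f x = f x :=
  Perm.ofSubtype_apply_coe f x

theorem extend_apply_of_notMem (f : Perm (Ico a b)) {x : ℝ} (hx : x ∉ Ico a b) :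
    extend a b f x = x :=
  Perm.ofSubtype_apply_of_not_mem f hx

theorem extend_injective : Function.Injective (extend a b) :=
  Perm.ofSubtype_injective

theorem exists_extend_eq {f : Perm ℝ} (hf : ∀ x ∉ Ico a b, f x = x) :
    ∃ g, extend a b g = f := by
  refine ⟨f.subtypePerm fun x => mem_of_fixed_compl_iff hf, ?_⟩
  ext x
  by_cases hx : x ∈ Ico a b
  · exact extend_apply _ ⟨x, hx⟩
  · rw [extend_apply_of_notMem _ hx, hf x hx]

/-- `f` is a translation on `s`. -/
def TransOn (f : ℝ → ℝ) (s : Set ℝ) : Prop := ∃ β, ∀ x ∈ s, f x = x + β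

/-- `f` is an increasing affine map on `s`. -/
def PosAffOn (f : ℝ → ℝ) (s : Set ℝ) : Prop := ∃ l β, 0 < l ∧ ∀ x ∈ s, f x = l * x + β

/-- `f` is continuous and strictly increasing on `s`. -/
def IncOn (f : ℝ → ℝ) (s : Set ℝ) : Prop := ContinuousOn f s ∧ StrictMonoOn f s

/-- `f` is affine of slope `1` or `-1` on `s`. -/
def IsomOn (f : ℝ → ℝ) (s : Set ℝ) : Prop := ∃ l β, (l = 1 ∨ l = -1) ∧ ∀ x ∈ s, f x = l * x + β

theorem transOn_extend {f : Perm (Ico a b)} {s : Set (Ico a b)} :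
    TransOn (extend a b f) (Subtype.val '' s) ↔ IsTranslationOn f s := by
  simp only [TransOn, IsTranslationOn, forall_mem_image, extend_apply]

theorem posAffOn_extend {f : Perm (Ico a b)} {s : Set (Ico a b)} :
    PosAffOn (extend a b f) (Subtype.val '' s) ↔ IsPosAffineOn f s := by
  simp only [PosAffOn, IsPosAffineOn, forall_mem_image, extend_apply]

theorem isomOn_extend {f : Perm (Ico a b)} {s : Set (Ico a b)} :
    IsomOn (extend a b f) (Subtype.val '' s) ↔ IsIsometricAffineOn f s := by
  simp only [IsomOn, IsIsometricAffineOn, forall_mem_image, extend_apply]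

theorem incOn_extend {f : Perm (Ico a b)} {s : Set (Ico a b)} :
    IncOn (extend a b f) (Subtype.val '' s) ↔ IsIncreasingHomeoOn f s := by
  have e : (extend a b f : ℝ → ℝ) ∘ Subtype.val = Subtype.val ∘ f :=
    funext fun x => extend_apply f x
  unfold IncOn IsIncreasingHomeoOn
  refine and_congr ?_ ?_
  · rw [Topology.IsInducing.subtypeVal.continuousOn_image_iff, e,
      ← Topology.IsInducing.subtypeVal.continuousOn_iff]
  · simp only [StrictMonoOn, forall_mem_image, extend_apply, Subtype.coe_lt_coe]

/-- Outside `[a, b)` the bijection `f` is the identity, and `[a, b)` can be cut at finitely many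
points in such a way that `f` has the property `Q` on the intervals between them. -/
def CutGood (Q : (ℝ → ℝ) → ℝ → ℝ → Prop) (a b : ℝ) (f : Perm ℝ) : Prop :=
  (∀ x ∉ Ico a b, f x = x) ∧ ∃ P : Set ℝ, P.Finite ∧ ∀ c d, a ≤ c → c < d → d ≤ b →
    (∀ p ∈ P, p ≤ c ∨ d ≤ p) → Q f c d

theorem mem_map_extend_iff {H : Subgroup (Perm (Ico a b))} {Q : (ℝ → ℝ) → ℝ → ℝ → Prop}
    (h : ∀ f, f ∈ H ↔ ∃ P : Set ℝ, P.Finite ∧ ∀ c d, a ≤ c → c < d → d ≤ b →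
      (∀ p ∈ P, p ≤ c ∨ d ≤ p) → Q (extend a b f) c d) {f : Perm ℝ} :
    f ∈ H.map (extend a b) ↔ CutGood Q a b f := by
  constructor
  · rintro ⟨g, hg, rfl⟩
    exact ⟨fun x => extend_apply_of_notMem g, (h g).1 hg⟩
  · rintro ⟨h1, h2⟩
    obtain ⟨g, rfl⟩ := exists_extend_eq h1
    exact ⟨g, (h g).2 h2, rfl⟩

theorem mem_iet_extend {f : Perm ℝ} : f ∈ (iet a b).map (extend a b) ↔
    CutGood (fun f c d => TransOn f (Ico c d)) a b f := by
  refine mem_map_extend_iff fun f => (isPiecewise_halfOpen_iff (Local := IsTranslationOn)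
    (fun _ _ _ hts ⟨β, h⟩ => ⟨β, fun x hx => h x (hts hx)⟩) f).trans ?_
  refine exists_congr fun P => and_congr_right fun _ => forall₂_congr fun c d =>
    forall₃_congr fun hc hcd hd => forall_congr' fun _ => ?_
  rw [← transOn_extend, image_val_setOf_Ico hc hd]

theorem mem_affineIET_extend {f : Perm ℝ} : f ∈ (affineIET a b).map (extend a b) ↔
    CutGood (fun f c d => PosAffOn f (Ico c d)) a b f := by
  refine mem_map_extend_iff fun f => (isPiecewise_halfOpen_iff (Local := IsPosAffineOn)
    (fun _ _ _ hts ⟨l, β, hl, h⟩ => ⟨l, β, hl, fun x hx => h x (hts hx)⟩) f).trans ?_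
  refine exists_congr fun P => and_congr_right fun _ => forall₂_congr fun c d =>
    forall₃_congr fun hc hcd hd => forall_congr' fun _ => ?_
  rw [← posAffOn_extend, image_val_setOf_Ico hc hd]

theorem mem_generalisedIET_extend {f : Perm ℝ} : f ∈ (generalisedIET a b).map (extend a b) ↔
    CutGood (fun f c d => IncOn f (Ico c d)) a b f := by
  refine mem_map_extend_iff fun f => (isPiecewise_halfOpen_iff (Local := IsIncreasingHomeoOn)
    (fun _ _ _ hts h => ⟨h.1.mono hts, h.2.mono hts⟩) f).trans ?_
  refine exists_congr fun P => and_congr_right fun _ => forall₂_congr fun c d =>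
    forall₃_congr fun hc hcd hd => forall_congr' fun _ => ?_
  rw [← incOn_extend, image_val_setOf_Ico hc hd]

theorem mem_flipBijections_extend {f : Perm ℝ} : f ∈ (flipBijections a b).map (extend a b) ↔
    CutGood (fun f c d => IsomOn f (Ioo c d)) a b f := by
  refine mem_map_extend_iff fun f => (isPiecewise_pointOrOpen_iff (Local := IsIsometricAffineOn)
    (fun _ _ _ hts ⟨l, β, hl, h⟩ => ⟨l, β, hl, fun x hx => h x (hts hx)⟩)
    (fun f x => ⟨1, f x - x, Or.inl rfl, by simp⟩) f).trans ?_
  refine exists_congr fun P => and_congr_right fun _ => forall₂_congr fun c d =>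
    forall₃_congr fun hc hcd hd => forall_congr' fun _ => ?_
  rw [← isomOn_extend, image_val_setOf_Ioo hc hd]

theorem TransOn.posAffOn {f : ℝ → ℝ} {s : Set ℝ} (h : TransOn f s) : PosAffOn f s :=
  let ⟨β, h⟩ := h
  ⟨1, β, one_pos, by simpa using h⟩

theorem TransOn.isomOn {f : ℝ → ℝ} {s : Set ℝ} (h : TransOn f s) : IsomOn f s :=
  let ⟨β, h⟩ := h
  ⟨1, β, Or.inl rfl, by simpa using h⟩

theorem TransOn.mono {f : ℝ → ℝ} {s t : Set ℝ} (h : TransOn f s) (hts : t ⊆ s) : TransOn f t :=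
  let ⟨β, h⟩ := h
  ⟨β, fun x hx => h x (hts hx)⟩

theorem PosAffOn.incOn {f : ℝ → ℝ} {s : Set ℝ} (h : PosAffOn f s) : IncOn f s := by
  obtain ⟨l, β, hl, h⟩ := h
  refine ⟨ContinuousOn.congr (f := fun x => l * x + β) (by fun_prop) h, fun x hx y hy hxy => ?_⟩
  rw [h x hx, h y hy]
  gcongr

theorem CutGood.imp {Q Q' : (ℝ → ℝ) → ℝ → ℝ → Prop} {f : Perm ℝ} (hf : CutGood Q a b f)
    (h : ∀ c d, Q f c d → Q' f c d) : CutGood Q' a b f :=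
  let ⟨h1, P, h2, h3⟩ := hf
  ⟨h1, P, h2, fun c d hc hcd hd hp => h c d (h3 c d hc hcd hd hp)⟩

theorem iet_le_affineIET_extend :
    (iet a b).map (extend a b) ≤ (affineIET a b).map (extend a b) := fun _ hf =>
  mem_affineIET_extend.2 ((mem_iet_extend.1 hf).imp fun _ _ => TransOn.posAffOn)

theorem affineIET_le_generalisedIET_extend :
    (affineIET a b).map (extend a b) ≤ (generalisedIET a b).map (extend a b) := fun _ hf =>
  mem_generalisedIET_extend.2 ((mem_affineIET_extend.1 hf).imp fun _ _ => PosAffOn.incOn)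

theorem iet_le_flipBijections_extend :
    (iet a b).map (extend a b) ≤ (flipBijections a b).map (extend a b) := fun _ hf =>
  mem_flipBijections_extend.2
    ((mem_iet_extend.1 hf).imp fun _ _ h => (h.mono Ioo_subset_Ico_self).isomOn)

end Extension

/-! ### Exchanges of two intervals of equal length. -/

section TranslationSwaps

/-- The intervals `[c, c + l)` and `[c', c' + l)` are disjoint. -/
def Apart (l c c' : ℝ) : Prop := c + l ≤ c' ∨ c' + l ≤ c

theorem Apart.symm {l c c' : ℝ} (h : Apart l c c') : Apart l c' c := Or.symm h

/-- The involution of the line exchanging `[c, c + l)` and `[c', c' + l)` by translations. -/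
noncomputable def tsw (l c c' : ℝ) : Perm ℝ := swapOn (Equiv.addRight (c' - c)) (Ico c (c + l))

variable {l c c' x : ℝ}

theorem Apart.disjoint (h : Apart l c c') :
    ∀ x ∈ Ico c (c + l), Equiv.addRight (c' - c) x ∉ Ico c (c + l) := by
  rintro x ⟨h1, h2⟩ ⟨h3, h4⟩
  simp only [Equiv.coe_addRight] at h3 h4
  rcases h with h | h <;> linarith

theorem tsw_left (h : Apart l c c') (h1 : c ≤ x) (h2 : x < c + l) :
    tsw l c c' x = x + (c' - c) :=
  swapOn_apply_of_mem h.disjoint ⟨h1, h2⟩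

theorem tsw_right (h : Apart l c c') (h1 : c' ≤ x) (h2 : x < c' + l) :
    tsw l c c' x = x + (c - c') := by
  have := swapOn_apply_image h.disjoint (x := x + (c - c'))
    ⟨by linarith, by linarith⟩
  rwa [show Equiv.addRight (c' - c) (x + (c - c')) = x by
    rw [Equiv.coe_addRight]; ring] at this

theorem tsw_other (h1 : x < c ∨ c + l ≤ x) (h2 : x < c' ∨ c' + l ≤ x) : tsw l c c' x = x := by
  apply swapOn_apply_of_notMem
  · rintro ⟨h3, h4⟩
    rcases h1 with h | h <;> linarith
  · rintro y ⟨h3, h4⟩ h5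
    simp only [Equiv.coe_addRight] at h5
    rcases h2 with h | h <;> linarith

theorem tsw_mul_self (l c c' : ℝ) : tsw l c c' * tsw l c c' = 1 := swapOn_mul_self _ _

theorem tsw_inv (l c c' : ℝ) : (tsw l c c')⁻¹ = tsw l c c' := swapOn_inv _ _

theorem conj_tsw (h : Apart l c c') {k : Perm ℝ} {d d' : ℝ}
    (h1 : ∀ x, c ≤ x → x < c + l → k x = x + (d - c))
    (h2 : ∀ x, c' ≤ x → x < c' + l → k x = x + (d' - c')) :
    k * tsw l c c' * k⁻¹ = tsw l d d' := by
  have e : k '' Ico c (c + l) = Ico d (d + l) := by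
    ext y
    constructor
    · rintro ⟨x, hx, rfl⟩
      rw [h1 x hx.1 hx.2]
      constructor <;> linarith [hx.1, hx.2]
    · rintro ⟨h3, h4⟩
      refine ⟨y + (c - d), ⟨by linarith, by linarith⟩, ?_⟩
      rw [h1 _ (by linarith) (by linarith)]
      ring
  rw [tsw, conj_swapOn (g' := Equiv.addRight (d' - d)) h.disjoint, e, tsw]
  intro x hx
  simp only [Equiv.coe_addRight]
  rw [h1 x hx.1 hx.2, h2 _ (by linarith [hx.1]) (by linarith [hx.2])]
  ring

theorem tsw_symm (h : Apart l c c') : tsw l c c' = tsw l c' c := by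
  have := conj_tsw h (k := tsw l c c') (d := c') (d' := c) (fun x => tsw_left h)
    (fun x => tsw_right h)
  rwa [tsw_mul_self, one_mul, tsw_inv] at this

/-- The relation (12)(23)(12) = (13) between transpositions, with intervals as letters. -/
theorem tsw_triple {c'' : ℝ} (h : Apart l c c') (h' : Apart l c' c'') (h'' : Apart l c c'') :
    tsw l c c' * tsw l c' c'' * tsw l c c' = tsw l c c'' := by
  have := conj_tsw h' (k := tsw l c c') (d := c) (d' := c'') (fun x => tsw_right h)
    (fun x h1 h2 => by
      rw [tsw_other, sub_self, add_zero]
      · rcases h'' with h | h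
        · right; linarith
        · left; linarith
      · rcases h' with h | h
        · right; linarith
        · left; linarith)
  rwa [tsw_inv] at this

theorem tsw_add {l' : ℝ} (hl : 0 ≤ l) (hl' : 0 ≤ l') (h : Apart (l + l') c c') :
    tsw (l + l') c c' = tsw l c c' * tsw l' (c + l) (c' + l) := by
  have e : Ico c (c + (l + l')) = Ico c (c + l) ∪ Ico (c + l) (c + l + l') := by
    rw [Ico_union_Ico_eq_Ico (by linarith) (by linarith), add_assoc]
  have h' := h.disjoint
  rw [e] at h'
  rw [tsw, e, swapOn_union h' fun x hx hx' => absurd hx.2 (not_lt.2 hx'.1), tsw, tsw,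
    add_sub_add_right_eq_sub]

variable {a b : ℝ}

theorem tsw_mem_iet (h : Apart l c c') (h1 : a ≤ c) (h2 : c + l ≤ b) (h3 : a ≤ c')
    (h4 : c' + l ≤ b) : tsw l c c' ∈ (iet a b).map (extend a b) := by
  rw [mem_iet_extend]
  refine ⟨fun x hx => ?_, {c, c + l, c', c' + l}, by simp, fun u v hu huv hv hp => ?_⟩
  · rw [mem_Ico, not_and_or, not_le, not_lt] at hx
    apply tsw_other
    · rcases hx with hx | hx
      · left; linarith
      · right; linarith
    · rcases hx with hx | hx
      · left; linarith
      · right; linarith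
  · simp only [mem_insert_iff, mem_singleton_iff, forall_eq_or_imp, forall_eq] at hp
    obtain ⟨p1, p2, p3, p4⟩ := hp
    by_cases hA : c ≤ u ∧ v ≤ c + l
    · exact ⟨c' - c, fun x hx => tsw_left h (hA.1.trans hx.1) (hx.2.trans_le hA.2)⟩
    by_cases hB : c' ≤ u ∧ v ≤ c' + l
    · exact ⟨c - c', fun x hx => tsw_right h (hB.1.trans hx.1) (hx.2.trans_le hB.2)⟩
    refine ⟨0, fun x hx => ?_⟩
    rw [add_zero]
    rw [not_and_or, not_le, not_le] at hA hB
    apply tsw_other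
    · rcases hA with hA | hA
      · left
        rcases p1 with p1 | p1 <;> linarith [hx.2]
      · right
        rcases p2 with p2 | p2 <;> linarith [hx.1]
    · rcases hB with hA | hA
      · left
        rcases p3 with p1 | p1 <;> linarith [hx.2]
      · right
        rcases p4 with p2 | p2 <;> linarith [hx.1]

/-- Cut both intervals in half. The exchange is the product of the exchange t of the left halves and
that of the right halves. The latter is a conjugate of t, and t is an involution, so the product is
a commutator. -/
theorem tsw_mem_commutator (hl : 0 ≤ l) (h : Apart l c c') (h1 : a ≤ c) (h2 : c + l ≤ b)
    (h3 : a ≤ c') (h4 : c' + l ≤ b) :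
    tsw l c c' ∈ ⁅(iet a b).map (extend a b), (iet a b).map (extend a b)⁆ := by
  have hA : Apart (l / 2) c c' := h.imp (fun h => by linarith) fun h => by linarith
  have hB : Apart (l / 2) c (c + l / 2) := Or.inl le_rfl
  have hB' : Apart (l / 2) c' (c' + l / 2) := Or.inl le_rfl
  -- The conjugating element carries each left half onto the right half of the same interval.
  set k := tsw (l / 2) c (c + l / 2) * tsw (l / 2) c' (c' + l / 2) with hk
  have hkm : k ∈ (iet a b).map (extend a b) := mul_mem
    (tsw_mem_iet hB (by linarith) (by linarith) (by linarith) (by linarith))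
    (tsw_mem_iet hB' (by linarith) (by linarith) (by linarith) (by linarith))
  have e1 : k * tsw (l / 2) c c' * k⁻¹ = tsw (l / 2) (c + l / 2) (c' + l / 2) := by
    apply conj_tsw hA
    · intro x hx hx'
      rw [hk, Perm.mul_apply, tsw_other (c := c'), tsw_left hB hx hx']
      · rcases h with h | h
        · left; linarith
        · right; linarith
      · rcases h with h | h
        · left; linarith
        · right; linarith
    · intro x hx hx'
      rw [hk, Perm.mul_apply, tsw_left hB' hx hx', tsw_other]
      · rcases h with h | h
        · right; linarith
        · left; linarith
      · rcases h with h | h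
        · right; linarith
        · left; linarith
  have e2 : tsw l c c' = ⁅tsw (l / 2) c c', k⁆ := by
    have := tsw_add (l := l / 2) (l' := l / 2) (c := c) (c' := c') (by linarith) (by linarith)
      (by rwa [add_halves])
    rw [add_halves] at this
    rw [this, commutatorElement_def, ← e1, tsw_inv]
    simp only [mul_assoc]
  rw [e2]
  exact Subgroup.commutator_mem_commutator
    (tsw_mem_iet hA (by linarith) (by linarith) (by linarith) (by linarith)) hkm

end TranslationSwaps

/-! ### Rotations: exchanges of two adjacent intervals. -/

section Rotations

/-- The bijection of the line exchanging the adjacent intervals `[x, y)` and `[y, z)` by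
translations. -/
noncomputable def rot (x y z : ℝ) : Perm ℝ :=
  if h : x ≤ y ∧ y ≤ z then
    { toFun := fun w => if w < x ∨ z ≤ w then w else if w < y then w + (z - y) else w + (x - y)
      invFun := fun w => if w < x ∨ z ≤ w then w else
        if w < x + (z - y) then w + (y - x) else w + (y - z)
      left_inv := fun w => by
        obtain ⟨h1, h2⟩ := h
        by_cases hw : w < x ∨ z ≤ w
        · simp [hw]
        · have hw' := hw
          push Not at hw'
          by_cases hy : w < y
          · have g1 : ¬ (w + (z - y) < x ∨ z ≤ w + (z - y)) := by
              push Not; constructor <;> linarith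
            have g2 : ¬ (w + (z - y) < x + (z - y)) := by linarith [hw'.1]
            simp only [hw, hy, g1, g2, if_true, if_false]
            ring
          · have g1 : ¬ (w + (x - y) < x ∨ z ≤ w + (x - y)) := by
              push Not; constructor <;> linarith
            have g2 : w + (x - y) < x + (z - y) := by linarith [hw'.2]
            simp only [hw, hy, g1, g2, if_true, if_false]
            ring
      right_inv := fun w => by
        obtain ⟨h1, h2⟩ := h
        by_cases hw : w < x ∨ z ≤ w
        · simp [hw]
        · have hw' := hw
          push Not at hw'
          by_cases hy : w < x + (z - y)
          · have g1 : ¬ (w + (y - x) < x ∨ z ≤ w + (y - x)) := by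
              push Not; constructor <;> linarith
            have g2 : ¬ (w + (y - x) < y) := by linarith [hw'.1]
            simp only [hw, hy, g1, g2, if_true, if_false]
            ring
          · have g1 : ¬ (w + (y - z) < x ∨ z ≤ w + (y - z)) := by
              push Not; constructor <;> linarith
            have g2 : w + (y - z) < y := by linarith [hw'.2]
            simp only [hw, hy, g1, g2, if_true, if_false]
            ring }
  else 1

variable {x y z w : ℝ}

theorem rot_apply (hxy : x ≤ y) (hyz : y ≤ z) (w : ℝ) : rot x y z w =
    if w < x ∨ z ≤ w then w else if w < y then w + (z - y) else w + (x - y) := by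
  rw [rot, dif_pos ⟨hxy, hyz⟩]
  rfl

theorem rot_left (hyz : y ≤ z) (h1 : x ≤ w) (h2 : w < y) : rot x y z w = w + (z - y) := by
  rw [rot_apply (by linarith) hyz, if_neg, if_pos h2]
  push Not
  constructor <;> linarith

theorem rot_right (hxy : x ≤ y) (h1 : y ≤ w) (h2 : w < z) : rot x y z w = w + (x - y) := by
  rw [rot_apply hxy (by linarith), if_neg, if_neg (not_lt.2 h1)]
  push Not
  constructor <;> linarith

theorem rot_other (h : w < x ∨ z ≤ w) : rot x y z w = w := by
  by_cases h' : x ≤ y ∧ y ≤ z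
  · rw [rot_apply h'.1 h'.2, if_pos h]
  · rw [rot, dif_neg h']
    rfl

theorem eq_rot {f : Perm ℝ} (hxy : x ≤ y) (hyz : y ≤ z)
    (h1 : ∀ w, x ≤ w → w < y → f w = w + (z - y)) (h2 : ∀ w, y ≤ w → w < z → f w = w + (x - y))
    (h3 : ∀ w, w < x ∨ z ≤ w → f w = w) : f = rot x y z := by
  ext w
  by_cases h : w < x ∨ z ≤ w
  · rw [h3 w h, rot_other h]
  · have hw := h
    push Not at hw
    by_cases hy : w < y
    · rw [h1 w hw.1 hy, rot_left hyz hw.1 hy]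
    · push Not at hy
      rw [h2 w hy hw.2, rot_right hxy hy hw.2]

/-- The interval `[x, y)` is carried first past `[y, z)` and then past `[z, z')`. -/
theorem rot_add_right {z' : ℝ} (hxy : x ≤ y) (hyz : y ≤ z) (hz : z ≤ z') :
    rot (x + (z - y)) z z' * rot x y z = rot x y z' := by
  apply eq_rot hxy (hyz.trans hz)
  · intro w h1 h2
    rw [Perm.mul_apply, rot_left hyz h1 h2, rot_left hz (by linarith) (by linarith)]
    ring
  · intro w h1 h2
    rcases lt_or_ge w z with h | h
    · rw [Perm.mul_apply, rot_right hxy h1 h, rot_other (by left; linarith)]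
    · rw [Perm.mul_apply, rot_other (Or.inr h), rot_right (by linarith) h h2]
      ring
  · rintro w (h | h)
    · rw [Perm.mul_apply, rot_other (w := w) (Or.inl h), rot_other (by left; linarith)]
    · rw [Perm.mul_apply, rot_other (w := w) (by right; linarith), rot_other (by right; linarith)]

theorem rot_add_left {x' : ℝ} (hx : x ≤ x') (hxy : x' ≤ y) (hyz : y ≤ z) :
    rot x x' (x' + (z - y)) * rot x' y z = rot x y z := by
  apply eq_rot (hx.trans hxy) hyz
  · intro w h1 h2
    rcases lt_or_ge w x' with h | h
    · rw [Perm.mul_apply, rot_other (w := w) (by left; linarith), rot_left (by linarith) h1 h]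
      ring
    · rw [Perm.mul_apply, rot_left hyz h h2, rot_other (by right; linarith)]
  · intro w h1 h2
    rw [Perm.mul_apply, rot_right hxy h1 h2, rot_right hx (by linarith) (by linarith)]
    ring
  · rintro w (h | h)
    · rw [Perm.mul_apply, rot_other (w := w) (by left; linarith), rot_other (by left; linarith)]
    · rw [Perm.mul_apply, rot_other (w := w) (by right; linarith), rot_other (by right; linarith)]

/-- `f` is an increasing affine map of the line. -/
def IsAff (f : ℝ → ℝ) : Prop := ∃ l β, 0 < l ∧ ∀ x, f x = l * x + β

theorem IsAff.strictMono {f : ℝ → ℝ} (hf : IsAff f) : StrictMono f := by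
  obtain ⟨l, β, hl, h⟩ := hf
  intro x y hxy
  rw [h, h]
  gcongr

theorem conj_rot_of_isAff {L : Perm ℝ} (hL : IsAff L) (hxy : x ≤ y) (hyz : y ≤ z) :
    L * rot x y z * L⁻¹ = rot (L x) (L y) (L z) := by
  have hm := hL.strictMono
  obtain ⟨l, β, hl, h⟩ := hL
  apply eq_rot (hm.monotone hxy) (hm.monotone hyz)
  · intro w h1 h2
    obtain ⟨w, rfl⟩ := L.surjective w
    rw [hm.le_iff_le] at h1
    rw [hm.lt_iff_lt] at h2
    rw [Perm.mul_apply, Perm.mul_apply, inv_apply_self, rot_left hyz h1 h2]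
    simp only [h]
    ring
  · intro w h1 h2
    obtain ⟨w, rfl⟩ := L.surjective w
    rw [hm.le_iff_le] at h1
    rw [hm.lt_iff_lt] at h2
    rw [Perm.mul_apply, Perm.mul_apply, inv_apply_self, rot_right hxy h1 h2]
    simp only [h]
    ring
  · intro w hw
    obtain ⟨w, rfl⟩ := L.surjective w
    rw [hm.lt_iff_lt, hm.le_iff_le] at hw
    rw [Perm.mul_apply, Perm.mul_apply, inv_apply_self, rot_other hw]

variable {a b : ℝ}

theorem rot_mem_iet (hx : a ≤ x) (hxy : x ≤ y) (hyz : y ≤ z) (hz : z ≤ b) :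
    rot x y z ∈ (iet a b).map (extend a b) := by
  rw [mem_iet_extend]
  refine ⟨fun w hw => ?_, {x, y, z}, by simp, fun u v hu huv hv hp => ?_⟩
  · rw [mem_Ico, not_and_or, not_le, not_lt] at hw
    exact rot_other (hw.imp (fun h => h.trans_le hx) fun h => hz.trans h)
  · simp only [mem_insert_iff, mem_singleton_iff, forall_eq_or_imp, forall_eq] at hp
    obtain ⟨p1, p2, p3⟩ := hp
    by_cases hA : x ≤ u ∧ v ≤ z
    · rcases p2 with p2 | p2
      · exact ⟨x - y, fun w hw => rot_right hxy (p2.trans hw.1) (hw.2.trans_le hA.2)⟩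
      · exact ⟨z - y, fun w hw => rot_left hyz (hA.1.trans hw.1) (hw.2.trans_le p2)⟩
    · rw [not_and_or, not_le, not_le] at hA
      refine ⟨0, fun w hw => ?_⟩
      rw [add_zero]
      apply rot_other
      rcases hA with hA | hA
      · left
        rcases p1 with p | p <;> linarith [hw.2]
      · right
        rcases p3 with p | p <;> linarith [hw.1]

/-- Cutting either of the two adjacent intervals factors the rotation. The first interval is cut
while the second is short; then the second is cut. -/
theorem rot_mem_of_small {M : Subgroup (Perm ℝ)} {ε : ℝ} (hε : 0 < ε)
    (h : ∀ x y z, a ≤ x → x ≤ y → y ≤ z → z ≤ b → z - x < ε → rot x y z ∈ M) :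
    ∀ x y z, a ≤ x → x ≤ y → y ≤ z → z ≤ b → rot x y z ∈ M := by
  -- A first interval of length at most ε / 3 and a second of length less than ε / 2 have total
  -- length less than ε.
  have s1 : ∀ n : ℕ, ∀ x y z, a ≤ x → x ≤ y → y ≤ z → z ≤ b → z - y < ε / 2 →
      y - x ≤ n * (ε / 3) → rot x y z ∈ M := by
    intro n
    induction n with
    | zero =>
      intro x y z hx hxy hyz hz h1 h2
      simp only [Nat.cast_zero, zero_mul] at h2
      exact h x y z hx hxy hyz hz (by linarith)
    | succ n ih =>
      intro x y z hx hxy hyz hz h1 h2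
      push_cast at h2
      rcases le_or_gt (y - x) (ε / 3) with h3 | h3
      · exact h x y z hx hxy hyz hz (by linarith)
      · rw [← rot_add_left (x' := x + ε / 3) (by linarith) (by linarith) hyz]
        exact mul_mem (h _ _ _ hx (by linarith) (by linarith) (by linarith) (by linarith))
          (ih _ _ _ (by linarith) (by linarith) hyz hz h1 (by linarith))
  have s2 : ∀ x y z, a ≤ x → x ≤ y → y ≤ z → z ≤ b → z - y < ε / 2 → rot x y z ∈ M := by
    intro x y z hx hxy hyz hz h1
    obtain ⟨n, hn⟩ := exists_nat_ge ((y - x) / (ε / 3))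
    exact s1 n x y z hx hxy hyz hz h1 ((div_le_iff₀ (by linarith)).1 hn)
  have s3 : ∀ n : ℕ, ∀ x y z, a ≤ x → x ≤ y → y ≤ z → z ≤ b →
      z - y ≤ n * (ε / 3) → rot x y z ∈ M := by
    intro n
    induction n with
    | zero =>
      intro x y z hx hxy hyz hz h2
      simp only [Nat.cast_zero, zero_mul] at h2
      exact s2 x y z hx hxy hyz hz (by linarith)
    | succ n ih =>
      intro x y z hx hxy hyz hz h2
      push_cast at h2
      rcases le_or_gt (z - y) (ε / 3) with h3 | h3
      · exact s2 x y z hx hxy hyz hz (by linarith)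
      · rw [← rot_add_right (z := y + ε / 3) hxy (by linarith) (by linarith)]
        exact mul_mem (ih _ _ _ (by linarith) (by linarith) (by linarith) hz (by linarith))
          (s2 _ _ _ hx hxy (by linarith) (by linarith) (by linarith))
  intro x y z hx hxy hyz hz
  obtain ⟨n, hn⟩ := exists_nat_ge ((z - y) / (ε / 3))
  exact s3 n x y z hx hxy hyz hz ((div_le_iff₀ (by linarith)).1 hn)

end Rotations

/-! ### Insertion sort: rotations make a piecewise increasing map increasing. -/

section Sorting

variable {a b : ℝ}

theorem continuous_of_strictMono {k : Perm ℝ} (hk : StrictMono k) : Continuous k :=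
  (hk.orderIsoOfSurjective k k.surjective).continuous

theorem image_Ico_of_strictMono {k : Perm ℝ} (hk : StrictMono k) (c d : ℝ) :
    k '' Ico c d = Ico (k c) (k d) :=
  (hk.orderIsoOfSurjective k k.surjective).image_Ico c d

theorem exists_image_Ico_eq {k : Perm ℝ} (hk : ∀ x ∉ Ico a b, k x = x) {c d : ℝ} (hc : a ≤ c)
    (hcd : c < d) (hd : d ≤ b) (h : IncOn k (Ico c d)) :
    ∃ u v, a ≤ u ∧ u < v ∧ v ≤ b ∧ k '' Ico c d = Ico u v := by
  obtain ⟨g, rfl⟩ := exists_extend_eq hk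
  rw [← image_val_setOf_Ico hc hd, incOn_extend] at h
  obtain ⟨⟨u, v, huv, e⟩, -⟩ := IsIncreasingHomeoOn.inv g _
    ⟨c, d, hcd, image_val_setOf_Ico hc hd⟩ h
  have hsub : Ico u v ⊆ Ico a b := by
    rw [← e]
    rintro _ ⟨x, -, rfl⟩
    exact x.2
  obtain ⟨h1, h2⟩ := (Ico_subset_Ico_iff huv).1 hsub
  refine ⟨u, v, h1, huv, h2, ?_⟩
  rw [← e, ← image_val_setOf_Ico hc hd, ← image_comp, ← image_comp]
  exact image_congr fun x _ => extend_apply g x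

theorem IncOn.add {k k' : ℝ → ℝ} {s : Set ℝ} {β : ℝ} (h : IncOn k s)
    (hk : ∀ w ∈ s, k' w = k w + β) : IncOn k' s := by
  refine ⟨(h.1.add continuousOn_const).congr hk, fun x hx y hy hxy => ?_⟩
  rw [hk x hx, hk y hy]
  have := h.2 hx hy hxy
  linarith

theorem strictMono_of_strictMonoOn {k : Perm ℝ} (hk : ∀ x ∉ Ico a b, k x = x)
    (h : StrictMonoOn k (Ico a b)) : StrictMono k := by
  intro x y hxy
  by_cases hx : x ∈ Ico a b
  · by_cases hy : y ∈ Ico a b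
    · exact h hx hy hxy
    · have := mem_of_fixed_compl hk hx
      rw [hk y hy]
      have : b ≤ y := by
        by_contra hb
        exact hy ⟨hx.1.trans hxy.le, not_le.1 hb⟩
      exact (mem_of_fixed_compl hk hx).2.trans_le this
  · rw [hk x hx]
    by_cases hy : y ∈ Ico a b
    · have : x < a := by
        by_contra hb
        exact hx ⟨not_lt.1 hb, hxy.trans hy.2⟩
      exact this.trans_le (mem_of_fixed_compl hk hy).1
    · rwa [hk y hy]

/-- The map is already increasing from `[a, x)` onto `[a, z)`. The next piece `[x, y)` has an image
`[u, v)` to the right of z, and the rotation slides this image left to start at z. By injectivity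
the image of every later piece lies in `[z, u)` or to the right of v, so it is only translated. -/
theorem sort_step {k : Perm ℝ} (hk : ∀ x ∉ Ico a b, k x = x) {P : Set ℝ}
    (hP : ∀ c d, a ≤ c → c < d → d ≤ b → (∀ p ∈ P, p ≤ c ∨ d ≤ p) → IncOn k (Ico c d))
    {x y z : ℝ} (hx : x ∈ P) (hy : y ∈ P) (hax : a ≤ x) (hxy : x < y) (hyb : y ≤ b) (haz : a ≤ z)
    (hgap : ∀ p ∈ P, p ≤ x ∨ y ≤ p) (hmono : StrictMonoOn k (Ico a x))
    (him : k '' Ico a x = Ico a z) :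
    ∃ u v z', z ≤ u ∧ u ≤ v ∧ v ≤ b ∧ a ≤ z' ∧
      (∀ x ∉ Ico a b, (rot z u v * k) x = x) ∧
      (∀ c d, a ≤ c → c < d → d ≤ b → (∀ p ∈ P, p ≤ c ∨ d ≤ p) →
        IncOn (rot z u v * k : Perm ℝ) (Ico c d)) ∧
      StrictMonoOn (rot z u v * k : Perm ℝ) (Ico a y) ∧
      (rot z u v * k : Perm ℝ) '' Ico a y = Ico a z' := by
  obtain ⟨u, v, hau, huv, hvb, huv'⟩ := exists_image_Ico_eq hk hax hxy hyb
    (hP x y hax hxy hyb hgap)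
  -- By injectivity, only points of `[a, x)` have their image in `[a, z)`.
  have key : ∀ w, a ≤ w → k w ∈ Ico a z → w < x := fun w _ hw => by
    rw [← him] at hw
    obtain ⟨w', hw', e⟩ := hw
    rw [← k.injective e]
    exact hw'.2
  have key' : ∀ w, k w ∈ Ico u v → x ≤ w ∧ w < y := fun w hw => by
    rw [← huv'] at hw
    obtain ⟨w', hw', e⟩ := hw
    rwa [← k.injective e]
  have hzu : z ≤ u := by
    by_contra h
    obtain ⟨w, hw, e⟩ : u ∈ k '' Ico x y := by rw [huv']; exact ⟨le_rfl, huv⟩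
    exact absurd (key w (hax.trans hw.1) (by rw [e]; exact ⟨hau, not_le.1 h⟩)) (not_lt.2 hw.1)
  have e1 : ∀ w ∈ Ico a x, (rot z u v * k) w = k w := fun w hw => by
    have : k w ∈ Ico a z := by rw [← him]; exact ⟨w, hw, rfl⟩
    rw [Perm.mul_apply, rot_other (Or.inl this.2)]
  have e2 : ∀ w ∈ Ico x y, (rot z u v * k) w = k w + (z - u) := fun w hw => by
    have : k w ∈ Ico u v := by rw [← huv']; exact ⟨w, hw, rfl⟩
    rw [Perm.mul_apply, rot_right hzu this.1 this.2]
  have hsplit : Ico a y = Ico a x ∪ Ico x y := (Ico_union_Ico_eq_Ico hax hxy.le).symm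
  refine ⟨u, v, z + (v - u), hzu, huv.le, hvb, by linarith, ?_, ?_, ?_, ?_⟩
  · intro w hw
    rw [Perm.mul_apply, hk w hw, rot_other]
    rw [mem_Ico, not_and_or, not_le, not_lt] at hw
    exact hw.imp (fun h => h.trans_le haz) hvb.trans
  · intro c d hc hcd hd hp
    have hI := hP c d hc hcd hd hp
    rcases hp x hx with h1 | h1
    · rcases hp y hy with h2 | h2
      · obtain ⟨u', v', hau', huv1, hvb', e⟩ := exists_image_Ico_eq hk hc hcd hd hI
        have hmem : ∀ w ∈ Ico c d, k w ∈ Ico u' v' := fun w hw => by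
          rw [← e]; exact ⟨w, hw, rfl⟩
        have hz : z ≤ u' := by
          by_contra h
          obtain ⟨w, hw, e'⟩ : u' ∈ k '' Ico c d := by rw [e]; exact ⟨le_rfl, huv1⟩
          have := key w (hc.trans hw.1) (by rw [e']; exact ⟨hau', not_le.1 h⟩)
          linarith [hw.1]
        have hd : v' ≤ u ∨ v ≤ u' := by
          by_contra! h
          obtain ⟨w, hw, e'⟩ : max u u' ∈ k '' Ico c d := by
            rw [e]; exact ⟨le_max_right _ _, max_lt h.1 huv1⟩
          have := (key' w (by rw [e']; exact ⟨le_max_left _ _, max_lt huv h.2⟩)).2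
          linarith [hw.1]
        rcases hd with h | h
        · refine hI.add (β := v - u) fun w hw => ?_
          have := hmem w hw
          rw [Perm.mul_apply, rot_left huv.le (hz.trans this.1) (this.2.trans_le h)]
        · refine hI.add (β := 0) fun w hw => ?_
          have := hmem w hw
          rw [Perm.mul_apply, rot_other (Or.inr (h.trans this.1)), add_zero]
      · exact hI.add fun w hw => e2 w ⟨h1.trans hw.1, hw.2.trans_le h2⟩
    · refine hI.add (β := 0) fun w hw => ?_
      rw [e1 w ⟨hc.trans hw.1, hw.2.trans_le h1⟩, add_zero]
  · intro w hw w' hw' hlt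
    rw [hsplit] at hw hw'
    rcases hw with hw | hw <;> rcases hw' with hw' | hw'
    · rw [e1 w hw, e1 w' hw']
      exact hmono hw hw' hlt
    · rw [e1 w hw, e2 w' hw']
      have h1 : k w ∈ Ico a z := by rw [← him]; exact ⟨w, hw, rfl⟩
      have h2 : k w' ∈ Ico u v := by rw [← huv']; exact ⟨w', hw', rfl⟩
      linarith [h1.2, h2.1]
    · linarith [hw.1, hw'.2]
    · rw [e2 w hw, e2 w' hw']
      have := (hP x y hax hxy hyb hgap).2 hw hw' hlt
      linarith
  · rw [hsplit, image_union, image_congr e1, him, image_congr e2,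
      show (fun w => k w + (z - u)) = (fun t => t + (z - u)) ∘ k from rfl, image_comp, huv',
      image_add_const_Ico, show u + (z - u) = z by ring,
      show v + (z - u) = z + (v - u) by ring, Ico_union_Ico_eq_Ico haz (by linarith)]

/-- Take the last cut point up to which the map can be sorted; if it were not b, `sort_step` would
reach the next one. -/
theorem exists_mul_strictMono (hab : a < b) {f : Perm ℝ}
    (hf : CutGood (fun f c d => IncOn f (Ico c d)) a b f) {M : Subgroup (Perm ℝ)}
    (hM : ∀ x y z, a ≤ x → x ≤ y → y ≤ z → z ≤ b → rot x y z ∈ M) :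
    ∃ h ∈ M, StrictMono (h * f : Perm ℝ) := by
  obtain ⟨hfix, P0, hP0, hgood⟩ := hf
  set P : Set ℝ := P0 ∪ {a, b} with hPdef
  have hP : P.Finite := hP0.union (by simp)
  let Q : ℝ → Prop := fun x => ∃ h ∈ M, ∃ z, a ≤ z ∧
    (∀ x ∉ Ico a b, (h * f) x = x) ∧
    (∀ c d, a ≤ c → c < d → d ≤ b → (∀ p ∈ P, p ≤ c ∨ d ≤ p) → IncOn (h * f : Perm ℝ) (Ico c d)) ∧
    StrictMonoOn (h * f : Perm ℝ) (Ico a x) ∧ (h * f : Perm ℝ) '' Ico a x = Ico a z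
  have hQa : Q a := by
    refine ⟨1, one_mem _, a, le_rfl, by simpa using hfix, ?_, by simp [StrictMonoOn], by simp⟩
    intro c d hc hcd hd hp
    rw [one_mul]
    exact hgood c d hc hcd hd fun p hp' => hp p (Or.inl hp')
  obtain ⟨x, ⟨hxP, ⟨hax, hxb⟩, hQx⟩, hmax⟩ :=
    (hP.subset (inter_subset_left (t := Icc a b ∩ {x | Q x}))).exists_maximalFor id _
      ⟨a, by simp [hPdef], ⟨le_rfl, hab.le⟩, hQa⟩
  rcases hxb.lt_or_eq with hlt | rfl
  · exfalso
    obtain ⟨y, hxy, hyb, hyP, hgap⟩ := exists_gap_right hP x hlt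
    have hyP : y ∈ P := by
      rcases hyP with h | rfl
      · exact h
      · simp [hPdef]
    obtain ⟨h, hh, z, haz, h1, h2, h3, h4⟩ := hQx
    obtain ⟨u, v, z', g1, g2, g3, g4, g5, g6, g7, g8⟩ :=
      sort_step h1 h2 hxP hyP hax hxy hyb haz hgap h3 h4
    have : Q y := by
      refine ⟨rot z u v * h, mul_mem (hM _ _ _ haz g1 g2 g3) hh, z', g4, ?_⟩
      rw [mul_assoc]
      exact ⟨g5, g6, g7, g8⟩
    exact absurd (hmax ⟨hyP, ⟨hax.trans hxy.le, hyb⟩, this⟩ hxy.le) (not_le.2 hxy)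
  · obtain ⟨h, hh, z, -, h1, -, h3, -⟩ := hQx
    exact ⟨h, hh, strictMono_of_strictMonoOn h1 h3⟩

theorem apply_left_of_strictMono {k : Perm ℝ} (hk : ∀ x ∉ Ico a b, k x = x) (hm : StrictMono k) :
    k a = a := by
  by_cases hab : a ∈ Ico a b
  · have h1 := (mem_of_fixed_compl hk hab).1
    obtain ⟨w, hw⟩ := k.surjective a
    have h2 : w ∈ Ico a b := (mem_of_fixed_compl_iff hk).1 (by rwa [hw])
    have := hm.monotone h2.1
    rw [hw] at this
    exact le_antisymm this h1
  · exact hk a hab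

/-- An increasing bijection of the line is continuous, so the translations on consecutive pieces fit
together; as a is fixed, they are all trivial. -/
theorem eq_one_of_strictMono {k : Perm ℝ} (hk : CutGood (fun f c d => TransOn f (Ico c d)) a b k)
    (hm : StrictMono k) : k = 1 := by
  obtain ⟨h1, P, hP, h2⟩ := hk
  ext x
  by_cases hx : x ∈ Ico a b
  · have ha := apply_left_of_strictMono h1 hm
    rcases hx.1.lt_or_eq with hax | rfl
    · have := gap_induction hax hP (fun c d => k d - k c = d - c) (fun x y z _ _ _ _ h h' => by
        linarith) fun c d hc hcd hd hp => by
          obtain ⟨β, h⟩ := h2 c d hc hcd (hd.trans hx.2.le) hp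
          -- Continuity extends the formula to the right endpoint, which belongs to the next piece.
          have hcl : ∀ w ∈ Icc c d, k w = w + β := by
            rw [← closure_Ico hcd.ne]
            exact fun w hw => closure_minimal (t := {w | k w = w + β}) h
              (isClosed_eq (continuous_of_strictMono hm) (by fun_prop)) hw
          rw [hcl d ⟨hcd.le, le_rfl⟩, hcl c ⟨le_rfl, hcd.le⟩]
          ring
      rw [ha] at this
      simp only [Perm.one_apply]
      linarith
    · exact ha
  · exact h1 x hx

/-- Sorting by rotations leaves an increasing interval exchange, that is, the identity. So rotations
generate. -/
theorem iet_le_of_rot_mem (hab : a < b) {M : Subgroup (Perm ℝ)}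
    (hM : ∀ x y z, a ≤ x → x ≤ y → y ≤ z → z ≤ b → rot x y z ∈ M) :
    (iet a b).map (extend a b) ≤ M := by
  intro f hf
  obtain ⟨h, hh, hm⟩ := exists_mul_strictMono hab
    (M := M ⊓ (iet a b).map (extend a b)) (mem_generalisedIET_extend.1
      (affineIET_le_generalisedIET_extend (iet_le_affineIET_extend hf)))
    fun x y z h1 h2 h3 h4 => ⟨hM x y z h1 h2 h3 h4, rot_mem_iet h1 h2 h3 h4⟩
  have := eq_one_of_strictMono (mem_iet_extend.1 (mul_mem hh.2 hf)) hm
  rw [eq_inv_of_mul_eq_one_right this]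
  exact inv_mem hh.1

end Sorting

/-! ### Finding room for an interval disjoint from given ones. -/

section Slots

theorem exists_subinterval_apart {p q l : ℝ} (hl : 0 ≤ l) (hpq : p ≤ q) (c : ℝ) :
    ∃ p' q', p ≤ p' ∧ q' ≤ q ∧ (q - p - l) / 2 ≤ q' - p' ∧ (q' ≤ c ∨ c + l ≤ p') := by
  rcases le_or_gt (p + (q - p - l) / 2) c with h | h
  · exact ⟨p, p + (q - p - l) / 2, le_rfl, by linarith, by linarith, Or.inl h⟩
  · exact ⟨q - (q - p - l) / 2, q, by linarith, le_rfl, by linarith, Or.inr (by linarith)⟩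

/-- Avoiding one interval of length l leaves a subinterval of at least half the remaining length.
The constant therefore obeys K₀ = 1 and Kₙ₊₁ = 2Kₙ + 1: it is 7 for two obstacles and 15 for three.
-/
theorem exists_slot {l : ℝ} (hl : 0 ≤ l) (cs : List ℝ) : ∀ {p q : ℝ},
    (2 ^ (cs.length + 1) - 1) * l ≤ q - p → ∃ c, p ≤ c ∧ c + l ≤ q ∧ ∀ c' ∈ cs, Apart l c c' := by
  induction cs with
  | nil =>
    intro p q h
    simp only [List.length_nil, zero_add, pow_one] at h
    exact ⟨p, le_rfl, by linarith, by simp⟩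
  | cons c' cs ih =>
    intro p q h
    rw [List.length_cons, pow_succ] at h
    have h2 : (1 : ℝ) ≤ 2 ^ (cs.length + 1) := one_le_pow₀ (by norm_num)
    obtain ⟨p', q', h3, h4, h5, h6⟩ := exists_subinterval_apart (p := p) (q := q) hl
      (by nlinarith) c'
    obtain ⟨c, h7, h8, h9⟩ := ih (p := p') (q := q') (by linarith)
    refine ⟨c, by linarith, by linarith, ?_⟩
    simp only [List.mem_cons, forall_eq_or_imp]
    refine ⟨?_, h9⟩
    rcases h6 with h | h
    · left; linarith
    · right; linarith

end Slots

/-! ### The commutator subgroup is contained in every group it normalises that displaces an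
interval. -/

section Derived

variable {a b : ℝ}

/-- The commutator subgroup of the group of interval exchange transformations of `[a, b)`, as a
group of bijections of the line. -/
noncomputable def derivedIET (a b : ℝ) : Subgroup (Perm ℝ) :=
  ⁅(iet a b).map (extend a b), (iet a b).map (extend a b)⁆

theorem derivedIET_le : derivedIET a b ≤ (iet a b).map (extend a b) := by
  rw [derivedIET, Subgroup.commutator_le]
  intro f hf g hg
  exact mul_mem (mul_mem (mul_mem hf hg) (inv_mem hf)) (inv_mem hg)

/-- Since g displaces s, the conjugate c = gug⁻¹ is the identity on s and commutes with u and v.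
Hence [g, u] = cu⁻¹ lies in M, and so does [cu⁻¹, v] = [u⁻¹, v], from which c has disappeared. -/
theorem twist_mem {M D : Subgroup (Perm ℝ)} (hM : ∀ d ∈ D, ∀ m ∈ M, d * m * d⁻¹ ∈ M)
    {g : Perm ℝ} (hg : g ∈ M) {s : Set ℝ} (hs : ∀ x ∈ s, g x ∉ s) {u v : Perm ℝ} (hu : u ∈ D)
    (hv : v ∈ D) (hus : ∀ x ∉ s, u x = x) (hvs : ∀ x ∉ s, v x = x) : u⁻¹ * v * u * v⁻¹ ∈ M := by
  have hc : ∀ x ∈ s, (g * u * g⁻¹) x = x := by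
    have := conj_fixed (k := g) (t := sᶜ) hus hs
    simpa using this
  have c2 : Commute v (g * u * g⁻¹) := commute_of_fixed hvs hc
  have m1 : g * (u * g⁻¹ * u⁻¹) ∈ M := mul_mem hg (hM u hu _ (inv_mem hg))
  have m2 := mul_mem m1 (hM v hv _ (inv_mem m1))
  have c1 : Commute u (g * u * g⁻¹) := commute_of_fixed hus hc
  set c := g * u * g⁻¹ with hcdef
  have e : g * (u * g⁻¹ * u⁻¹) = c * u⁻¹ := by rw [hcdef]; group
  rw [e] at m2
  have c3 : Commute c (u⁻¹ * v * u) := ((c1.inv_left.mul_left c2).mul_left c1).symm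
  have : c * u⁻¹ * (v * (c * u⁻¹)⁻¹ * v⁻¹) = u⁻¹ * v * u * v⁻¹ := by
    calc _ = c * (u⁻¹ * v * u) * c⁻¹ * v⁻¹ := by group
      _ = _ := by rw [c3.eq]; group
  rwa [this] at m2

theorem tsw_fixed {l c c' p q : ℝ} (h1 : p ≤ c) (h2 : c + l ≤ q) (h3 : p ≤ c') (h4 : c' + l ≤ q) :
    ∀ x ∉ Ico p q, tsw l c c' x = x := fun x hx => by
  rw [mem_Ico, not_and_or, not_le, not_lt] at hx
  apply tsw_other
  · exact hx.imp (fun h => by linarith) fun h => by linarith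
  · exact hx.imp (fun h => by linarith) fun h => by linarith

theorem Apart.mono {l l' c c' : ℝ} (h : Apart l c c') (hl : l' ≤ l) : Apart l' c c' :=
  h.imp (fun h => by linarith) fun h => by linarith

/-- `twist_mem` yields products of two transpositions with a common letter. Halving makes a single
exchange an even permutation of four letters, hence a product of such pairs. -/
theorem tsw_mem_of_displaced {M : Subgroup (Perm ℝ)}
    (hM : ∀ d ∈ derivedIET a b, ∀ m ∈ M, d * m * d⁻¹ ∈ M) {g : Perm ℝ} (hg : g ∈ M) {p q : ℝ}
    (hp : a ≤ p) (hq : q ≤ b) (hgI : ∀ x ∈ Ico p q, g x ∉ Ico p q) {l c c' : ℝ} (hl : 0 ≤ l)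
    (h : Apart l c c') (h1 : p ≤ c) (h2 : c + l ≤ q) (h3 : p ≤ c') (h4 : c' + l ≤ q) :
    tsw l c c' ∈ M := by
  have key : ∀ l c1 c2 c3, 0 ≤ l → p ≤ c1 → c1 + l ≤ q → p ≤ c2 → c2 + l ≤ q → p ≤ c3 →
      c3 + l ≤ q → Apart l c1 c2 → Apart l c2 c3 → Apart l c1 c3 →
      tsw l c1 c3 * tsw l c2 c3 ∈ M := by
    intro l c1 c2 c3 hl g1 g1' g2 g2' g3 g3' A12 A23 A13
    have := twist_mem hM hg hgI (u := tsw l c1 c2) (v := tsw l c2 c3)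
      (tsw_mem_commutator hl A12 (by linarith) (by linarith) (by linarith) (by linarith))
      (tsw_mem_commutator hl A23 (by linarith) (by linarith) (by linarith) (by linarith))
      (tsw_fixed g1 g1' g2 g2') (tsw_fixed g2 g2' g3 g3')
    rwa [tsw_inv, tsw_inv, tsw_triple A12 A23 A13] at this
  set m := l / 2 with hm
  have hlm : l = m + m := by rw [hm]; ring
  have hm0 : 0 ≤ m := by rw [hm]; linarith
  have hA : Apart m c c' := h.mono (by linarith)
  have hB : Apart m c (c + m) := Or.inl le_rfl
  have hB' : Apart m c' (c' + m) := Or.inl le_rfl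
  have hC : Apart m (c + m) c' := h.imp (fun h => by linarith) fun h => by linarith
  have hC' : Apart m c (c' + m) := h.imp (fun h => by linarith) fun h => by linarith
  have hA' : Apart m (c + m) (c' + m) := h.imp (fun h => by linarith) fun h => by linarith
  -- With letters 1, 2 for the halves at c and 3, 4 for those at c', this is (13)(24) = (13)(23) ·
  -- (23)(24).
  have e : tsw l c c' = (tsw m c c' * tsw m (c + m) c') *
      (tsw m c' (c + m) * tsw m (c' + m) (c + m)) := by
    rw [tsw_symm hC.symm, tsw_symm hA'.symm]
    rw [hlm, tsw_add hm0 hm0 (by rwa [← hlm])]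
    calc _ = tsw m c c' * (tsw m (c + m) c' * tsw m (c + m) c') * tsw m (c + m) (c' + m) := by
          rw [tsw_mul_self, mul_one]
      _ = _ := by group
  rw [e]
  exact mul_mem (key m c (c + m) c' hm0 (by linarith) (by linarith) (by linarith) (by linarith)
    (by linarith) (by linarith) hB hC hA) (key m c' (c' + m) (c + m) hm0 (by linarith)
    (by linarith) (by linarith) (by linarith) (by linarith) (by linarith) hB' hA'.symm hC.symm)

/-- Both intervals are moved into the displaced interval by an element of D. The factor 15 makes
room there for two slots disjoint from both intervals and from each other. -/
theorem small_tsw_mem_of_displaced {M : Subgroup (Perm ℝ)}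
    (hM : ∀ d ∈ derivedIET a b, ∀ m ∈ M, d * m * d⁻¹ ∈ M) {g : Perm ℝ} (hg : g ∈ M) {p q : ℝ}
    (hp : a ≤ p) (hq : q ≤ b) (hgI : ∀ x ∈ Ico p q, g x ∉ Ico p q) {l c c' : ℝ} (hl : 0 ≤ l)
    (h : Apart l c c') (h1 : a ≤ c) (h2 : c + l ≤ b) (h3 : a ≤ c') (h4 : c' + l ≤ b)
    (hlq : 15 * l ≤ q - p) : tsw l c c' ∈ M := by
  obtain ⟨d, d1, d2, d3⟩ := exists_slot (p := p) (q := q) hl [c, c'] (by norm_num; linarith)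
  obtain ⟨d', e1, e2, e3⟩ := exists_slot (p := p) (q := q) hl [c, c', d] (by norm_num; linarith)
  simp only [List.mem_cons, List.not_mem_nil, or_false, forall_eq_or_imp, forall_eq] at d3 e3
  obtain ⟨A1, A2⟩ := d3
  obtain ⟨B1, B2, B3⟩ := e3
  set k := tsw l c d * tsw l c' d' with hk
  have hkD : k ∈ derivedIET a b := mul_mem
    (tsw_mem_commutator hl A1.symm (by linarith) (by linarith) (by linarith) (by linarith))
    (tsw_mem_commutator hl B2.symm (by linarith) (by linarith) (by linarith) (by linarith))
  have e : k * tsw l c c' * k⁻¹ = tsw l d d' := by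
    apply conj_tsw h
    · intro x hx hx'
      rw [hk, Perm.mul_apply, tsw_other (c := c'), tsw_left A1.symm hx hx']
      · exact h.imp (fun h => by linarith) fun h => by linarith
      · exact B1.symm.imp (fun h => by linarith) fun h => by linarith
    · intro x hx hx'
      rw [hk, Perm.mul_apply, tsw_left B2.symm hx hx', tsw_other]
      · rcases B1 with h | h
        · left; linarith
        · right; linarith
      · rcases B3 with h | h
        · left; linarith
        · right; linarith
  have := hM _ (inv_mem hkD) _ (tsw_mem_of_displaced hM hg hp hq hgI hl B3.symm d1 d2 e1 e2)
  rw [← e] at this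
  convert this using 1
  group

theorem tsw_mem_of_small {M : Subgroup (Perm ℝ)} {ε : ℝ} (hε : 0 < ε)
    (hM : ∀ l c c', 0 ≤ l → l ≤ ε → Apart l c c' → a ≤ c → c + l ≤ b → a ≤ c' → c' + l ≤ b →
      tsw l c c' ∈ M) {l c c' : ℝ} (hl : 0 ≤ l) (h : Apart l c c') (h1 : a ≤ c) (h2 : c + l ≤ b)
    (h3 : a ≤ c') (h4 : c' + l ≤ b) : tsw l c c' ∈ M := by
  obtain ⟨n, hn⟩ := exists_nat_ge (l / ε)
  rw [div_le_iff₀ hε] at hn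
  induction n generalizing l c c' with
  | zero =>
    simp only [Nat.cast_zero, zero_mul] at hn
    exact hM l c c' hl (by linarith) h h1 h2 h3 h4
  | succ n ih =>
    rcases le_or_gt l ε with hle | hle
    · exact hM l c c' hl hle h h1 h2 h3 h4
    · push_cast at hn
      have e : l = ε + (l - ε) := by ring
      rw [e, tsw_add hε.le (by linarith) (by rwa [← e])]
      exact mul_mem (hM _ _ _ hε.le le_rfl (h.mono hle.le) h1 (by linarith) h3 (by linarith))
        (ih (by linarith) (h.imp (fun h => by linarith) fun h => by linarith) (by linarith)
          (by linarith) (by linarith) (by linarith) (by linarith))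

/-- The group generated by the exchanges of two disjoint subintervals of `[a, b)` of the same
length. -/
noncomputable def swapGroup (a b : ℝ) : Subgroup (Perm ℝ) :=
  Subgroup.closure {f | ∃ l c c', 0 ≤ l ∧ Apart l c c' ∧ a ≤ c ∧ c + l ≤ b ∧ a ≤ c' ∧ c' + l ≤ b ∧
    f = tsw l c c'}

theorem tsw_mem_swapGroup {l c c' : ℝ} (hl : 0 ≤ l) (h : Apart l c c') (h1 : a ≤ c)
    (h2 : c + l ≤ b) (h3 : a ≤ c') (h4 : c' + l ≤ b) : tsw l c c' ∈ swapGroup a b :=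
  Subgroup.subset_closure ⟨l, c, c', hl, h, h1, h2, h3, h4, rfl⟩

theorem swapGroup_le : swapGroup a b ≤ (iet a b).map (extend a b) := by
  rw [swapGroup, Subgroup.closure_le]
  rintro _ ⟨l, c, c', hl, h, h1, h2, h3, h4, rfl⟩
  exact tsw_mem_iet h h1 h2 h3 h4

/-- On short enough subintervals g translates both sides of the exchange, so the conjugate is a
product of exchanges. -/
theorem conj_tsw_mem_swapGroup {g : Perm ℝ} (hg : g ∈ (iet a b).map (extend a b)) {l c c' : ℝ}
    (hl : 0 ≤ l) (h : Apart l c c') (h1 : a ≤ c) (h2 : c + l ≤ b) (h3 : a ≤ c')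
    (h4 : c' + l ≤ b) : g * tsw l c c' * g⁻¹ ∈ swapGroup a b := by
  rcases hl.eq_or_lt with rfl | hl
  · have : tsw 0 c c' = 1 := by
      ext x
      exact tsw_other ((lt_or_ge x c).imp_right (by simp)) ((lt_or_ge x c').imp_right (by simp))
    rw [this, mul_one, mul_inv_cancel]
    exact one_mem _
  rw [mem_iet_extend] at hg
  obtain ⟨hfix, P, hP, hgood⟩ := hg
  -- Both intervals are parametrised by `[0, l)`, which is cut at the break points of g coming from
  -- either of them.
  have := gap_induction hl ((hP.image (fun p => p - c)).union (hP.image fun p => p - c'))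
    (fun u v => g * tsw (v - u) (c + u) (c' + u) * g⁻¹ ∈ swapGroup a b) ?_ ?_
  · simpa using this
  · intro x y z hx hxy hyz hz H H'
    have e : z - x = (y - x) + (z - y) := by ring
    rw [e, tsw_add (by linarith) (by linarith)
      (h.imp (fun h => by linarith) fun h => by linarith)]
    have := mul_mem H H'
    convert this using 1
    rw [show c + x + (y - x) = c + y by ring, show c' + x + (y - x) = c' + y by ring]
    group
  · intro u v hu huv hv hp
    obtain ⟨β, hβ⟩ := hgood (c + u) (c + v) (by linarith) (by linarith) (by linarith)
      fun p hp' => (hp _ (Or.inl ⟨p, hp', rfl⟩)).imp (fun h => by linarith) fun h => by linarith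
    obtain ⟨β', hβ'⟩ := hgood (c' + u) (c' + v) (by linarith) (by linarith) (by linarith)
      fun p hp' => (hp _ (Or.inr ⟨p, hp', rfl⟩)).imp (fun h => by linarith) fun h => by linarith
    have hbound : ∀ (s t γ : ℝ), s < t → a ≤ s → t ≤ b → (∀ x ∈ Ico s t, g x = x + γ) →
        a ≤ s + γ ∧ t + γ ≤ b := by
      intro s t γ hst hs ht hγ
      refine (Ico_subset_Ico_iff (by linarith)).1 fun w hw => ?_
      have : w = g (w - γ) := by
        rw [hγ _ ⟨by linarith [hw.1], by linarith [hw.2]⟩]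
        ring
      rw [this]
      exact mem_of_fixed_compl hfix ⟨by linarith [hw.1], by linarith [hw.2]⟩
    have b1 := hbound _ _ β (by linarith) (by linarith) (by linarith) hβ
    have b2 := hbound _ _ β' (by linarith) (by linarith) (by linarith) hβ'
    rw [conj_tsw (d := c + u + β) (d' := c' + u + β')
      (h.imp (fun h => by linarith) fun h => by linarith)]
    · refine tsw_mem_swapGroup (by linarith) ?_ (by linarith) (by linarith) (by linarith)
        (by linarith)
      -- A common point of the two image intervals would have two preimages under g.
      by_contra! hn
      simp only [Apart, not_or, not_le] at hn
      obtain ⟨n1, n2⟩ := hn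
      set w := max (c + u + β) (c' + u + β') with hw
      have w1 : c + u + β ≤ w := le_max_left _ _
      have w2 : c' + u + β' ≤ w := le_max_right _ _
      have w3 : w < c + v + β := max_lt (by linarith) (by linarith)
      have w4 : w < c' + v + β' := max_lt (by linarith) (by linarith)
      have i1 : g (w - β) = w := by rw [hβ _ ⟨by linarith, by linarith⟩]; ring
      have i2 : g (w - β') = w := by rw [hβ' _ ⟨by linarith, by linarith⟩]; ring
      have := g.injective (i1.trans i2.symm)
      rcases h with h | h <;> linarith
    · intro x hx hx'
      rw [hβ x ⟨hx, by linarith⟩]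
      ring
    · intro x hx hx'
      rw [hβ' x ⟨hx, by linarith⟩]
      ring

theorem conj_mem_swapGroup {g f : Perm ℝ} (hg : g ∈ (iet a b).map (extend a b))
    (hf : f ∈ swapGroup a b) : g * f * g⁻¹ ∈ swapGroup a b := by
  have : swapGroup a b ≤ (swapGroup a b).comap (MulAut.conj g).toMonoidHom := by
    conv_lhs => rw [swapGroup]
    rw [Subgroup.closure_le]
    rintro _ ⟨l, c, c', hl, h, h1, h2, h3, h4, rfl⟩
    exact conj_tsw_mem_swapGroup hg hl h h1 h2 h3 h4
  exact this hf

theorem rot_fixed {x y z p q : ℝ} (hp : p ≤ x) (hq : z ≤ q) : ∀ w ∉ Ico p q, rot x y z w = w :=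
  fun w hw => by
    rw [mem_Ico, not_and_or, not_le, not_lt] at hw
    exact rot_other (hw.imp (fun h => h.trans_le hp) fun h => hq.trans h)

/-- An exchange t moves the support of r' to a slot disjoint from the support of r. Then r'' =
tr't⁻¹ commutes with r and is congruent to r' modulo the normal subgroup of exchanges. A slot of
length (b - a) / 8 avoiding two intervals exists because 7 < 8. -/
theorem commutator_small_rot_mem {x y z x' y' z' : ℝ} (hx : a ≤ x) (hxy : x ≤ y) (hyz : y ≤ z)
    (hz : z ≤ b) (hx' : a ≤ x') (hxy' : x' ≤ y') (hyz' : y' ≤ z') (hz' : z' ≤ b)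
    (hs : z - x < (b - a) / 8) (hs' : z' - x' < (b - a) / 8) :
    ⁅rot x y z, rot x' y' z'⁆ ∈ swapGroup a b := by
  obtain ⟨c, c1, c2, c3⟩ := exists_slot (p := a) (q := b) (l := (b - a) / 8) (by linarith) [x, x']
    (by norm_num; linarith)
  simp only [List.mem_cons, List.not_mem_nil, or_false, forall_eq_or_imp, forall_eq] at c3
  obtain ⟨A1, A2⟩ := c3
  set l := z' - x' with hl
  have A2' : Apart l x' c := A2.symm.mono hs'.le
  set t := tsw l x' c with ht
  have htS : t ∈ swapGroup a b := tsw_mem_swapGroup (by linarith) A2' (by linarith) (by linarith)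
    (by linarith) (by linarith)
  set r := rot x y z
  set r' := rot x' y' z'
  have hr : r ∈ (iet a b).map (extend a b) := rot_mem_iet hx hxy hyz hz
  have hr' : r' ∈ (iet a b).map (extend a b) := rot_mem_iet hx' hxy' hyz' hz'
  have ht' := swapGroup_le htS
  set r'' := t * r' * t⁻¹ with hr''
  have hc : Commute r r'' := by
    apply commute_of_fixed (s := (Ico c (c + l))ᶜ)
    · intro w hw
      rw [mem_compl_iff, not_not] at hw
      apply rot_other
      rcases A1 with h | h
      · left; linarith [hw.2]
      · right; linarith [hw.1]
    · refine conj_fixed (s := Ico x' z') (rot_fixed le_rfl le_rfl) fun w hw => ?_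
      rw [ht, tsw_left A2' hw.1 (by linarith [hw.2])]
      constructor <;> linarith [hw.1, hw.2]
  set s := t * (r'⁻¹ * t⁻¹ * r') with hs
  have hsS : s ∈ swapGroup a b := by
    refine mul_mem htS ?_
    have := conj_mem_swapGroup (inv_mem hr') (inv_mem htS)
    rwa [inv_inv] at this
  have e : r' = r'' * s := by rw [hr'', hs]; group
  have e' : ⁅r, r'⁆ = r'' * ((r * s * r⁻¹) * s⁻¹) * r''⁻¹ := by
    rw [e, commutatorElement_def]
    calc _ = (r * r'') * s * r⁻¹ * s⁻¹ * r''⁻¹ := by group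
      _ = _ := by rw [hc.eq]; group
  rw [e']
  exact conj_mem_swapGroup (mul_mem (mul_mem ht' hr') (inv_mem ht'))
    (mul_mem (conj_mem_swapGroup hr hsS) (inv_mem hsS))

/-- The elements of `G` that commute with all elements of `A` modulo `S`. -/
def commuteMod {Γ : Type*} [Group Γ] (G S : Subgroup Γ)
    (h : ∀ g ∈ G, ∀ s ∈ S, g * s * g⁻¹ ∈ S) (A : Set Γ) : Subgroup Γ where
  carrier := {g | g ∈ G ∧ ∀ r ∈ A, ⁅r, g⁆ ∈ S}
  one_mem' := ⟨one_mem _, fun r _ => by simp⟩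
  mul_mem' := by
    rintro g k ⟨hg, hg'⟩ ⟨hk, hk'⟩
    refine ⟨mul_mem hg hk, fun r hr => ?_⟩
    have : ⁅r, g * k⁆ = ⁅r, g⁆ * (g * ⁅r, k⁆ * g⁻¹) := by
      simp only [commutatorElement_def]; group
    rw [this]
    exact mul_mem (hg' r hr) (h g hg _ (hk' r hr))
  inv_mem' := by
    rintro g ⟨hg, hg'⟩
    refine ⟨inv_mem hg, fun r hr => ?_⟩
    have : ⁅r, g⁻¹⁆ = g⁻¹ * ⁅r, g⁆⁻¹ * g⁻¹⁻¹ := by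
      simp only [commutatorElement_def]; group
    rw [this]
    exact h _ (inv_mem hg) _ (inv_mem (hg' r hr))

/-- Modulo exchanges the group is abelian: it is generated by short rotations, which commute.
Commuting is extended from generators to the whole group in one argument (`h1`), then in the other
(`h2`). -/
theorem derivedIET_le_swapGroup (hab : a < b) : derivedIET a b ≤ swapGroup a b := by
  set G := (iet a b).map (extend a b) with hG
  have hS : ∀ g ∈ G, ∀ s ∈ swapGroup a b, g * s * g⁻¹ ∈ swapGroup a b :=
    fun g hg s hs => conj_mem_swapGroup hg hs
  set A : Set (Perm ℝ) := {f | ∃ x y z, a ≤ x ∧ x ≤ y ∧ y ≤ z ∧ z ≤ b ∧ z - x < (b - a) / 8 ∧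
    f = rot x y z}
  have h1 : G ≤ commuteMod G _ hS A := by
    refine iet_le_of_rot_mem hab (rot_mem_of_small (ε := (b - a) / 8) (by linarith) ?_)
    rintro x y z hx hxy hyz hz hs
    refine ⟨rot_mem_iet hx hxy hyz hz, ?_⟩
    rintro _ ⟨x', y', z', hx', hxy', hyz', hz', hs', rfl⟩
    exact commutator_small_rot_mem hx' hxy' hyz' hz' hx hxy hyz hz hs' hs
  have h2 : G ≤ commuteMod G _ hS G := by
    refine iet_le_of_rot_mem hab (rot_mem_of_small (ε := (b - a) / 8) (by linarith) ?_)
    rintro x y z hx hxy hyz hz hs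
    refine ⟨rot_mem_iet hx hxy hyz hz, fun g hg => ?_⟩
    rw [← commutatorElement_inv]
    exact inv_mem ((h1 hg).2 _ ⟨x, y, z, hx, hxy, hyz, hz, hs, rfl⟩)
  rw [derivedIET, Subgroup.commutator_le]
  exact fun f hf g hg => (h2 hg).2 f hf

/-- A group of bijections that is normalised by the commutator subgroup of the group of interval
exchange transformations and has an element displacing an interval contains this commutator
subgroup. -/
theorem derivedIET_le_of_displaced (hab : a < b) {M : Subgroup (Perm ℝ)}
    (hM : ∀ d ∈ derivedIET a b, ∀ m ∈ M, d * m * d⁻¹ ∈ M) {g : Perm ℝ} (hg : g ∈ M) {p q : ℝ}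
    (hp : a ≤ p) (hpq : p < q) (hq : q ≤ b) (hgI : ∀ x ∈ Ico p q, g x ∉ Ico p q) :
    derivedIET a b ≤ M := by
  refine (derivedIET_le_swapGroup hab).trans ?_
  rw [swapGroup, Subgroup.closure_le]
  rintro _ ⟨l, c, c', hl, h, h1, h2, h3, h4, rfl⟩
  refine tsw_mem_of_small (ε := (q - p) / 15) (by linarith) ?_ hl h h1 h2 h3 h4
  intro l c c' hl hle h h1 h2 h3 h4
  exact small_tsw_mem_of_displaced hM hg hp hq hgI hl h h1 h2 h3 h4 (by linarith)

end Derived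

/-- Class in the quotient of G by its intersection with M, as a function on the whole ambient group.
The value outside G is a dummy 1, so elements need no membership proof attached. -/
theorem exists_class {X : Type} [Group X] {G M : Subgroup X}
    (hM : ∀ g ∈ G, ∀ m ∈ M, g * m * g⁻¹ ∈ M) :
    ∃ (Γ : Type) (_ : Group Γ) (cl : X → Γ), (∀ f ∈ G, ∀ g ∈ G, cl (f * g) = cl f * cl g) ∧
      ∀ f ∈ G, cl f = 1 ↔ f ∈ M := by
  classical
  have hn : (M.subgroupOf G).Normal := ⟨fun m hm g => by
    rw [Subgroup.mem_subgroupOf] at hm ⊢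
    exact hM g g.2 m hm⟩
  refine ⟨G ⧸ M.subgroupOf G, inferInstance,
    fun f => if h : f ∈ G then QuotientGroup.mk' _ (⟨f, h⟩ : G) else 1, fun f hf g hg => ?_,
    fun f hf => ?_⟩
  · simp only [dif_pos hf, dif_pos hg, dif_pos (mul_mem hf hg), ← map_mul]
    rfl
  · simp only [dif_pos hf]
    exact (QuotientGroup.eq_one_iff _).trans Subgroup.mem_subgroupOf

/-! ### Affine exchanges, and rotations modulo a normal subgroup containing D. -/

section AffineSwaps

variable {a b : ℝ}

theorem exists_isAff_of_slope {l : ℝ} (hl : 0 < l) (β : ℝ) :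
    ∃ f : Perm ℝ, IsAff f ∧ ∀ x, f x = l * x + β :=
  ⟨(Equiv.mulLeft₀ l hl.ne').trans (Equiv.addRight β), ⟨l, β, hl, fun _ => rfl⟩, fun _ => rfl⟩

theorem IsAff.inv {L : Perm ℝ} (hL : IsAff L) : IsAff (L⁻¹ : Perm ℝ) := by
  obtain ⟨l, β, hl, h⟩ := hL
  refine ⟨l⁻¹, -(l⁻¹ * β), inv_pos.2 hl, fun x => ?_⟩
  rw [Perm.inv_eq_iff_eq, h]
  field_simp
  ring

theorem IsAff.posAffOn {L : ℝ → ℝ} (hL : IsAff L) {f : ℝ → ℝ} {s : Set ℝ}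
    (h : ∀ x ∈ s, f x = L x) : PosAffOn f s := by
  obtain ⟨l, β, hl, h'⟩ := hL
  exact ⟨l, β, hl, fun x hx => by rw [h x hx, h']⟩

theorem displaced_of_isAff {L : Perm ℝ} (hL : IsAff L) {c d : ℝ} (h : d ≤ L c ∨ L d ≤ c) :
    ∀ x ∈ Ico c d, L x ∉ Ico c d := by
  rintro x ⟨h1, h2⟩ ⟨h3, h4⟩
  have := hL.strictMono.monotone h1
  have := hL.strictMono h2
  rcases h with h | h <;> linarith

theorem swapOn_mem_affineIET {L : Perm ℝ} (hL : IsAff L) {c d : ℝ} (h : d ≤ L c ∨ L d ≤ c)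
    (hc : a ≤ c) (hd : d ≤ b) (hc' : a ≤ L c) (hd' : L d ≤ b) :
    swapOn L (Ico c d) ∈ (affineIET a b).map (extend a b) := by
  have hdis := displaced_of_isAff hL h
  have hm := hL.strictMono
  have hother : ∀ x ∉ Ico c d, x ∉ Ico (L c) (L d) → swapOn L (Ico c d) x = x :=
    fun x hx hx' => swapOn_apply_of_notMem hx fun y hy e => hx' (by
      rw [← image_Ico_of_strictMono hm]; exact ⟨y, hy, e⟩)
  rw [mem_affineIET_extend]
  refine ⟨fun x hx => hother x (fun h => hx ⟨hc.trans h.1, h.2.trans_le hd⟩)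
    (fun h => hx ⟨hc'.trans h.1, h.2.trans_le hd'⟩), {c, d, L c, L d}, by simp,
    fun u v hu huv hv hp => ?_⟩
  simp only [mem_insert_iff, mem_singleton_iff, forall_eq_or_imp, forall_eq] at hp
  obtain ⟨p1, p2, p3, p4⟩ := hp
  by_cases hA : c ≤ u ∧ v ≤ d
  · exact hL.posAffOn fun x hx =>
      swapOn_apply_of_mem hdis ⟨hA.1.trans hx.1, hx.2.trans_le hA.2⟩
  by_cases hB : L c ≤ u ∧ v ≤ L d
  · refine hL.inv.posAffOn fun x hx => ?_
    have hx' : x ∈ L '' Ico c d := by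
      rw [image_Ico_of_strictMono hm]
      exact ⟨hB.1.trans hx.1, hx.2.trans_le hB.2⟩
    obtain ⟨y, hy, rfl⟩ := hx'
    rw [swapOn_apply_image hdis hy, inv_apply_self]
  refine ⟨1, 0, one_pos, fun x hx => ?_⟩
  rw [one_mul, add_zero]
  rw [not_and_or, not_le, not_le] at hA hB
  apply hother
  · rintro ⟨h1, h2⟩
    rcases hA with hA | hA
    · rcases p1 with p1 | p1 <;> linarith [hx.2]
    · rcases p2 with p2 | p2 <;> linarith [hx.1]
  · rintro ⟨h1, h2⟩
    rcases hB with hA | hA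
    · rcases p3 with p1 | p1 <;> linarith [hx.2]
    · rcases p4 with p2 | p2 <;> linarith [hx.1]

/-- Let y exchange the left halves. An element k of D carries left halves to right halves on both
sides, so the whole exchange is y · kyk⁻¹. As y is an involution this equals yky⁻¹ · k⁻¹, and yky⁻¹
lies in M because k does. -/
theorem swapOn_mem_of_derivedIET_le {M : Subgroup (Perm ℝ)}
    (hM : ∀ g ∈ (affineIET a b).map (extend a b), ∀ m ∈ M, g * m * g⁻¹ ∈ M)
    (hD : derivedIET a b ≤ M) {L : Perm ℝ} (hL : IsAff L) {c d : ℝ} (h : d ≤ L c ∨ L d ≤ c)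
    (hcd : c ≤ d) (hc : a ≤ c) (hd : d ≤ b) (hc' : a ≤ L c) (hd' : L d ≤ b) :
    swapOn L (Ico c d) ∈ M := by
  have hdis := displaced_of_isAff hL h
  have hm := hL.strictMono
  obtain ⟨l, β, hl, hLx⟩ := hL
  set e := (d - c) / 2 with he
  have hd2 : d = c + e + e := by rw [he]; ring
  have he0 : 0 ≤ e := by rw [he]; linarith
  have hle0 : 0 ≤ l * e := by positivity
  have hA : Apart e c (c + e) := Or.inl le_rfl
  have hB : Apart (l * e) (L c) (L c + l * e) := Or.inl le_rfl
  have hLd : L d = L c + l * e + l * e := by rw [hLx, hLx, hd2]; ring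
  set k := tsw e c (c + e) * tsw (l * e) (L c) (L c + l * e) with hk
  have hkD : k ∈ derivedIET a b := mul_mem
    (tsw_mem_commutator he0 hA (by linarith) (by linarith) (by linarith) (by linarith))
    (tsw_mem_commutator hle0 hB (by linarith) (by linarith) (by linarith) (by linarith))
  set y := swapOn L (Ico c (c + e)) with hy
  have hyG : y ∈ (affineIET a b).map (extend a b) := by
    have : L (c + e) = L c + l * e := by rw [hLx, hLx]; ring
    exact swapOn_mem_affineIET ⟨l, β, hl, hLx⟩
      (h.imp (fun h => by linarith) fun h => by linarith) hc (by linarith) hc' (by linarith)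
  have hk1 : ∀ w ∈ Ico c (c + e), k w = w + e := by
    intro w hw
    rw [hk, Perm.mul_apply, tsw_other (x := w), tsw_left hA hw.1 hw.2]
    · ring
    · rcases h with h | h
      · left; linarith [hw.2]
      · right; linarith [hw.1]
    · rcases h with h | h
      · left; linarith [hw.2]
      · right; linarith [hw.1]
  have hk2 : ∀ w ∈ Ico c (c + e), k (L w) = L w + l * e := by
    intro w hw
    have i1 : L c ≤ L w := hm.monotone hw.1
    have i2 : L w < L c + l * e := by
      have := hm hw.2
      have e2 : L (c + e) = L c + l * e := by rw [hLx, hLx]; ring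
      linarith
    rw [hk, Perm.mul_apply, tsw_left (x := L w) hB i1 i2, tsw_other]
    · ring
    · rcases h with h | h
      · right; linarith
      · left; linarith
    · rcases h with h | h
      · right; linarith
      · left; linarith
  have e1 : k * y * k⁻¹ = swapOn L (Ico (c + e) d) := by
    rw [hy, conj_swapOn (g' := L), image_congr hk1, image_add_const_Ico, ← hd2]
    · intro x hx hx'
      exact hdis x ⟨hx.1, by linarith [hx.2]⟩ ⟨hx'.1, by linarith [hx'.2]⟩
    · intro x hx
      rw [hk2 x hx, hk1 x hx, hLx, hLx]
      ring
  have e2 : swapOn L (Ico c d) = (y * k * y⁻¹) * k⁻¹ := by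
    have hs : Ico c d = Ico c (c + e) ∪ Ico (c + e) d :=
      (Ico_union_Ico_eq_Ico (by linarith) (by linarith)).symm
    have hdis' := hdis
    rw [hs] at hdis'
    rw [hs, swapOn_union hdis' fun x hx hx' => absurd hx.2 (not_lt.2 hx'.1), ← e1, ← hy]
    nth_rewrite 2 [hy]
    rw [← swapOn_inv, ← hy]
    group
  rw [e2]
  exact mul_mem (hM y hyG k (hD hkD)) (inv_mem (hD hkD))

/-- On the interval carrying f, the map L agrees with an affine exchange that lies in M, so
conjugation by L does not alter the class. -/
theorem class_conj_eq {M : Subgroup (Perm ℝ)}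
    (hM : ∀ g ∈ (affineIET a b).map (extend a b), ∀ m ∈ M, g * m * g⁻¹ ∈ M)
    (hD : derivedIET a b ≤ M) {Γ : Type} [Group Γ] {cl : Perm ℝ → Γ}
    (hmul : ∀ f ∈ (affineIET a b).map (extend a b), ∀ g ∈ (affineIET a b).map (extend a b),
      cl (f * g) = cl f * cl g)
    (hone : ∀ f ∈ (affineIET a b).map (extend a b), cl f = 1 ↔ f ∈ M)
    {f : Perm ℝ} (hf : f ∈ (affineIET a b).map (extend a b)) {c d : ℝ}
    (hfix : ∀ x ∉ Ico c d, f x = x) {L : Perm ℝ} (hL : IsAff L) (h : d ≤ L c ∨ L d ≤ c)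
    (hcd : c ≤ d) (hc : a ≤ c) (hd : d ≤ b) (hc' : a ≤ L c) (hd' : L d ≤ b) :
    cl (L * f * L⁻¹) = cl f := by
  have hdis := displaced_of_isAff hL h
  set t := swapOn L (Ico c d) with ht
  have htG : t ∈ (affineIET a b).map (extend a b) := swapOn_mem_affineIET hL h hc hd hc' hd'
  have htM : t ∈ M := swapOn_mem_of_derivedIET_le hM hD hL h hcd hc hd hc' hd'
  have e : t * f * t⁻¹ = L * f * L⁻¹ := conj_eq_of_eqOn hfix fun x hx =>
    swapOn_apply_of_mem hdis hx
  rw [← e, hmul _ (mul_mem htG hf) _ (inv_mem htG), hmul _ htG _ hf, (hone _ htG).2 htM,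
    (hone _ (inv_mem htG)).2 (inv_mem htM), one_mul, mul_one]

/-- The class of a short rotation depends only on its two lengths, is additive in each and is
invariant under scaling. Doubling gives r = r⁴, and division by 3 gives r = 1. -/
theorem rot_mem_of_derivedIET_le (hab : a < b) {M : Subgroup (Perm ℝ)}
    (hM : ∀ g ∈ (affineIET a b).map (extend a b), ∀ m ∈ M, g * m * g⁻¹ ∈ M)
    (hD : derivedIET a b ≤ M) :
    ∀ x y z, a ≤ x → x ≤ y → y ≤ z → z ≤ b → rot x y z ∈ M := by
  obtain ⟨Γ, _, cl, hmul, hone⟩ := exists_class hM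
  set ε := (b - a) / 8 with hε
  have hrot : ∀ {x y z}, a ≤ x → x ≤ y → y ≤ z → z ≤ b →
      rot x y z ∈ (affineIET a b).map (extend a b) := fun h1 h2 h3 h4 =>
    iet_le_affineIET_extend (rot_mem_iet h1 h2 h3 h4)
  -- The two supports may overlap, so both are compared with a copy in a third slot disjoint from
  -- them.
  have haff : ∀ x x' u v l, 0 < l → 0 ≤ u → 0 ≤ v → u + v ≤ ε → l * (u + v) ≤ ε → a ≤ x →
      x + u + v ≤ b → a ≤ x' → x' + l * u + l * v ≤ b →
      cl (rot x (x + u) (x + u + v)) = cl (rot x' (x' + l * u) (x' + l * u + l * v)) := by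
    intro x x' u v l hl hu hv hs hs' h1 h2 h3 h4
    obtain ⟨c, c1, c2, c3⟩ := exists_slot (p := a) (q := b) (l := ε) (by linarith) [x, x']
      (by norm_num; linarith)
    simp only [List.mem_cons, List.not_mem_nil, or_false, forall_eq_or_imp, forall_eq] at c3
    obtain ⟨A1, A2⟩ := c3
    obtain ⟨L1, hL1, e1⟩ := exists_isAff_of_slope one_pos (x - c)
    obtain ⟨L2, hL2, e2⟩ := exists_isAff_of_slope hl (x' - l * c)
    have hm := hrot (x := c) (y := c + u) (z := c + u + v) c1 (by linarith) (by linarith)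
      (by linarith)
    have i1 := class_conj_eq hM hD hmul hone hm (c := c) (d := c + u + v)
      (rot_fixed le_rfl le_rfl) hL1
      (A1.imp (fun h => by rw [e1]; linarith) fun h => by rw [e1]; linarith) (by linarith) c1
      (by linarith) (by rw [e1]; linarith) (by rw [e1]; linarith)
    have i2 := class_conj_eq hM hD hmul hone hm (c := c) (d := c + u + v)
      (rot_fixed le_rfl le_rfl) hL2
      (A2.imp (fun h => by rw [e2]; linarith) fun h => by rw [e2]; linarith) (by linarith) c1
      (by linarith) (by rw [e2]; linarith) (by rw [e2]; linarith)
    rw [conj_rot_of_isAff hL1 (by linarith) (by linarith)] at i1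
    rw [conj_rot_of_isAff hL2 (by linarith) (by linarith)] at i2
    rw [e1, e1, e1] at i1
    rw [e2, e2, e2] at i2
    rw [show x = 1 * c + (x - c) by ring, show 1 * c + (x - c) + u = 1 * (c + u) + (x - c) by ring,
      show 1 * (c + u) + (x - c) + v = 1 * (c + u + v) + (x - c) by ring, i1, ← i2]
    congr 2 <;> ring
  set r : ℝ → ℝ → Γ := fun u v => cl (rot a (a + u) (a + u + v)) with hr
  have hpos : ∀ x u v, 0 ≤ u → 0 ≤ v → u + v ≤ ε → a ≤ x → x + u + v ≤ b →
      cl (rot x (x + u) (x + u + v)) = r u v := by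
    intro x u v hu hv hs h1 h2
    have := haff x a u v 1 one_pos hu hv hs (by linarith) h1 h2 le_rfl (by linarith)
    rwa [one_mul, one_mul] at this
  have hscale : ∀ u v, 0 ≤ u → 0 ≤ v → 2 * (u + v) ≤ ε → r (2 * u) (2 * v) = r u v := by
    intro u v hu hv hs
    exact (haff a a u v 2 two_pos hu hv (by linarith) hs le_rfl (by linarith) le_rfl
      (by linarith)).symm
  have haddr : ∀ u v v', 0 ≤ u → 0 ≤ v → 0 ≤ v' → u + (v + v') ≤ ε →
      r u (v + v') = r u v' * r u v := by
    intro u v v' hu hv hv' hs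
    have e := rot_add_right (x := a) (y := a + u) (z := a + u + v) (z' := a + u + (v + v'))
      (by linarith) (by linarith) (by linarith)
    simp only [hr]
    rw [← e, hmul _ (hrot (by linarith) (by linarith) (by linarith) (by linarith)) _
      (hrot (by linarith) (by linarith) (by linarith) (by linarith))]
    congr 1
    refine Eq.trans ?_ (hpos (a + v) u v' hu hv' (by linarith) (by linarith) (by linarith))
    congr 2 <;> ring
  have haddl : ∀ u u' v, 0 ≤ u → 0 ≤ u' → 0 ≤ v → u + u' + v ≤ ε →
      r (u + u') v = r u v * r u' v := by
    intro u u' v hu hu' hv hs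
    have e := rot_add_left (x := a) (x' := a + u) (y := a + (u + u')) (z := a + (u + u') + v)
      (by linarith) (by linarith) (by linarith)
    simp only [hr]
    rw [← e, hmul _ (hrot (by linarith) (by linarith) (by linarith) (by linarith)) _
      (hrot (by linarith) (by linarith) (by linarith) (by linarith))]
    congr 1
    · congr 2; ring
    · rw [show a + (u + u') = a + u + u' by ring, hpos (a + u) u' v hu' hv (by linarith)
        (by linarith) (by linarith)]
  -- Doubling both lengths preserves the class by scaling and raises it to the fourth power by
  -- additivity.
  have hcube : ∀ u v, 0 ≤ u → 0 ≤ v → 2 * (u + v) ≤ ε → r u v ^ 3 = 1 := by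
    intro u v hu hv hs
    have h1 : r (2 * u) (2 * v) = r u v ^ 4 := by
      rw [two_mul v, haddr _ _ _ (by linarith) hv hv (by linarith), two_mul,
        haddl u u v hu hu hv (by linarith)]
      simp only [pow_succ, pow_zero, one_mul, mul_assoc]
    rw [hscale u v hu hv hs] at h1
    have : r u v * r u v ^ 3 = r u v * 1 := by rw [mul_one, ← pow_succ', ← h1]
    exact mul_left_cancel this
  have htriv : ∀ u v, 0 ≤ u → 0 ≤ v → 2 * (u + v) ≤ ε → r u v = 1 := by
    intro u v hu hv hs
    have e : u = u / 3 + (u / 3 + u / 3) := by ring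
    rw [e, haddl _ _ _ (by linarith) (by linarith) hv (by linarith),
      haddl _ _ _ (by linarith) (by linarith) hv (by linarith), ← mul_assoc, ← pow_three',
      hcube _ _ (by linarith) hv (by linarith)]
  refine rot_mem_of_small (ε := ε / 2) (by linarith) fun x y z hx hxy hyz hz hs => ?_
  rw [← hone _ (hrot hx hxy hyz hz)]
  have := hpos x (y - x) (z - y) (by linarith) (by linarith) (by linarith) hx (by linarith)
  rw [htriv _ _ (by linarith) (by linarith) (by linarith)] at this
  rw [← this]
  congr 2 <;> ring

end AffineSwaps

/-! ### Increasing affine maps with two pieces, and generation of 𝒜⁺. -/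

section Bumps

/-- The piecewise affine map of the line that is the identity outside `[p, q)` and maps `[p, x)`
onto `[p, y)` and `[x, q)` onto `[y, q)` affinely. -/
noncomputable def bumpFun (p x y q w : ℝ) : ℝ :=
  if w < p ∨ q ≤ w then w else
    if w < x then p + (y - p) / (x - p) * (w - p) else q - (q - y) / (q - x) * (q - w)

theorem bumpFun_bumpFun {p x y q : ℝ} (hpx : p < x) (hxq : x < q) (hpy : p < y) (hyq : y < q)
    (w : ℝ) : bumpFun p y x q (bumpFun p x y q w) = w := by
  have hx1 : x - p ≠ 0 := by linarith
  have hx2 : q - x ≠ 0 := by linarith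
  have hy1 : y - p ≠ 0 := by linarith
  have hy2 : q - y ≠ 0 := by linarith
  by_cases hw : w < p ∨ q ≤ w
  · simp [bumpFun, hw]
  have hw' := hw
  push Not at hw'
  by_cases hwx : w < x
  · have e : bumpFun p x y q w = p + (y - p) / (x - p) * (w - p) := by
      rw [bumpFun, if_neg hw, if_pos hwx]
    have h1 : 0 ≤ (y - p) / (x - p) * (w - p) :=
      mul_nonneg (div_pos (by linarith) (by linarith)).le (by linarith)
    have h2 : (y - p) / (x - p) * (w - p) < y - p := by
      rw [div_mul_eq_mul_div, div_lt_iff₀ (by linarith)]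
      exact mul_lt_mul_of_pos_left (by linarith) (by linarith)
    rw [e, bumpFun, if_neg, if_pos (by linarith)]
    · field_simp
      ring
    · push Not
      constructor <;> linarith
  · have e : bumpFun p x y q w = q - (q - y) / (q - x) * (q - w) := by
      rw [bumpFun, if_neg hw, if_neg hwx]
    have h1 : 0 < (q - y) / (q - x) * (q - w) :=
      mul_pos (div_pos (by linarith) (by linarith)) (by linarith)
    have h2 : (q - y) / (q - x) * (q - w) ≤ q - y := by
      rw [div_mul_eq_mul_div, div_le_iff₀ (by linarith)]
      exact mul_le_mul_of_nonneg_left (by linarith) (by linarith)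
    rw [e, bumpFun, if_neg, if_neg (by linarith)]
    · field_simp
      ring
    · push Not
      constructor <;> linarith

/-- The bijection of the line that is the identity outside `[p, q)` and maps `[p, x)` onto `[p, y)`
and `[x, q)` onto `[y, q)` affinely. -/
noncomputable def bump (p x y q : ℝ) : Perm ℝ :=
  if h : (p < x ∧ x < q) ∧ p < y ∧ y < q then
    { toFun := bumpFun p x y q
      invFun := bumpFun p y x q
      left_inv := bumpFun_bumpFun h.1.1 h.1.2 h.2.1 h.2.2
      right_inv := bumpFun_bumpFun h.2.1 h.2.2 h.1.1 h.1.2 }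
  else 1

variable {p x y q w : ℝ}

theorem bump_apply (hpx : p < x) (hxq : x < q) (hpy : p < y) (hyq : y < q) (w : ℝ) :
    bump p x y q w = bumpFun p x y q w := by
  rw [bump, dif_pos ⟨⟨hpx, hxq⟩, hpy, hyq⟩]
  rfl

theorem bump_other (h : w < p ∨ q ≤ w) : bump p x y q w = w := by
  by_cases h' : (p < x ∧ x < q) ∧ p < y ∧ y < q
  · rw [bump_apply h'.1.1 h'.1.2 h'.2.1 h'.2.2, bumpFun, if_pos h]
  · rw [bump, dif_neg h']
    rfl

theorem bump_left (hpx : p < x) (hxq : x < q) (hpy : p < y) (hyq : y < q) (h1 : p ≤ w)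
    (h2 : w < x) {k : ℝ} (hk : y - p = k * (x - p)) : bump p x y q w = p + k * (w - p) := by
  have hx1 : x - p ≠ 0 := by linarith
  have : k = (y - p) / (x - p) := by rw [hk]; field_simp
  rw [bump_apply hpx hxq hpy hyq, bumpFun, if_neg, if_pos h2, this]
  push Not
  constructor <;> linarith

theorem bump_right (hpx : p < x) (hxq : x < q) (hpy : p < y) (hyq : y < q) (h1 : x ≤ w)
    (h2 : w < q) {k : ℝ} (hk : q - y = k * (q - x)) : bump p x y q w = q - k * (q - w) := by
  have hx1 : q - x ≠ 0 := by linarith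
  have : k = (q - y) / (q - x) := by rw [hk]; field_simp
  rw [bump_apply hpx hxq hpy hyq, bumpFun, if_neg, if_neg (by linarith), this]
  push Not
  constructor <;> linarith

theorem conj_bump_of_isAff {L : Perm ℝ} (hL : IsAff L) (hpx : p < x) (hxq : x < q) (hpy : p < y)
    (hyq : y < q) : L * bump p x y q * L⁻¹ = bump (L p) (L x) (L y) (L q) := by
  have hm := hL.strictMono
  obtain ⟨l, β, hl, h⟩ := hL
  have hx1 : x - p ≠ 0 := by linarith
  have hx2 : q - x ≠ 0 := by linarith
  ext w
  obtain ⟨w, rfl⟩ := L.surjective w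
  rw [Perm.mul_apply, Perm.mul_apply, inv_apply_self]
  by_cases hw : w < p ∨ q ≤ w
  · rw [bump_other hw, bump_other]
    rwa [hm.lt_iff_lt, hm.le_iff_le]
  push Not at hw
  by_cases hwx : w < x
  · have hk : y - p = (y - p) / (x - p) * (x - p) := by field_simp
    have hk' : L y - L p = (y - p) / (x - p) * (L x - L p) := by
      simp only [h]
      field_simp
      ring
    rw [bump_left hpx hxq hpy hyq hw.1 hwx hk, bump_left (hm hpx) (hm hxq) (hm hpy) (hm hyq)
      (hm.monotone hw.1) (hm hwx) hk']
    simp only [h]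
    ring
  · push Not at hwx
    have hk : q - y = (q - y) / (q - x) * (q - x) := by field_simp
    have hk' : L q - L y = (q - y) / (q - x) * (L q - L x) := by
      simp only [h]
      field_simp
      ring
    rw [bump_right hpx hxq hpy hyq hwx hw.2 hk, bump_right (hm hpx) (hm hxq) (hm hpy) (hm hyq)
      (hm.monotone hwx) (hm hw.2) hk']
    simp only [h]
    ring

variable {a b : ℝ}

theorem bump_fixed (hp : a ≤ p) (hq : q ≤ b) : ∀ w ∉ Ico a b, bump p x y q w = w :=
  fun w hw => by
    rw [mem_Ico, not_and_or, not_le, not_lt] at hw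
    exact bump_other (hw.imp (fun h => h.trans_le hp) fun h => hq.trans h)

theorem bump_mem_affineIET (hp : a ≤ p) (hpx : p < x) (hxq : x < q) (hpy : p < y) (hyq : y < q)
    (hq : q ≤ b) : bump p x y q ∈ (affineIET a b).map (extend a b) := by
  rw [mem_affineIET_extend]
  refine ⟨bump_fixed hp hq, {p, x, q}, by simp, fun u v hu huv hv hp => ?_⟩
  simp only [mem_insert_iff, mem_singleton_iff, forall_eq_or_imp, forall_eq] at hp
  obtain ⟨p1, p2, p3⟩ := hp
  have hx1 : x - p ≠ 0 := by linarith
  have hx2 : q - x ≠ 0 := by linarith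
  by_cases hA : p ≤ u ∧ v ≤ q
  · rcases p2 with p2 | p2
    · refine ⟨(q - y) / (q - x), q - (q - y) / (q - x) * q, div_pos (by linarith) (by linarith),
        fun w hw => ?_⟩
      rw [bump_right hpx hxq hpy hyq (p2.trans hw.1) (hw.2.trans_le hA.2)
        (k := (q - y) / (q - x)) (by field_simp)]
      ring
    · refine ⟨(y - p) / (x - p), p - (y - p) / (x - p) * p, div_pos (by linarith) (by linarith),
        fun w hw => ?_⟩
      rw [bump_left hpx hxq hpy hyq (hA.1.trans hw.1) (hw.2.trans_le p2)
        (k := (y - p) / (x - p)) (by field_simp)]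
      ring
  · rw [not_and_or, not_le, not_le] at hA
    refine ⟨1, 0, one_pos, fun w hw => ?_⟩
    rw [one_mul, add_zero]
    apply bump_other
    rcases hA with hA | hA
    · left
      rcases p1 with p | p <;> linarith [hw.2]
    · right
      rcases p3 with p | p <;> linarith [hw.1]

/-- Both sides map four consecutive intervals affinely onto four consecutive intervals; the
rotations exchange the two intervals in the middle. -/
theorem bump_mul_bump {h s t : ℝ} (hs : 0 < s) (hsh : s < h) (ht : 0 < t) (hth : t < h) :
    bump p (p + s) (p + t) (p + h) * bump (p + h) (p + h + s) (p + h + t) (p + 2 * h) *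
        rot (p + s) (p + 2 * s) (p + h + s) =
      rot (p + t) (p + 2 * t) (p + h + t) *
        bump p (p + 2 * s) (p + 2 * t) (p + 2 * h) := by
  obtain ⟨k, hk⟩ : ∃ k, t = k * s := ⟨t / s, by field_simp⟩
  have hhs : h - s ≠ 0 := by linarith
  obtain ⟨m, hm⟩ : ∃ m, h - t = m * (h - s) := ⟨(h - t) / (h - s), by field_simp⟩
  have hk0 : 0 < k := by
    rcases (pos_iff_pos_of_mul_pos (hk ▸ ht)).2 hs with h; exact h
  have hm0 : 0 < m := (pos_iff_pos_of_mul_pos (hm ▸ sub_pos.2 hth)).2 (sub_pos.2 hsh)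
  have bA : ∀ w, p ≤ w → w < p + s →
      bump p (p + s) (p + t) (p + h) w = p + k * (w - p) := fun w h1 h2 =>
    bump_left (by linarith) (by linarith) (by linarith) (by linarith) h1 h2 (by linarith)
  have bB : ∀ w, p + s ≤ w → w < p + h →
      bump p (p + s) (p + t) (p + h) w = p + h - m * (p + h - w) := fun w h1 h2 =>
    bump_right (by linarith) (by linarith) (by linarith) (by linarith) h1 h2 (by linarith)
  have bC : ∀ w, p + h ≤ w → w < p + h + s →
      bump (p + h) (p + h + s) (p + h + t) (p + 2 * h) w = p + h + k * (w - (p + h)) :=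
    fun w h1 h2 =>
      bump_left (by linarith) (by linarith) (by linarith) (by linarith) h1 h2 (by linarith)
  have bD : ∀ w, p + h + s ≤ w → w < p + 2 * h →
      bump (p + h) (p + h + s) (p + h + t) (p + 2 * h) w = p + 2 * h - m * (p + 2 * h - w) :=
    fun w h1 h2 =>
      bump_right (by linarith) (by linarith) (by linarith) (by linarith) h1 h2 (by linarith)
  have bE : ∀ w, p ≤ w → w < p + 2 * s →
      bump p (p + 2 * s) (p + 2 * t) (p + 2 * h) w = p + k * (w - p) := fun w h1 h2 =>
    bump_left (by linarith) (by linarith) (by linarith) (by linarith) h1 h2 (by linarith)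
  have bF : ∀ w, p + 2 * s ≤ w → w < p + 2 * h →
      bump p (p + 2 * s) (p + 2 * t) (p + 2 * h) w = p + 2 * h - m * (p + 2 * h - w) :=
    fun w h1 h2 =>
      bump_right (by linarith) (by linarith) (by linarith) (by linarith) h1 h2 (by linarith)
  ext w
  simp only [Perm.mul_apply]
  rcases lt_or_ge w p with h1 | h1
  · rw [rot_other (w := w) (by left; linarith), bump_other (w := w) (by left; linarith),
      bump_other (w := w) (by left; linarith), bump_other (w := w) (by left; linarith),
      rot_other (by left; linarith)]
  rcases lt_or_ge w (p + s) with h2 | h2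
  · have i1 : k * (w - p) < k * s := mul_lt_mul_of_pos_left (by linarith) hk0
    rw [rot_other (w := w) (by left; linarith), bump_other (w := w) (by left; linarith),
      bA w h1 h2, bE w h1 (by linarith), rot_other (by left; linarith)]
  rcases lt_or_ge w (p + 2 * s) with h3 | h3
  · have i1 : k * (w - p) < k * (2 * s) := mul_lt_mul_of_pos_left (by linarith) hk0
    have i2 : k * s ≤ k * (w - p) := mul_le_mul_of_nonneg_left (by linarith) hk0.le
    rw [rot_left (by linarith) h2 h3, bC _ (by linarith) (by linarith),
      bump_other (by right; nlinarith), bE w h1 h3, rot_left (by linarith) (by linarith)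
      (by linarith)]
    rw [hk]
    ring
  rcases lt_or_ge w (p + h + s) with h4 | h4
  · have i1 : m * (p + 2 * h - w) ≤ m * (2 * (h - s)) :=
      mul_le_mul_of_nonneg_left (by linarith) hm0.le
    have i2 : m * (h - s) < m * (p + 2 * h - w) := mul_lt_mul_of_pos_left (by linarith) hm0
    rw [rot_right (by linarith) h3 h4, bump_other (w := w + (p + s - (p + 2 * s)))
      (by left; linarith), bB _ (by linarith)
      (by linarith), bF w h3 (by linarith), rot_right (by linarith) (by linarith) (by linarith)]
    linear_combination -hm
  rcases lt_or_ge w (p + 2 * h) with h5 | h5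
  · have i2 : m * (p + 2 * h - w) ≤ m * (h - s) :=
      mul_le_mul_of_nonneg_left (by linarith) hm0.le
    have i1 : 0 < m * (p + 2 * h - w) := mul_pos hm0 (by linarith)
    rw [rot_other (w := w) (by right; linarith), bD w h4 h5, bump_other (by right; linarith),
      bF w h3 h5, rot_other (by right; linarith)]
  · rw [rot_other (w := w) (by right; linarith), bump_other (w := w) (by right; linarith),
      bump_other (w := w) (by right; linarith), bump_other (w := w) (by right; linarith),
      rot_other (by right; linarith)]

/-- Rotations being trivial modulo M, `bump_mul_bump` makes a bump the product of two half-size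
bumps of the same shape. Equally shaped bumps on disjoint intervals have the same class, so this
class is idempotent. -/
theorem bump_mem_of_derivedIET_le (hab : a < b) {M : Subgroup (Perm ℝ)}
    (hM : ∀ g ∈ (affineIET a b).map (extend a b), ∀ m ∈ M, g * m * g⁻¹ ∈ M)
    (hD : derivedIET a b ≤ M) (hp : a ≤ p) (hpx : p < x) (hxq : x < q) (hpy : p < y)
    (hyq : y < q) (hq : q ≤ b) : bump p x y q ∈ M := by
  obtain ⟨Γ, _, cl, hmul, hone⟩ := exists_class hM
  obtain ⟨h, rfl⟩ : ∃ h, q = p + 2 * h := ⟨(q - p) / 2, by ring⟩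
  have hh : 0 < h := by linarith
  obtain ⟨s, rfl⟩ : ∃ s, x = p + 2 * (s * h) := ⟨(x - p) / (2 * h), by field_simp; ring⟩
  obtain ⟨t, rfl⟩ : ∃ t, y = p + 2 * (t * h) := ⟨(y - p) / (2 * h), by field_simp; ring⟩
  have hs0 : 0 < s := pos_of_mul_pos_left (b := h) (by linarith) hh.le
  have ht0 : 0 < t := pos_of_mul_pos_left (b := h) (by linarith) hh.le
  have hs1 : s < 1 := by
    by_contra hc
    have := mul_le_mul_of_nonneg_right (not_lt.1 hc) hh.le
    linarith
  have ht1 : t < 1 := by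
    by_contra hc
    have := mul_le_mul_of_nonneg_right (not_lt.1 hc) hh.le
    linarith
  -- The ratios s and t fix the shape; position and length remain free.
  set φ : ℝ → ℝ → Γ := fun p h => cl (bump p (p + s * h) (p + t * h) (p + h)) with hφ
  have hmem : ∀ p h, a ≤ p → 0 < h → p + h ≤ b →
      bump p (p + s * h) (p + t * h) (p + h) ∈ (affineIET a b).map (extend a b) := by
    intro p h h1 h2 h3
    have e1 : 0 < s * h := by positivity
    have e2 : 0 < t * h := by positivity
    have e3 : s * h < 1 * h := by gcongr
    have e4 : t * h < 1 * h := by gcongr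
    exact bump_mem_affineIET h1 (by linarith) (by linarith) (by linarith) (by linarith) h3
  have hdisj : ∀ p h p' h', a ≤ p → 0 < h → p + h ≤ b → a ≤ p' → 0 < h' → p' + h' ≤ b →
      (p + h ≤ p' ∨ p' + h' ≤ p) → φ p h = φ p' h' := by
    intro p h p' h' h1 h2 h3 h4 h5 h6 h7
    have e1 : 0 < s * h := by positivity
    have e2 : 0 < t * h := by positivity
    have e3 : s * h < 1 * h := by gcongr
    have e4 : t * h < 1 * h := by gcongr
    have hl : 0 < h' / h := div_pos h5 h2
    obtain ⟨L, hL, e⟩ := exists_isAff_of_slope hl (p' - h' / h * p)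
    have ea : ∀ c, L (p + c * h) = p' + c * h' := fun c => by
      rw [e]; field_simp; ring
    have ep : L p = p' := by simpa using ea 0
    have eq : L (p + h) = p' + h' := by simpa using ea 1
    have := class_conj_eq hM hD hmul hone (hmem p h h1 h2 h3) (c := p) (d := p + h)
      (bump_fixed le_rfl le_rfl) hL (by rwa [ep, eq]) (by linarith) h1 h3 (by rwa [ep])
      (by rwa [eq])
    rw [conj_bump_of_isAff hL (by linarith) (by linarith) (by linarith) (by linarith), ep, eq,
      ea, ea] at this
    exact this.symm
  have hdouble : ∀ p h, a ≤ p → 0 < h → p + 2 * h ≤ b →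
      φ p (2 * h) = φ p h * φ (p + h) h := by
    intro p h h1 h2 h3
    have e1 : 0 < s * h := by positivity
    have e2 : 0 < t * h := by positivity
    have e3 : s * h < 1 * h := by gcongr
    have e4 : t * h < 1 * h := by gcongr
    have key := bump_mul_bump (p := p) e1 (by linarith) e2 (by linarith)
    have m1 := hmem p h h1 h2 (by linarith)
    have m2 := hmem (p + h) h (by linarith) h2 (by linarith)
    have m3 := hmem p (2 * h) h1 (by linarith) h3
    rw [show p + h + h = p + 2 * h by ring] at m2
    rw [show s * (2 * h) = 2 * (s * h) by ring, show t * (2 * h) = 2 * (t * h) by ring] at m3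
    have r1 : ∀ c, 0 < c → c < 1 → rot (p + c * h) (p + 2 * (c * h)) (p + h + c * h) ∈
        (affineIET a b).map (extend a b) ∧
        cl (rot (p + c * h) (p + 2 * (c * h)) (p + h + c * h)) = 1 := by
      intro c hc hc1
      have e1 : 0 < c * h := by positivity
      have e3 : c * h < 1 * h := by gcongr
      have := iet_le_affineIET_extend (rot_mem_iet (a := a) (b := b) (x := p + c * h)
        (y := p + 2 * (c * h)) (z := p + h + c * h) (by linarith) (by linarith) (by linarith)
        (by linarith))
      exact ⟨this, (hone _ this).2 (rot_mem_of_derivedIET_le hab hM hD _ _ _ (by linarith)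
        (by linarith) (by linarith) (by linarith))⟩
    have key' := congrArg cl key
    rw [hmul _ (mul_mem m1 m2) _ (r1 s hs0 hs1).1, hmul _ m1 _ m2, (r1 s hs0 hs1).2,
      hmul _ (r1 t ht0 ht1).1 _ m3, (r1 t ht0 ht1).2, mul_one, one_mul] at key'
    simp only [hφ]
    rw [show s * (2 * h) = 2 * (s * h) by ring, show t * (2 * h) = 2 * (t * h) by ring, ← key',
      show p + h + h = p + 2 * h by ring]
  -- The bump on `[p, p + h)` and its two halves all have the class of the bump on the disjoint
  -- interval `[p + h, p + 2 * h)`.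
  have hhalf : φ p h = 1 := by
    have d1 := hdouble p (h / 2) hp (by linarith) (by linarith)
    rw [show 2 * (h / 2) = h by ring, hdisj p (h / 2) (p + h) h hp (by linarith) (by linarith)
      (by linarith) hh (by linarith) (by left; linarith), hdisj (p + h / 2) (h / 2) (p + h) h
      (by linarith) (by linarith) (by linarith) (by linarith) hh (by linarith)
      (by left; linarith), hdisj p h (p + h) h hp hh (by linarith) (by linarith) hh (by linarith)
      (by left; linarith)] at d1
    rw [hdisj p h (p + h) h hp hh (by linarith) (by linarith) hh (by linarith)
      (by left; linarith)]
    exact (mul_eq_left.1 d1.symm)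
  have hfin := hdouble p h hp hh hq
  rw [← hdisj p h (p + h) h hp hh (by linarith) (by linarith) hh (by linarith)
      (by left; linarith), hhalf, mul_one] at hfin
  rw [← hone]
  · rw [← hfin]
    simp only [hφ]
    congr 2 <;> ring
  · convert hmem p (2 * h) hp (by linarith) hq using 2 <;> ring

theorem strictMono_bump (hpx : p < x) (hxq : x < q) (hpy : p < y) (hyq : y < q) :
    StrictMono (bump p x y q) := by
  refine strictMono_of_strictMonoOn (a := p) (b := q) (bump_fixed le_rfl le_rfl) ?_
  have hx1 : x - p ≠ 0 := by linarith
  have hx2 : q - x ≠ 0 := by linarith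
  obtain ⟨k, hk0, hk⟩ : ∃ k, 0 < k ∧ y - p = k * (x - p) :=
    ⟨(y - p) / (x - p), div_pos (by linarith) (by linarith), by field_simp⟩
  obtain ⟨m, hm0, hm⟩ : ∃ m, 0 < m ∧ q - y = m * (q - x) :=
    ⟨(q - y) / (q - x), div_pos (by linarith) (by linarith), by field_simp⟩
  intro u hu v hv huv
  rcases lt_or_ge v x with h | h
  · rw [bump_left hpx hxq hpy hyq hu.1 (huv.trans h) hk, bump_left hpx hxq hpy hyq hv.1 h hk]
    gcongr
  · rw [bump_right hpx hxq hpy hyq h hv.2 hm]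
    have h2 : m * (q - v) ≤ m * (q - x) := by gcongr
    rcases lt_or_ge u x with h' | h'
    · rw [bump_left hpx hxq hpy hyq hu.1 h' hk]
      have h1 : k * (u - p) < k * (x - p) := by gcongr
      linarith
    · rw [bump_right hpx hxq hpy hyq h' hu.2 hm]
      gcongr

/-- The affine pieces are undone from left to right. If k is the identity up to the cut point x and
affine on `[x, y)`, a bump on `[x, b)` sending k y to y makes it the identity up to y. -/
theorem mem_of_bump_mem (hab : a < b) {M : Subgroup (Perm ℝ)}
    (hM : ∀ p x y, a ≤ p → p < x → x < b → p < y → y < b → bump p x y b ∈ M) {f : Perm ℝ}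
    (hf : CutGood (fun f c d => PosAffOn f (Ico c d)) a b f) (hm : StrictMono f) : f ∈ M := by
  obtain ⟨hfix, P0, hP0, hgood⟩ := hf
  set P : Set ℝ := P0 ∪ {a, b} with hPdef
  have hP : P.Finite := hP0.union (by simp)
  let Q : ℝ → Prop := fun x => ∃ k : Perm ℝ, f * k⁻¹ ∈ M ∧ StrictMono k ∧
    (∀ w ∉ Ico x b, k w = w) ∧
    (∀ c d, x ≤ c → c < d → d ≤ b → (∀ p ∈ P, p ≤ c ∨ d ≤ p) → PosAffOn k (Ico c d))
  have hQa : Q a := ⟨f, by simp, hm, hfix, fun c d hc hcd hd hp =>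
    hgood c d hc hcd hd fun p hp' => hp p (Or.inl hp')⟩
  obtain ⟨x, ⟨hxP, ⟨hax, hxb⟩, hQx⟩, hmax⟩ :=
    (hP.subset (inter_subset_left (t := Icc a b ∩ {x | Q x}))).exists_maximalFor id _
      ⟨a, by simp [hPdef], ⟨le_rfl, hab.le⟩, hQa⟩
  obtain ⟨k, hkM, hkm, hkfix, hkgood⟩ := hQx
  suffices hx : x = b by
    have : k = 1 := by
      ext w
      exact hkfix w (by rw [hx, Ico_self]; simp)
    rwa [this, inv_one, mul_one] at hkM
  by_contra hne
  obtain ⟨y, hxy, hyb, hyP, hgap⟩ := exists_gap_right hP x (lt_of_le_of_ne hxb hne)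
  have hyP : y ∈ P := by
    rcases hyP with h | rfl
    · exact h
    · simp [hPdef]
  have hkx := apply_left_of_strictMono hkfix hkm
  obtain ⟨l, β, hl, hlβ⟩ := hkgood x y le_rfl hxy hyb hgap
  have hlx : x = l * x + β := by rw [← hlβ x ⟨le_rfl, hxy⟩, hkx]
  have hly : k y = l * y + β := by
    have hcl : ∀ w ∈ Icc x y, k w = l * w + β := by
      rw [← closure_Ico hxy.ne]
      exact fun w hw => closure_minimal (t := {w | k w = l * w + β}) hlβ
        (isClosed_eq (continuous_of_strictMono hkm) (by fun_prop)) hw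
    exact hcl y ⟨hxy.le, le_rfl⟩
  have : Q y := by
    rcases hyb.lt_or_eq with hyb' | rfl
    · have hky : x < k y := by rw [← hkx]; exact hkm hxy
      have hkyb : k y < b := by
        have := hkm hyb'
        rwa [hkfix b (fun h => lt_irrefl _ h.2)] at this
      have hxb' : x < b := hxy.trans hyb'
      set g := bump x (k y) y b with hg
      have hgM : g ∈ M := hM x (k y) y hax hky hkyb hxy hyb'
      have hid : ∀ w ∈ Ico x y, (g * k) w = w := by
        intro w hw
        have h1 : x ≤ k w := by rw [← hkx]; exact hkm.monotone hw.1
        rw [Perm.mul_apply, hg, bump_left hky hkyb hxy hyb' h1 (hkm hw.2) (k := l⁻¹), hlβ w hw]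
        · field_simp
          linarith
        · rw [hly]
          field_simp
          linarith
      refine ⟨g * k, ?_, (strictMono_bump hky hkyb hxy hyb').comp hkm, fun w hw => ?_, ?_⟩
      · have e : f * (g * k)⁻¹ = f * k⁻¹ * g⁻¹ := by group
        rw [e]
        exact mul_mem hkM (inv_mem hgM)
      · by_cases hwx : w ∈ Ico x b
        · refine hid w ⟨hwx.1, ?_⟩
          by_contra hc
          exact hw ⟨not_lt.1 hc, hwx.2⟩
        · rw [Perm.mul_apply, hkfix w hwx, hg, bump_fixed le_rfl le_rfl w hwx]
      · intro c d hc hcd hd hp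
        obtain ⟨l', β', hl', h'⟩ := hkgood c d (hxy.le.trans hc) hcd hd hp
        have hk1 : b - k y ≠ 0 := by linarith
        refine ⟨(b - y) / (b - k y) * l', b - (b - y) / (b - k y) * (b - β'),
          mul_pos (div_pos (by linarith) (by linarith)) hl', fun w hw => ?_⟩
        have h2 : k w < b := by
          have := hkm (hw.2.trans_le hd)
          rwa [hkfix b (fun h => lt_irrefl _ h.2)] at this
        rw [Perm.mul_apply, hg, bump_right hky hkyb hxy hyb' (hkm.monotone (hc.trans hw.1)) h2
          (k := (b - y) / (b - k y)) (by field_simp), h' w hw]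
        ring
    -- On the last piece no bump is needed: an affine map fixing both endpoints is the identity.
    · have hl1 : l = 1 := by
        rw [hkfix y (fun h => lt_irrefl _ h.2)] at hly
        have : (l - 1) * (y - x) = 0 := by linarith
        rcases mul_eq_zero.1 this with h | h <;> linarith
      refine ⟨k, hkM, hkm, fun w _ => ?_, fun c d hc hcd hd => by linarith⟩
      by_cases hw : w ∈ Ico x y
      · rw [hlβ w hw]
        rw [hl1] at hlx ⊢
        linarith
      · exact hkfix w hw
  exact absurd (hmax ⟨hyP, ⟨hax.trans hxy.le, hyb⟩, this⟩ hxy.le) (not_le.2 hxy)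

/-- A group of bijections that is normalised by the group of affine interval exchange
transformations and contains the commutator subgroup of the group of interval exchange
transformations contains all affine interval exchange transformations. -/
theorem affineIET_le_of_derivedIET_le (hab : a < b) {M : Subgroup (Perm ℝ)}
    (hM : ∀ g ∈ (affineIET a b).map (extend a b), ∀ m ∈ M, g * m * g⁻¹ ∈ M)
    (hD : derivedIET a b ≤ M) : (affineIET a b).map (extend a b) ≤ M := by
  intro f hf
  obtain ⟨h, hh, hm⟩ := exists_mul_strictMono hab
    (M := M ⊓ (affineIET a b).map (extend a b)) (mem_generalisedIET_extend.1
      (affineIET_le_generalisedIET_extend hf)) fun x y z h1 h2 h3 h4 =>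
      ⟨rot_mem_of_derivedIET_le hab hM hD x y z h1 h2 h3 h4,
        iet_le_affineIET_extend (rot_mem_iet h1 h2 h3 h4)⟩
  have := mem_of_bump_mem hab (M := M) (fun p x y h1 h2 h3 h4 h5 =>
    bump_mem_of_derivedIET_le hab hM hD h1 h2 h3 h4 h5 le_rfl)
    (mem_affineIET_extend.1 (mul_mem hh.2 hf)) hm
  have e : f = h⁻¹ * (h * f) := by group
  rw [e]
  exact mul_mem (inv_mem hh.1) this

end Bumps

/-! ### Infinite products of conjugates with disjoint supports. -/

section InfiniteProduct

open Classical in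
-- The translates of s by powers of L are pairwise disjoint, so the conjugates of f can be applied
-- simultaneously; the same construction for f⁻¹ is the inverse.
theorem exists_infinite_product {X : Type*} {L f : Perm X} {s : Set X}
    (hdis : ∀ (m n : ℕ) x, (L ^ m)⁻¹ x ∈ s → (L ^ n)⁻¹ x ∈ s → m = n) (hf : ∀ x ∉ s, f x = x) :
    ∃ F : Perm X, (∀ (n : ℕ) x, (L ^ n)⁻¹ x ∈ s → F x = (L ^ n * f * (L ^ n)⁻¹) x) ∧
      ∀ x, (∀ n : ℕ, (L ^ n)⁻¹ x ∉ s) → F x = x := by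
  let F : Perm X → X → X := fun f x => if h : ∃ n : ℕ, (L ^ n)⁻¹ x ∈ s then
    (L ^ h.choose * f * (L ^ h.choose)⁻¹) x else x
  have h1 : ∀ (f : Perm X) (n : ℕ) x, (L ^ n)⁻¹ x ∈ s → F f x = (L ^ n * f * (L ^ n)⁻¹) x := by
    intro f n x hx
    have h : ∃ n : ℕ, (L ^ n)⁻¹ x ∈ s := ⟨n, hx⟩
    simp only [F, dif_pos h, hdis _ _ x h.choose_spec hx]
  have h2 : ∀ (f : Perm X) x, (∀ n : ℕ, (L ^ n)⁻¹ x ∉ s) → F f x = x := by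
    intro f x hx
    simp only [F, dif_neg (not_exists.2 hx)]
  have h3 : ∀ f : Perm X, (∀ x ∉ s, f x = x) → ∀ x, F f⁻¹ (F f x) = x := by
    intro f hf x
    by_cases h : ∃ n : ℕ, (L ^ n)⁻¹ x ∈ s
    · obtain ⟨n, hx⟩ := h
      have e : (L ^ n)⁻¹ (F f x) = f ((L ^ n)⁻¹ x) := by
        rw [h1 f n x hx, Perm.mul_apply, Perm.mul_apply, inv_apply_self]
      rw [h1 f⁻¹ n _ (by rw [e]; exact mem_of_fixed_compl hf hx), Perm.mul_apply, Perm.mul_apply,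
        e, inv_apply_self, apply_inv_self]
    · rw [h2 f x (not_exists.1 h), h2 _ x (not_exists.1 h)]
  refine ⟨⟨F f, F f⁻¹, h3 f hf, fun x => ?_⟩, h1 f, h2 f⟩
  have := h3 f⁻¹ (fun x hx => inv_apply_of_fixed (hf x hx)) x
  rwa [inv_inv] at this

/-- Conjugation by L shifts the factors by one and so removes exactly the first. -/
theorem infinite_product_eq {X : Type*} {L f F : Perm X} {s : Set X}
    (hdis : ∀ (m n : ℕ) x, (L ^ m)⁻¹ x ∈ s → (L ^ n)⁻¹ x ∈ s → m = n) (hf : ∀ x ∉ s, f x = x)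
    (h1 : ∀ (n : ℕ) x, (L ^ n)⁻¹ x ∈ s → F x = (L ^ n * f * (L ^ n)⁻¹) x)
    (h2 : ∀ x, (∀ n : ℕ, (L ^ n)⁻¹ x ∉ s) → F x = x) : F = f * (L * F * L⁻¹) := by
  have hs : ∀ (n : ℕ) x, (L ^ n)⁻¹ (L⁻¹ x) = (L ^ (n + 1))⁻¹ x := fun n x => by
    rw [← Perm.mul_apply, ← mul_inv_rev, ← pow_succ']
  ext x
  rw [Perm.mul_apply, Perm.mul_apply, Perm.mul_apply]
  by_cases h : ∃ n : ℕ, (L ^ n)⁻¹ x ∈ s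
  · obtain ⟨n, hx⟩ := h
    cases n with
    | zero =>
      rw [h2 (L⁻¹ x) fun n hn => by
        rw [hs] at hn
        exact absurd (hdis _ _ _ hx hn) (by omega), apply_inv_self, h1 0 x hx]
      simp
    | succ n =>
      have hx' := hx
      rw [← hs] at hx'
      have e : L (F (L⁻¹ x)) = F x := by
        rw [h1 _ _ hx', h1 _ _ hx, pow_succ', mul_inv_rev]
        simp only [Perm.mul_apply]
      rw [e, hf]
      intro hs0
      have e2 : (L ^ (n + 1))⁻¹ (F x) = f ((L ^ (n + 1))⁻¹ x) := by
        rw [h1 _ _ hx, Perm.mul_apply, Perm.mul_apply, inv_apply_self]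
      have := hdis (n + 1) 0 (F x) (by rw [e2]; exact mem_of_fixed_compl hf hx) (by simpa using hs0)
      omega
  · push Not at h
    rw [h2 x h, h2 (L⁻¹ x) fun n => by rw [hs]; exact h _, apply_inv_self, hf x (by simpa using h 0)]

end InfiniteProduct

/-! ### Increasing homeomorphisms, and generation of 𝒫𝒞⁺. -/

section Generalised

variable {a b : ℝ}

theorem mem_generalisedIET_of_strictMono {f : Perm ℝ} (hf : ∀ x ∉ Ico a b, f x = x)
    (hm : StrictMono f) : f ∈ (generalisedIET a b).map (extend a b) :=
  mem_generalisedIET_extend.2 ⟨hf, ∅, finite_empty, fun _ _ _ _ _ _ =>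
    ⟨(continuous_of_strictMono hm).continuousOn, hm.strictMonoOn _⟩⟩

theorem strictMono_inv {f : Perm ℝ} (hf : StrictMono f) : StrictMono (f⁻¹ : Perm ℝ) :=
  fun x y hxy => by
    rw [← hf.lt_iff_lt, apply_inv_self, apply_inv_self]
    exact hxy

theorem strictMono_pow {L : Perm ℝ} (hL : StrictMono L) (n : ℕ) : StrictMono (L ^ n : Perm ℝ) := by
  rw [Perm.coe_pow]
  exact hL.iterate n

/-- The supporting intervals are adjacent and ordered by n. Each is preserved, with an increasing
map on it, and every other point lies to the left or to the right of all of them. -/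
theorem strictMono_infinite_product {L f F : Perm ℝ} {m : ℝ} (hL : StrictMono L) (hm : m ≤ L m)
    (hf : ∀ x ∉ Ico m (L m), f x = x) (hfm : StrictMono f)
    (h1 : ∀ (n : ℕ) x, (L ^ n)⁻¹ x ∈ Ico m (L m) → F x = (L ^ n * f * (L ^ n)⁻¹) x)
    (h2 : ∀ x, (∀ n : ℕ, (L ^ n)⁻¹ x ∉ Ico m (L m)) → F x = x) : StrictMono F := by
  have hpc : ∀ (n : ℕ) x, (L ^ n)⁻¹ x ∈ Ico m (L m) ↔ (L ^ n) m ≤ x ∧ x < (L ^ (n + 1)) m := by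
    intro n x
    have hn := strictMono_pow hL n
    rw [mem_Ico, ← hn.le_iff_le, ← hn.lt_iff_lt, apply_inv_self, pow_succ, Perm.mul_apply]
  have hmono : Monotone fun n : ℕ => (L ^ n) m := monotone_nat_of_le_succ fun n => by
    rw [pow_succ, Perm.mul_apply]
    exact (strictMono_pow hL n).monotone hm
  have hex : ∀ (n : ℕ) x, m ≤ x → x < (L ^ n) m → ∃ k : ℕ, (L ^ k)⁻¹ x ∈ Ico m (L m) := by
    intro n
    induction n with
    | zero => intro x h h'; exact absurd h' (not_lt.2 (by simpa using h))
    | succ n ih =>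
      intro x h h'
      rcases lt_or_ge x ((L ^ n) m) with h3 | h3
      · exact ih x h h3
      · exact ⟨n, (hpc n x).2 ⟨h3, h'⟩⟩
  have hF : ∀ (n : ℕ) x, (L ^ n)⁻¹ x ∈ Ico m (L m) → (L ^ n) m ≤ F x ∧ F x < (L ^ (n + 1)) m := by
    intro n x hx
    rw [← hpc, h1 n x hx, Perm.mul_apply, Perm.mul_apply, inv_apply_self]
    exact mem_of_fixed_compl hf hx
  have h0 : ∀ n : ℕ, m ≤ (L ^ n) m := fun n => by simpa using hmono (Nat.zero_le n)
  intro x y hxy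
  by_cases hx : ∃ n : ℕ, (L ^ n)⁻¹ x ∈ Ico m (L m)
  · obtain ⟨i, hi⟩ := hx
    by_cases hy : ∃ n : ℕ, (L ^ n)⁻¹ y ∈ Ico m (L m)
    · obtain ⟨j, hj⟩ := hy
      rcases lt_trichotomy i j with hij | rfl | hij
      · exact (hF i x hi).2.trans_le ((hmono hij).trans (hF j y hj).1)
      · rw [h1 i x hi, h1 i y hj]
        simp only [Perm.mul_apply]
        exact strictMono_pow hL i (hfm (strictMono_inv (strictMono_pow hL i) hxy))
      · have e1 := ((hpc j y).1 hj).2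
        have e2 := ((hpc i x).1 hi).1
        have e3 : (L ^ (j + 1)) m ≤ (L ^ i) m := hmono hij
        linarith
    · push Not at hy
      rw [h2 y hy]
      refine (hF i x hi).2.trans_le ?_
      by_contra hc
      obtain ⟨k, hk⟩ := hex _ y ((h0 i).trans (((hpc i x).1 hi).1.trans hxy.le)) (not_le.1 hc)
      exact hy k hk
  · push Not at hx
    rw [h2 x hx]
    by_cases hy : ∃ n : ℕ, (L ^ n)⁻¹ y ∈ Ico m (L m)
    · obtain ⟨j, hj⟩ := hy
      refine lt_of_lt_of_le ?_ ((h0 j).trans (hF j y hj).1)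
      by_contra hc
      obtain ⟨k, hk⟩ := hex (j + 1) x (not_lt.1 hc) (hxy.trans ((hpc j y).1 hj).2)
      exact hx k hk
    · push Not at hy
      rwa [h2 y hy]

/-- A group of bijections that is normalised by the group of generalised interval exchange
transformations and contains all affine interval exchange transformations contains all increasing
homeomorphisms of the second quarter from the right. -/
theorem mem_of_fixed_compl_Ico (hab : a < b) {M : Subgroup (Perm ℝ)}
    (hM : ∀ g ∈ (generalisedIET a b).map (extend a b), ∀ m ∈ M, g * m * g⁻¹ ∈ M)
    (hA : (affineIET a b).map (extend a b) ≤ M) {L : Perm ℝ} (hL : IsAff L)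
    (hLx : ∀ x, L x = 2⁻¹ * x + b / 2) {m : ℝ} (hm : m = L a) {f : Perm ℝ} (hfm : StrictMono f)
    (hf : ∀ x ∉ Ico m (L m), f x = x) : f ∈ M := by
  have hLm := hL.strictMono
  have ham : a < m := by rw [hm, hLx]; linarith
  have hmb : m < b := by rw [hm, hLx]; linarith
  have hmL : m < L m := by rw [hLx]; linarith
  have hLb : L m < b := by rw [hLx]; linarith
  have hmono : Monotone fun n : ℕ => (L ^ n) m := monotone_nat_of_le_succ fun n => by
    rw [pow_succ, Perm.mul_apply]
    exact (strictMono_pow hLm n).monotone hmL.le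
  have hpc : ∀ (n : ℕ) x, (L ^ n)⁻¹ x ∈ Ico m (L m) ↔ (L ^ n) m ≤ x ∧ x < (L ^ (n + 1)) m := by
    intro n x
    have hn := strictMono_pow hLm n
    rw [mem_Ico, ← hn.le_iff_le, ← hn.lt_iff_lt, apply_inv_self, pow_succ, Perm.mul_apply]
  have hlt : ∀ n : ℕ, (L ^ n) m < b := by
    intro n
    induction n with
    | zero => simpa using hmb
    | succ n ih =>
      rw [pow_succ', Perm.mul_apply, hLx]
      linarith
  have h0 : ∀ n : ℕ, m ≤ (L ^ n) m := fun n => by simpa using hmono (Nat.zero_le n)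
  have hdis : ∀ (i j : ℕ) x, (L ^ i)⁻¹ x ∈ Ico m (L m) → (L ^ j)⁻¹ x ∈ Ico m (L m) → i = j := by
    intro i j x hi hj
    rw [hpc] at hi hj
    by_contra hne
    rcases Nat.lt_or_gt_of_ne hne with h | h
    · have : (L ^ (i + 1)) m ≤ (L ^ j) m := hmono h
      linarith
    · have : (L ^ (j + 1)) m ≤ (L ^ i) m := hmono h
      linarith
  obtain ⟨F, h1, h2⟩ := exists_infinite_product hdis hf
  have hFm : StrictMono F := strictMono_infinite_product hLm hmL.le hf hfm h1 h2
  have hFfix : ∀ x ∉ Ico m b, F x = x := by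
    intro x hx
    apply h2
    intro n hn
    rw [hpc] at hn
    exact hx ⟨(h0 n).trans hn.1, hn.2.trans (hlt _)⟩
  have hFG : F ∈ (generalisedIET a b).map (extend a b) := mem_generalisedIET_of_strictMono
    (fun x hx => hFfix x fun h => hx ⟨ham.le.trans h.1, h.2⟩) hFm
  -- On `[m, b)`, which carries F, this bump halves distances to b just as L does; unlike L it
  -- belongs to 𝒜⁺.
  set s := bump a m (L m) b with hs
  have hsM : s ∈ M := hA (bump_mem_affineIET le_rfl ham hmb (ham.trans hmL) hLb le_rfl)
  have e1 : s * F * s⁻¹ = L * F * L⁻¹ := conj_eq_of_eqOn hFfix fun x hx => by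
    rw [hs, bump_right ham hmb (ham.trans hmL) hLb hx.1 hx.2 (k := 2⁻¹) (by rw [hLx]; ring), hLx]
    ring
  have e2 := infinite_product_eq hdis hf h1 h2
  rw [← e1] at e2
  -- From F = f · sFs⁻¹, f is the commutator of F and s. It lies in M because s does and F
  -- normalises M.
  have e3 : f = F * s * F⁻¹ * s⁻¹ := by
    calc f = f * (s * F * s⁻¹) * (s * F * s⁻¹)⁻¹ := by group
      _ = F * (s * F * s⁻¹)⁻¹ := by rw [← e2]
      _ = _ := by group
  rw [e3]
  exact mul_mem (hM F hFG s hsM) (inv_mem hsM)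

theorem mem_of_conj_isAff_mem {M : Subgroup (Perm ℝ)} (hA : (affineIET a b).map (extend a b) ≤ M)
    {f L : Perm ℝ} {c d : ℝ} (hfix : ∀ x ∉ Ico c d, f x = x) (hL : IsAff L)
    (h : d ≤ L c ∨ L d ≤ c) (hc : a ≤ c) (hd : d ≤ b) (hc' : a ≤ L c) (hd' : L d ≤ b)
    (hf : L * f * L⁻¹ ∈ M) : f ∈ M := by
  have ht := hA (swapOn_mem_affineIET hL h hc hd hc' hd')
  rw [← conj_eq_of_eqOn (k := swapOn L (Ico c d)) hfix fun x hx =>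
    swapOn_apply_of_mem (displaced_of_isAff hL h) hx] at hf
  have := mul_mem (mul_mem (inv_mem ht) hf) ht
  convert this using 1
  group

theorem strictMono_conj {f L : Perm ℝ} (hf : StrictMono f) (hL : StrictMono L) :
    StrictMono (L * f * L⁻¹ : Perm ℝ) :=
  hL.comp (hf.comp (strictMono_inv hL))

theorem conj_fixed_Ico {f L : Perm ℝ} (hL : StrictMono L) {c d : ℝ}
    (hf : ∀ x ∉ Ico c d, f x = x) : ∀ x ∉ Ico (L c) (L d), (L * f * L⁻¹) x = x :=
  conj_fixed hf fun _ hx => ⟨hL.monotone hx.1, hL hx.2⟩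

open Classical in
theorem exists_restrict_Iio {g : Perm ℝ} (hg : StrictMono g) {m : ℝ} (hm : g m = m) :
    ∃ g1 : Perm ℝ, (∀ x < m, g1 x = g x) ∧ ∀ x, m ≤ x → g1 x = x := by
  have h : ∀ x, g x < m ↔ x < m := fun x => by
    conv_lhs => rw [← hm]
    exact hg.lt_iff_lt
  refine ⟨Perm.ofSubtype (g.subtypePerm (p := fun x => x < m) h), fun x hx => ?_, fun x hx => ?_⟩
  · exact Perm.ofSubtype_apply_coe (g.subtypePerm (p := fun x => x < m) h) ⟨x, hx⟩
  · exact Perm.ofSubtype_apply_of_not_mem (g.subtypePerm (p := fun x => x < m) h) (not_lt.2 hx)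

/-- Fragmentation at the midpoint m: after correction by an affine bump f fixes m and splits into
homeomorphisms of the two halves. Each half is carried affinely to the interval treated in
`mem_of_fixed_compl_Ico`. -/
theorem mem_of_strictMono (hab : a < b) {M : Subgroup (Perm ℝ)}
    (hM : ∀ g ∈ (generalisedIET a b).map (extend a b), ∀ m ∈ M, g * m * g⁻¹ ∈ M)
    (hA : (affineIET a b).map (extend a b) ≤ M) {f : Perm ℝ} (hfm : StrictMono f)
    (hf : ∀ x ∉ Ico a b, f x = x) : f ∈ M := by
  obtain ⟨L, hL, hLx⟩ := exists_isAff_of_slope (l := 2⁻¹) (by norm_num) (b / 2)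
  have hLm := hL.strictMono
  set m := L a with hm
  have ham : a < m := by rw [hm, hLx]; linarith
  have hmb : m < b := by rw [hm, hLx]; linarith
  have hmm : L m < b := by rw [hLx]; linarith
  have left : ∀ g : Perm ℝ, StrictMono g → (∀ x ∉ Ico a m, g x = x) → g ∈ M :=
    fun g hg hfix => mem_of_conj_isAff_mem hA hfix hL (Or.inl le_rfl) le_rfl hmb.le ham.le hmm.le
      (mem_of_fixed_compl_Ico hab hM hA hL hLx hm (strictMono_conj hg hLm)
        (conj_fixed_Ico hLm hfix))
  -- A translation carries the right half onto the left half.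
  have right : ∀ g : Perm ℝ, StrictMono g → (∀ x ∉ Ico m b, g x = x) → g ∈ M := by
    intro g hg hfix
    obtain ⟨L', hL', hLx'⟩ := exists_isAff_of_slope one_pos (a - m)
    have e1 : L' m = a := by rw [hLx']; ring
    have e2 : L' b = m := by rw [hLx', hm, hLx]; ring
    refine mem_of_conj_isAff_mem hA hfix hL' (Or.inr e2.le) ham.le le_rfl e1.ge
      (e2.le.trans hmb.le) (left _ (strictMono_conj hg hL'.strictMono) ?_)
    have := conj_fixed_Ico hL'.strictMono hfix
    rwa [e1, e2] at this
  have hfa := apply_left_of_strictMono hf hfm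
  have h1 : a < f m := by
    have := hfm ham
    rwa [hfa] at this
  have h2 : f m < b := by
    have := hfm hmb
    rwa [hf b fun h => lt_irrefl _ h.2] at this
  -- This bump returns f m to m.
  set k := bump a (f m) m b with hk
  have hkM : k ∈ M := hA (bump_mem_affineIET le_rfl h1 h2 ham hmb le_rfl)
  set g := k * f with hg
  have hgm : StrictMono g := (strictMono_bump h1 h2 ham hmb).comp hfm
  have hgfix : ∀ x ∉ Ico a b, g x = x := fun x hx => by
    rw [hg, Perm.mul_apply, hf x hx, hk, bump_fixed le_rfl le_rfl x hx]
  have hgmm : g m = m := by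
    rw [hg, Perm.mul_apply, hk, bump_right h1 h2 ham hmb le_rfl h2 (k := (b - m) / (b - f m))]
    · have : b - f m ≠ 0 := by linarith
      field_simp
      ring
    · have : b - f m ≠ 0 := by linarith
      field_simp
  obtain ⟨g1, h3, h4⟩ := exists_restrict_Iio hgm hgmm
  have f1 : ∀ x ∉ Ico a m, g1 x = x := by
    intro x hx
    rw [mem_Ico, not_and_or, not_le, not_lt] at hx
    rcases hx with hx | hx
    · rw [h3 x (hx.trans ham), hgfix x fun h => absurd h.1 (not_le.2 hx)]
    · exact h4 x hx
  have m1 : g1 ∈ M := left g1 (strictMono_of_strictMonoOn f1 fun x hx y hy hxy => by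
    rw [h3 x hx.2, h3 y hy.2]
    exact hgm hxy) f1
  have h5 : ∀ x, m ≤ x → (g1⁻¹ * g) x = g x := fun x hx => by
    have : m ≤ g x := by rw [← hgmm]; exact hgm.monotone hx
    rw [Perm.mul_apply, inv_apply_of_fixed (h4 _ this)]
  have f2 : ∀ x ∉ Ico m b, (g1⁻¹ * g) x = x := by
    intro x hx
    rw [mem_Ico, not_and_or, not_le, not_lt] at hx
    rcases hx with hx | hx
    · rw [Perm.mul_apply, ← h3 x hx, inv_apply_self]
    · rw [h5 x (hmb.le.trans hx), hgfix x fun h => absurd h.2 (not_lt.2 hx)]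
  have m2 : g1⁻¹ * g ∈ M := right _ (strictMono_of_strictMonoOn f2 fun x hx y hy hxy => by
    rw [h5 x hx.1, h5 y hy.1]
    exact hgm hxy) f2
  have e : f = k⁻¹ * (g1 * (g1⁻¹ * g)) := by rw [hg]; group
  rw [e]
  exact mul_mem (inv_mem hkM) (mul_mem m1 m2)

/-- A group of bijections that is normalised by the group of generalised interval exchange
transformations and contains all affine interval exchange transformations contains all generalised
interval exchange transformations. -/
theorem generalisedIET_le_of_affineIET_le (hab : a < b) {M : Subgroup (Perm ℝ)}
    (hM : ∀ g ∈ (generalisedIET a b).map (extend a b), ∀ m ∈ M, g * m * g⁻¹ ∈ M)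
    (hA : (affineIET a b).map (extend a b) ≤ M) : (generalisedIET a b).map (extend a b) ≤ M := by
  intro f hf
  obtain ⟨h, hh, hm⟩ := exists_mul_strictMono hab (M := (iet a b).map (extend a b))
    (mem_generalisedIET_extend.1 hf) fun x y z h1 h2 h3 h4 => rot_mem_iet h1 h2 h3 h4
  have hhA := iet_le_affineIET_extend hh
  have := mem_of_strictMono hab hM hA hm (mem_generalisedIET_extend.1
    (mul_mem (affineIET_le_generalisedIET_extend hhA) hf)).1
  have e : f = h⁻¹ * (h * f) := by group
  rw [e]
  exact mul_mem (inv_mem (hA hhA)) this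

end Generalised

/-! ### Flips modulo finite support, and generation of 𝒢. -/

section Flips

variable {a b : ℝ}

/-- The reflection of the open interval `(c, d)`, extended by the identity. -/
noncomputable def flip (c d : ℝ) : Perm ℝ :=
  Function.Involutive.toPerm (fun x => if c < x ∧ x < d then c + d - x else x) fun x => by
    by_cases h : c < x ∧ x < d
    · have h' : c < c + d - x ∧ c + d - x < d := ⟨by linarith [h.2], by linarith [h.1]⟩
      simp only [h, h', and_self, if_true]
      ring
    · simp only [h, if_false]

theorem flip_of_mem {c d x : ℝ} (h1 : c < x) (h2 : x < d) : flip c d x = c + d - x :=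
  if_pos ⟨h1, h2⟩

theorem flip_other {c d x : ℝ} (h : x ≤ c ∨ d ≤ x) : flip c d x = x :=
  if_neg fun h' => by rcases h with h | h <;> linarith [h'.1, h'.2]

theorem flip_inv (c d : ℝ) : (flip c d)⁻¹ = flip c d := rfl

theorem flip_eq_one {c d : ℝ} (h : d ≤ c) : flip c d = 1 := by
  ext x
  exact flip_other ((le_total x c).imp_right h.trans)

theorem flip_mem {c d : ℝ} (hc : a ≤ c) (hd : d ≤ b) :
    flip c d ∈ (flipBijections a b).map (extend a b) := by
  rw [mem_flipBijections_extend]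
  refine ⟨fun x hx => ?_, {c, d}, by simp, fun u v hu huv hv hp => ?_⟩
  · rw [mem_Ico, not_and_or, not_le, not_lt] at hx
    exact flip_other (hx.imp (fun h => by linarith) fun h => by linarith)
  · simp only [mem_insert_iff, mem_singleton_iff, forall_eq_or_imp, forall_eq] at hp
    obtain ⟨p1, p2⟩ := hp
    by_cases hA : c ≤ u ∧ v ≤ d
    · refine ⟨-1, c + d, Or.inr rfl, fun x hx => ?_⟩
      rw [flip_of_mem (hA.1.trans_lt hx.1) (hx.2.trans_le hA.2)]
      ring
    · refine ⟨1, 0, Or.inl rfl, fun x hx => ?_⟩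
      rw [not_and_or, not_le, not_le] at hA
      rw [one_mul, add_zero]
      apply flip_other
      rcases hA with hA | hA
      · left
        rcases p1 with p | p <;> linarith [hx.2]
      · right
        rcases p2 with p | p <;> linarith [hx.1]

theorem mem_of_eq_off_finite {M : Subgroup (Perm ℝ)}
    (hK : ∀ f ∈ (flipBijections a b).map (extend a b), {x | f x ≠ x}.Finite → f ∈ M)
    {f g : Perm ℝ} (hf : f ∈ (flipBijections a b).map (extend a b))
    (hg : g ∈ (flipBijections a b).map (extend a b)) (hgM : g ∈ M) {E : Set ℝ} (hE : E.Finite)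
    (h : ∀ x ∉ E, f x = g x) : f ∈ M := by
  have e : f = (f * g⁻¹) * g := by group
  rw [e]
  refine mul_mem (hK _ (mul_mem hf (inv_mem hg)) ((hE.image g).subset fun y hy => ?_)) hgM
  refine ⟨g⁻¹ y, ?_, apply_inv_self g y⟩
  by_contra hc
  exact hy (by rw [Perm.mul_apply, h _ hc, apply_inv_self])

theorem flip_mem_of_derivedIET_le {M : Subgroup (Perm ℝ)}
    (hM : ∀ g ∈ (flipBijections a b).map (extend a b), ∀ m ∈ M, g * m * g⁻¹ ∈ M)
    (hK : ∀ f ∈ (flipBijections a b).map (extend a b), {x | f x ≠ x}.Finite → f ∈ M)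
    (hD : derivedIET a b ≤ M) {c d : ℝ} (hc : a ≤ c) (hd : d ≤ b) : flip c d ∈ M := by
  rcases le_or_gt d c with h | h
  · rw [flip_eq_one h]
    exact one_mem _
  obtain ⟨e, rfl⟩ : ∃ e, d = c + e + e := ⟨(d - c) / 2, by ring⟩
  have he : 0 < e := by linarith
  have hA : Apart e c (c + e) := Or.inl le_rfl
  set t := tsw e c (c + e) with ht
  have htD : t ∈ derivedIET a b :=
    tsw_mem_commutator he.le hA hc (by linarith) (by linarith) (by linarith)
  have htM := hD htD
  have htG := iet_le_flipBijections_extend (derivedIET_le htD)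
  set f := flip c (c + e) with hf
  have hfG : f ∈ (flipBijections a b).map (extend a b) := flip_mem hc (by linarith)
  -- Since tft⁻¹ flips the right half up to finitely many points, this product is the conjugate of t
  -- by that flip. Flipping one of the two exchanged halves turns the translation t into the
  -- reflection of the whole interval.
  refine mem_of_eq_off_finite hK (flip_mem hc hd)
    (g := t * (f * t * f⁻¹) * t⁻¹) (mul_mem (mul_mem htG (mul_mem (mul_mem hfG htG)
      (inv_mem hfG))) (inv_mem htG))
    (mul_mem (mul_mem htM (hM f hfG t htM)) (inv_mem htM)) (E := {c, c + e, c + e + e})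
    (by simp) fun x hx => ?_
  simp only [mem_insert_iff, mem_singleton_iff, not_or] at hx
  obtain ⟨h1, h2, h3⟩ := hx
  rw [hf, ht, tsw_inv, flip_inv]
  simp only [Perm.mul_apply]
  rcases lt_or_gt_of_ne h1 with h1 | h1
  · rw [flip_other (d := c + e + e) (by left; linarith), tsw_other (x := x) (by left; linarith)
      (by left; linarith), flip_other (x := x) (by left; linarith), tsw_other (x := x)
      (by left; linarith) (by left; linarith), flip_other (by left; linarith),
      tsw_other (by left; linarith) (by left; linarith)]
  rcases lt_or_gt_of_ne h2 with h2 | h2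
  · rw [flip_of_mem h1 (by linarith), tsw_left hA (x := x) h1.le h2,
      flip_other (x := x + (c + e - c)) (by right; linarith),
      tsw_right hA (x := x + (c + e - c)) (by linarith) (by linarith),
      show x + (c + e - c) + (c - (c + e)) = x by ring, flip_of_mem (x := x) h1 h2,
      tsw_left hA (by linarith) (by linarith)]
    ring
  rcases lt_or_gt_of_ne h3 with h3 | h3
  · rw [flip_of_mem h1 h3, tsw_right hA (x := x) h2.le h3,
      flip_of_mem (x := x + (c - (c + e))) (by linarith) (by linarith),
      tsw_left hA (x := c + (c + e) - (x + (c - (c + e)))) (by linarith) (by linarith),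
      flip_other (by right; linarith), tsw_right hA (by linarith) (by linarith)]
    ring
  · rw [flip_other (d := c + e + e) (by right; linarith), tsw_other (x := x) (by right; linarith)
      (by right; linarith), flip_other (x := x) (by right; linarith), tsw_other (x := x)
      (by right; linarith) (by right; linarith), flip_other (by right; linarith),
      tsw_other (by right; linarith) (by right; linarith)]

/-- Reversing the whole interval and then each of the two resulting pieces restores orientation but
keeps the new order. -/
theorem rot_mem_of_flip_mem {M : Subgroup (Perm ℝ)}
    (hK : ∀ f ∈ (flipBijections a b).map (extend a b), {x | f x ≠ x}.Finite → f ∈ M)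
    (hF : ∀ c d, a ≤ c → d ≤ b → flip c d ∈ M) {x y z : ℝ} (hx : a ≤ x) (hxy : x ≤ y)
    (hyz : y ≤ z) (hz : z ≤ b) : rot x y z ∈ M := by
  refine mem_of_eq_off_finite hK (iet_le_flipBijections_extend (rot_mem_iet hx hxy hyz hz))
    (g := flip x (x + z - y) * flip (x + z - y) z * flip x z)
    (mul_mem (mul_mem (flip_mem hx (by linarith)) (flip_mem (by linarith) hz)) (flip_mem hx hz))
    (mul_mem (mul_mem (hF _ _ hx (by linarith)) (hF _ _ (by linarith) hz)) (hF _ _ hx hz))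
    (E := {x, y, z}) (by simp) fun w hw => ?_
  simp only [mem_insert_iff, mem_singleton_iff, not_or] at hw
  obtain ⟨h1, h2, h3⟩ := hw
  simp only [Perm.mul_apply]
  rcases lt_or_gt_of_ne h1 with h1 | h1
  · rw [rot_other (Or.inl h1), flip_other (x := w) (by left; linarith), flip_other (x := w)
      (by left; linarith), flip_other (by left; linarith)]
  rcases lt_or_gt_of_ne h2 with h2 | h2
  · rw [rot_left hyz h1.le h2, flip_of_mem (x := w) h1 (by linarith),
      flip_of_mem (x := x + z - w) (by linarith) (by linarith), flip_other (by right; linarith)]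
    ring
  rcases lt_or_gt_of_ne h3 with h3 | h3
  · rw [rot_right hxy h2.le h3, flip_of_mem (x := w) h1 h3, flip_other (x := x + z - w)
      (by left; linarith), flip_of_mem (by linarith) (by linarith)]
    ring
  · rw [rot_other (Or.inr h3.le), flip_other (x := w) (by right; linarith), flip_other (x := w)
      (by right; linarith), flip_other (by right; linarith)]

theorem exists_image_Ioo_eq {k : Perm ℝ} {c d : ℝ} (h : IsomOn k (Ioo c d)) :
    ∃ u v, v - u = d - c ∧ k '' Ioo c d = Ioo u v ∧
      ((∀ w ∈ Ioo c d, k w = w + (u - c)) ∨ ∀ w ∈ Ioo c d, k w = u + d - w) := by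
  obtain ⟨l, β, rfl | rfl, h⟩ := h
  · refine ⟨c + β, d + β, by ring, ?_, Or.inl fun w hw => by rw [h w hw]; ring⟩
    rw [image_congr (g := fun w => w + β) fun w hw => by rw [h w hw]; ring, image_add_const_Ioo]
  · refine ⟨β - d, β - c, by ring, ?_, Or.inr fun w hw => by rw [h w hw]; ring⟩
    rw [image_congr (g := fun w => β - w) fun w hw => by rw [h w hw]; ring,
      image_const_sub_Ioo]

theorem IsomOn.add {k k' : ℝ → ℝ} {s : Set ℝ} {γ : ℝ} (h : IsomOn k s)
    (hk : ∀ w ∈ s, k' w = k w + γ) : IsomOn k' s := by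
  obtain ⟨l, β, hl, h⟩ := h
  exact ⟨l, β + γ, hl, fun x hx => by rw [hk x hx, h x hx]; ring⟩

/-- Up to finitely many points `[a, x)` is fixed. If the image of an interval to its right began
before x, it would contain infinitely many points of `[a, x)`, and one of them would be fixed,
contradicting injectivity. -/
theorem le_of_image_Ioo_eq {k : Perm ℝ} (hk : ∀ x ∉ Ico a b, k x = x) {x : ℝ} (hax : a ≤ x)
    (hid : {w | w ∈ Ico a x ∧ k w ≠ w}.Finite) {c d u v : ℝ} (hxc : x ≤ c) (hcd : c < d)
    (hd : d ≤ b) (huv : v - u = d - c) (him : k '' Ioo c d = Ioo u v) : x ≤ u ∧ v ≤ b := by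
  have hsub : Ioo u v ⊆ Ico a b := by
    rw [← him]
    rintro _ ⟨w, hw, rfl⟩
    exact mem_of_fixed_compl hk ⟨hax.trans (hxc.trans hw.1.le), hw.2.trans_le hd⟩
  have huv' : u < v := by linarith
  have hau : a ≤ u := le_of_forall_gt_imp_ge_of_dense fun w hw => by
    by_contra! hlt
    have h1 : u < min w v := lt_min hw huv'
    have h2 : (u + min w v) / 2 < w := by linarith [min_le_left w v]
    have h3 : (u + min w v) / 2 < v := by linarith [min_le_right w v]
    have := (hsub ⟨by linarith, h3⟩ : (u + min w v) / 2 ∈ Ico a b).1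
    linarith
  have hvb : v ≤ b := le_of_forall_lt_imp_le_of_dense fun w hw => by
    by_contra! hlt
    have h1 : max w u < v := max_lt hw huv'
    have := (hsub ⟨by linarith [le_max_right w u], by linarith⟩ : (max w u + v) / 2 ∈ Ico a b).2
    linarith [le_max_left w u]
  refine ⟨?_, hvb⟩
  by_contra! hux
  have hinf : (Ioo u (min v x)).Infinite := Ioo_infinite (lt_min huv' hux)
  obtain ⟨z, hz, hz'⟩ := hinf.exists_notMem_finite hid
  have hzx : z < x := hz.2.trans_le (min_le_right _ _)
  have hkz : k z = z := by
    by_contra hc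
    exact hz' ⟨⟨hau.trans hz.1.le, hzx⟩, hc⟩
  obtain ⟨w, hw, hwz⟩ : z ∈ k '' Ioo c d := by
    rw [him]; exact ⟨hz.1, hz.2.trans_le (min_le_left _ _)⟩
  have : w = z := k.injective (hwz.trans hkz.symm)
  linarith [hw.1]

/-- The analogue of `sort_step` off a finite set: the image of the next piece is first flipped if
its orientation is reversed, then rotated into place, so that the map becomes the identity there. -/
theorem flip_step {M : Subgroup (Perm ℝ)}
    (hF : ∀ c d, a ≤ c → d ≤ b → flip c d ∈ M)
    (hR : ∀ x y z, a ≤ x → x ≤ y → y ≤ z → z ≤ b → rot x y z ∈ M)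
    {k : Perm ℝ} (hk : ∀ x ∉ Ico a b, k x = x) {P : Set ℝ} {x y : ℝ} (hax : a ≤ x)
    (hxy : x < y) (hyb : y ≤ b) (hgap : ∀ p ∈ P, p ≤ x ∨ y ≤ p)
    (hgood : ∀ c d, x ≤ c → c < d → d ≤ b → (∀ p ∈ P, p ≤ c ∨ d ≤ p) → IsomOn k (Ioo c d))
    (hid : {w | w ∈ Ico a x ∧ k w ≠ w}.Finite) :
    ∃ h ∈ M, (∀ x ∉ Ico a b, (h * k) x = x) ∧
      (∀ c d, y ≤ c → c < d → d ≤ b → (∀ p ∈ P, p ≤ c ∨ d ≤ p) →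
        IsomOn (h * k : Perm ℝ) (Ioo c d)) ∧ {w | w ∈ Ico a y ∧ (h * k) w ≠ w}.Finite := by
  obtain ⟨u, v, huv, him, hform⟩ := exists_image_Ioo_eq (hgood x y le_rfl hxy hyb hgap)
  obtain ⟨hxu, hvb⟩ := le_of_image_Ioo_eq hk hax hid le_rfl hxy hyb huv him
  have huv' : u < v := by linarith
  obtain ⟨φ, hφM, hφfix, hφ⟩ : ∃ φ ∈ M, (∀ w, w ≤ u ∨ v ≤ w → φ w = w) ∧
      ∀ w ∈ Ioo x y, φ (k w) = w + (u - x) := by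
    rcases hform with h | h
    · exact ⟨1, one_mem _, fun w _ => rfl, h⟩
    · refine ⟨flip u v, hF u v (hax.trans hxu) hvb, fun w => flip_other, fun w hw => ?_⟩
      have : k w ∈ Ioo u v := by rw [← him]; exact ⟨w, hw, rfl⟩
      rw [flip_of_mem this.1 this.2, h w hw]
      linarith
  refine ⟨rot x u v * φ, mul_mem (hR _ _ _ hax hxu huv'.le hvb) hφM, fun w hw => ?_, ?_, ?_⟩
  · rw [mem_Ico, not_and_or, not_le, not_lt] at hw
    rw [Perm.mul_apply, Perm.mul_apply, hk w (by rw [mem_Ico, not_and_or, not_le, not_lt]; exact hw),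
      hφfix w (hw.imp (fun h => by linarith) fun h => by linarith),
      rot_other (hw.imp (fun h => by linarith) fun h => by linarith)]
  · intro c d hc hcd hd hp
    have hI := hgood c d (hxy.le.trans hc) hcd hd hp
    obtain ⟨u', v', huv1, him', -⟩ := exists_image_Ioo_eq hI
    obtain ⟨hxu', hvb'⟩ := le_of_image_Ioo_eq hk hax hid (hxy.le.trans hc) hcd hd huv1 him'
    have hmem : ∀ w ∈ Ioo c d, k w ∈ Ioo u' v' := fun w hw => by
      rw [← him']; exact ⟨w, hw, rfl⟩
    have hdj : v' ≤ u ∨ v ≤ u' := by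
      by_contra! h
      have hlt : max u u' < min v v' :=
        max_lt (lt_min huv' h.1) (lt_min h.2 (by linarith))
      obtain ⟨z, hz1, hz2⟩ := exists_between hlt
      rw [max_lt_iff] at hz1
      rw [lt_min_iff] at hz2
      obtain ⟨w, hw, e⟩ : z ∈ k '' Ioo x y := by rw [him]; exact ⟨hz1.1, hz2.1⟩
      obtain ⟨w', hw', e'⟩ : z ∈ k '' Ioo c d := by rw [him']; exact ⟨hz1.2, hz2.2⟩
      have := k.injective (e.trans e'.symm)
      linarith [hw.2, hw'.1]
    rcases hdj with h | h
    · refine hI.add (γ := v - u) fun w hw => ?_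
      have := hmem w hw
      rw [Perm.mul_apply, Perm.mul_apply, hφfix _ (by left; linarith [this.2]),
        rot_left huv'.le (by linarith [this.1]) (by linarith [this.2])]
    · refine hI.add (γ := 0) fun w hw => ?_
      have := hmem w hw
      rw [Perm.mul_apply, Perm.mul_apply, hφfix _ (by right; linarith [this.1]),
        rot_other (by right; linarith [this.1]), add_zero]
  · refine (hid.union (finite_singleton x)).subset ?_
    rintro w ⟨hw, hne⟩
    rcases lt_trichotomy w x with h | h | h
    · refine Or.inl ⟨⟨hw.1, h⟩, fun hkw => hne ?_⟩
      rw [Perm.mul_apply, Perm.mul_apply, hkw, hφfix _ (by left; linarith), rot_other (Or.inl h)]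
    · exact Or.inr h
    · refine absurd ?_ hne
      rw [Perm.mul_apply, Perm.mul_apply, hφ w ⟨h, hw.2⟩, rot_right hxu (by linarith)
        (by linarith [hw.2])]
      ring

/-- A group of bijections that is normalised by the group of interval exchange transformations with
flips, contains the commutator subgroup of the group of interval exchange transformations, and
contains all interval exchange transformations with flips of finite support, contains all interval
exchange transformations with flips. -/
theorem flipBijections_le_of_derivedIET_le (hab : a < b) {M : Subgroup (Perm ℝ)}
    (hM : ∀ g ∈ (flipBijections a b).map (extend a b), ∀ m ∈ M, g * m * g⁻¹ ∈ M)
    (hK : ∀ f ∈ (flipBijections a b).map (extend a b), {x | f x ≠ x}.Finite → f ∈ M)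
    (hD : derivedIET a b ≤ M) : (flipBijections a b).map (extend a b) ≤ M := by
  intro f hf
  have hF : ∀ c d, a ≤ c → d ≤ b → flip c d ∈ M ⊓ (flipBijections a b).map (extend a b) :=
    fun c d hc hd => ⟨flip_mem_of_derivedIET_le hM hK hD hc hd, flip_mem hc hd⟩
  have hR : ∀ x y z, a ≤ x → x ≤ y → y ≤ z → z ≤ b →
      rot x y z ∈ M ⊓ (flipBijections a b).map (extend a b) := fun x y z h1 h2 h3 h4 =>
    ⟨rot_mem_of_flip_mem hK (fun c d hc hd => (hF c d hc hd).1) h1 h2 h3 h4,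
      iet_le_flipBijections_extend (rot_mem_iet h1 h2 h3 h4)⟩
  obtain ⟨hfix, P0, hP0, hgood⟩ := mem_flipBijections_extend.1 hf
  set P : Set ℝ := P0 ∪ {a, b} with hPdef
  have hP : P.Finite := hP0.union (by simp)
  let Q : ℝ → Prop := fun x => ∃ h ∈ M ⊓ (flipBijections a b).map (extend a b),
    (∀ x ∉ Ico a b, (h * f) x = x) ∧
    (∀ c d, x ≤ c → c < d → d ≤ b → (∀ p ∈ P, p ≤ c ∨ d ≤ p) →
      IsomOn (h * f : Perm ℝ) (Ioo c d)) ∧ {w | w ∈ Ico a x ∧ (h * f) w ≠ w}.Finite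
  have hQa : Q a := by
    refine ⟨1, one_mem _, by simpa using hfix, fun c d hc hcd hd hp => ?_, by simp⟩
    rw [one_mul]
    exact hgood c d hc hcd hd fun p hp' => hp p (Or.inl hp')
  obtain ⟨x, ⟨hxP, ⟨hax, hxb⟩, hQx⟩, hmax⟩ :=
    (hP.subset (inter_subset_left (t := Icc a b ∩ {x | Q x}))).exists_maximalFor id _
      ⟨a, by simp [hPdef], ⟨le_rfl, hab.le⟩, hQa⟩
  rcases hxb.lt_or_eq with hlt | rfl
  · exfalso
    obtain ⟨y, hxy, hyb, hyP, hgap⟩ := exists_gap_right hP x hlt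
    have hyP : y ∈ P := by
      rcases hyP with h | rfl
      · exact h
      · simp [hPdef]
    obtain ⟨h, hh, h1, h2, h3⟩ := hQx
    obtain ⟨g, hg, g1, g2, g3⟩ := flip_step hF hR h1 hax hxy hyb hgap h2 h3
    have : Q y := by
      refine ⟨g * h, mul_mem hg hh, ?_⟩
      rw [mul_assoc]
      exact ⟨g1, g2, g3⟩
    exact absurd (hmax ⟨hyP, ⟨hax.trans hxy.le, hyb⟩, this⟩ hxy.le) (not_le.2 hxy)
  · obtain ⟨h, hh, h1, -, h3⟩ := hQx
    have hfin : {w | (h * f) w ≠ w}.Finite := h3.subset fun w hw => ⟨by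
      by_contra hc
      exact hw (h1 w hc), hw⟩
    have e : f = h⁻¹ * (h * f) := by group
    rw [e]
    exact mul_mem (inv_mem hh.1) (hK _ (mul_mem hh.2 hf) hfin)

end Flips

/-! ### The Sah-Arnoux-Fathi invariant contracted by a rational linear form. -/

section SAF

open MeasureTheory

variable {a b : ℝ}

/-- The displacement of an interval exchange transformation, as a simple function. -/
theorem exists_simpleFunc_displacement (hab : a < b) {f : Perm ℝ}
    (hf : f ∈ (iet a b).map (extend a b)) : ∃ δ : SimpleFunc ℝ ℝ, ∀ x, f x = x + δ x := by
  obtain ⟨hfix, P, hP, hgood⟩ := mem_iet_extend.1 hf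
  have key : ((fun w => f w - w) '' Ico a b).Finite ∧
      ∀ t, MeasurableSet (Ico a b ∩ {w | f w - w = t}) := by
    refine gap_induction hab hP (fun x y => ((fun w => f w - w) '' Ico x y).Finite ∧
      ∀ t, MeasurableSet (Ico x y ∩ {w | f w - w = t})) ?_ ?_
    · rintro x y z - hxy hyz - ⟨h1, h2⟩ ⟨h3, h4⟩
      rw [← Ico_union_Ico_eq_Ico hxy.le hyz.le, image_union]
      refine ⟨h1.union h3, fun t => ?_⟩
      rw [union_inter_distrib_right]
      exact (h2 t).union (h4 t)
    · intro c d hc hcd hd hp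
      obtain ⟨β, h⟩ := hgood c d hc hcd hd hp
      refine ⟨(finite_singleton β).subset ?_, fun t => ?_⟩
      · rintro _ ⟨w, hw, rfl⟩
        simp [h w hw]
      · by_cases ht : β = t
        · convert measurableSet_Ico (a := c) (b := d) using 1
          refine inter_eq_left.2 fun w hw => ?_
          simp [h w hw, ht]
        · convert MeasurableSet.empty using 1
          refine eq_empty_of_forall_notMem fun w hw => ht ?_
          have : f w - w = t := hw.2
          rw [← this, h w hw.1]
          ring
  refine ⟨⟨fun w => f w - w, fun t => ?_, ?_⟩, fun x => (add_sub_cancel x (f x)).symm⟩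
  · have e : (fun w => f w - w) ⁻¹' {t} =
        Ico a b ∩ {w | f w - w = t} ∪ (Ico a b)ᶜ ∩ {_w | (0 : ℝ) = t} := by
      ext w
      by_cases hw : w ∈ Ico a b
      · simp [hw]
      · simp [hw, hfix w hw]
    rw [e]
    exact (key.2 t).union (measurableSet_Ico.compl.inter (MeasurableSet.const _))
  · refine (key.1.union (finite_singleton 0)).subset ?_
    rintro _ ⟨w, rfl⟩
    by_cases hw : w ∈ Ico a b
    · exact Or.inl ⟨w, hw, rfl⟩
    · exact Or.inr (by simp [hfix w hw])

theorem measurable_of_mem_iet (hab : a < b) {f : Perm ℝ} (hf : f ∈ (iet a b).map (extend a b)) :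
    Measurable f := by
  obtain ⟨δ, h⟩ := exists_simpleFunc_displacement hab hf
  rw [funext h]
  exact measurable_id.add δ.measurable

/-- The displacement takes finitely many values and the map is a translation on each level set, so
translation invariance can be summed over the level sets. -/
theorem measurePreserving_of_mem_iet (hab : a < b) {f : Perm ℝ}
    (hf : f ∈ (iet a b).map (extend a b)) : MeasurePreserving f := by
  have hm := measurable_of_mem_iet hab hf
  refine ⟨hm, Measure.ext fun s hs => ?_⟩
  rw [Measure.map_apply hm hs]
  obtain ⟨δ, h⟩ := exists_simpleFunc_displacement hab hf
  have himg : ∀ t, f '' (δ ⁻¹' {t}) = (fun x => x + -t) ⁻¹' (δ ⁻¹' {t}) := by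
    intro t
    ext y
    constructor
    · rintro ⟨x, hx, rfl⟩
      have hx' : δ x = t := hx
      simp [h, hx']
    · intro hy
      have hy' : δ (y + -t) = t := hy
      exact ⟨y + -t, hy, by rw [h, hy']; ring⟩
  have e1 : f ⁻¹' s = ⋃ t ∈ δ.range, (f ⁻¹' s ∩ δ ⁻¹' {t}) := by
    ext x
    simp
  have e2 : s = ⋃ t ∈ δ.range, (s ∩ f '' (δ ⁻¹' {t})) := by
    ext y
    obtain ⟨x, rfl⟩ := f.surjective y
    simp
  rw [e1, measure_biUnion_finset, e2, measure_biUnion_finset, ← e2]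
  · refine Finset.sum_congr rfl fun t _ => ?_
    rw [← measure_preimage_add_right volume t (s ∩ _), himg]
    congr 1
    ext x
    have : δ x = t → (f x ∈ s ↔ x + t ∈ s) := fun hx => by rw [h, hx]
    simp only [mem_inter_iff, mem_preimage, mem_singleton_iff, add_neg_cancel_right]
    tauto
  · intro t _ u _ htu
    refine Disjoint.mono inter_subset_right inter_subset_right ?_
    rw [disjoint_image_iff f.injective]
    exact Disjoint.preimage _ (by simpa using htu)
  · intro t _
    rw [himg]
    exact hs.inter ((measurable_add_const _) (δ.measurableSet_fiber t))
  · intro t _ u _ htu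
    refine Disjoint.mono inter_subset_right inter_subset_right ?_
    exact Disjoint.preimage _ (by simpa using htu)
  · intro t _
    exact (hm hs).inter (δ.measurableSet_fiber t)

theorem integrable_displacement (hab : a < b) {f : Perm ℝ} (hf : f ∈ (iet a b).map (extend a b))
    (φ : ℝ →ₗ[ℚ] ℝ) : Integrable (fun x => φ (f x - x)) := by
  obtain ⟨δ, h⟩ := exists_simpleFunc_displacement hab hf
  refine IntegrableOn.integrable_of_forall_notMem_eq_zero (s := Ico a b) ?_ fun x hx => ?_
  · refine ((δ.map φ).integrable_of_isFiniteMeasure).congr (Filter.Eventually.of_forall fun x => ?_)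
    simp [h]
  · rw [(mem_iet_extend.1 hf).1 x hx, sub_self, map_zero]

/-- Split f(g x) - x as (f(g x) - g x) + (g x - x) and change variables by g in the first term. -/
theorem integral_displacement_mul (hab : a < b) {f g : Perm ℝ}
    (hf : f ∈ (iet a b).map (extend a b)) (hg : g ∈ (iet a b).map (extend a b)) (φ : ℝ →ₗ[ℚ] ℝ) :
    ∫ x, φ ((f * g) x - x) = (∫ x, φ (f x - x)) + ∫ x, φ (g x - x) := by
  have hgm := measurePreserving_of_mem_iet hab hg
  have hge : MeasurableEmbedding g := (⟨g, hgm.measurable,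
    measurable_of_mem_iet hab (inv_mem hg)⟩ : ℝ ≃ᵐ ℝ).measurableEmbedding
  rw [← hgm.integral_comp hge fun x => φ (f x - x), ← integral_add]
  · congr 1
    ext x
    rw [← map_add, Perm.mul_apply, sub_add_sub_cancel]
  · exact hgm.integrable_comp_of_integrable (integrable_displacement hab hf φ)
  · exact integrable_displacement hab hg φ

theorem integral_displacement_rot {x y z : ℝ} (hxy : x ≤ y) (hyz : y ≤ z) (φ : ℝ →ₗ[ℚ] ℝ) :
    ∫ w, φ (rot x y z w - w) = (y - x) * φ (z - y) + (z - y) * φ (x - y) := by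
  have e : (fun w => φ (rot x y z w - w)) = fun w =>
      (Ico x y).indicator (fun _ => φ (z - y)) w + (Ico y z).indicator (fun _ => φ (x - y)) w := by
    ext w
    by_cases h1 : w ∈ Ico x y
    · have h2 : w ∉ Ico y z := fun h => absurd h1.2 (not_lt.2 h.1)
      rw [indicator_of_mem h1, indicator_of_notMem h2, rot_left hyz h1.1 h1.2,
        add_sub_cancel_left, add_zero]
    · rw [indicator_of_notMem h1, zero_add]
      by_cases h2 : w ∈ Ico y z
      · rw [indicator_of_mem h2, rot_right hxy h2.1 h2.2, add_sub_cancel_left]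
      · rw [indicator_of_notMem h2, rot_other, sub_self, map_zero]
        by_contra! h
        rcases lt_or_ge w y with h' | h'
        · exact h1 ⟨h.1, h'⟩
        · exact h2 ⟨h', h.2⟩
  have hi : ∀ (u v r : ℝ), Integrable ((Ico u v).indicator fun _ : ℝ => r) := fun u v r =>
    (integrable_indicator_iff measurableSet_Ico).2 (integrableOn_const (by simp))
  rw [e, integral_add (hi _ _ _) (hi _ _ _), integral_indicator_const _ measurableSet_Ico,
    integral_indicator_const _ measurableSet_Ico, Real.volume_real_Ico_of_le hxy,
    Real.volume_real_Ico_of_le hyz, smul_eq_mul, smul_eq_mul]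

/-- The contraction of the Sah-Arnoux-Fathi invariant by a `ℚ`-linear form. -/
noncomputable def contractedSAF (hab : a < b) (φ : ℝ →ₗ[ℚ] ℝ) : iet a b →* Multiplicative ℝ :=
  MonoidHom.mk' (fun f => Multiplicative.ofAdd (∫ x, φ (extend a b f x - x))) fun f g => by
    rw [← ofAdd_add, ← integral_displacement_mul hab ⟨f, f.2, rfl⟩ ⟨g, g.2, rfl⟩,
      Subgroup.coe_mul, map_mul]

/-- If y - a is an irrational multiple of b - a, the two lengths are independent over ℚ. -/
theorem exists_linearForm (hab : a < b) :
    ∃ (φ : ℝ →ₗ[ℚ] ℝ) (y : ℝ), a < y ∧ y < b ∧ φ (b - a) = 0 ∧ φ (y - a) ≠ 0 := by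
  obtain ⟨r, hr, h0, h1⟩ := exists_irrational_btwn (zero_lt_one (α := ℝ))
  have hba : 0 < b - a := sub_pos.2 hab
  have hn : r * (b - a) ∉ Submodule.span ℚ {b - a} := by
    rw [Submodule.mem_span_singleton]
    rintro ⟨q, hq⟩
    rw [Rat.smul_def] at hq
    exact hr ⟨q, mul_right_cancel₀ hba.ne' hq⟩
  obtain ⟨ψ, hψ, hle⟩ := Submodule.exists_le_ker_of_notMem hn
  refine ⟨(Algebra.linearMap ℚ ℝ).comp ψ, a + r * (b - a), by nlinarith, by nlinarith, ?_, ?_⟩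
  · have : ψ (b - a) = 0 := hle (Submodule.mem_span_singleton_self _)
    simp [this]
  · simpa using hψ

/-- As φ vanishes on b - a, the rotation of `[a, b)` at y has invariant -(b - a) · φ(y - a), which
is nonzero, whereas commutators have invariant zero. -/
theorem commutator_iet_ne_top (hab : a < b) : commutator (iet a b) ≠ ⊤ := by
  obtain ⟨φ, y, hay, hyb, h0, hy⟩ := exists_linearForm hab
  obtain ⟨f, hf, hfr⟩ := rot_mem_iet le_rfl hay.le hyb.le le_rfl
  intro h
  have hk : (⟨f, hf⟩ : iet a b) ∈ (contractedSAF hab φ).ker :=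
    Abelianization.commutator_subset_ker _ (h ▸ Subgroup.mem_top _)
  have hk' : ∫ x, φ (extend a b f x - x) = 0 := hk
  rw [hfr, integral_displacement_rot hay.le hyb.le, show b - y = (b - a) - (y - a) by ring,
    map_sub, h0, ← neg_sub y a, map_neg] at hk'
  have : (b - a) * φ (y - a) = 0 := by linarith
  exact (mul_ne_zero (sub_pos.2 hab).ne' hy) this

end SAF

/-! ### Displaced intervals and the conclusions for each group. -/

section Simplicity

variable {a b : ℝ}

theorem conj_mem_map {G X : Type*} [Group G] [Group X] {N : Subgroup G} (hN : N.Normal)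
    (ι : G →* X) {g m : X} (hg : g ∈ ι.range) (hm : m ∈ N.map ι) : g * m * g⁻¹ ∈ N.map ι := by
  obtain ⟨g, rfl⟩ := hg
  obtain ⟨m, hm, rfl⟩ := hm
  exact ⟨g * m * g⁻¹, hN.conj_mem m hm g, by simp⟩

/-- Translates simplicity of a quotient into a statement on subgroups M of the ambient group that
contain the image of the kernel. The kernel matters only for 𝒢, where it consists of the elements of
finite support. -/
theorem isSimpleGroup_of_surjective {G Q X : Type*} [Group G] [Group Q] [Group X] {π : G →* Q}
    (hπ : Function.Surjective π) {ι : G →* X} (hι : Function.Injective ι) (hne : ∃ g, π g ≠ 1)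
    (h : ∀ M : Subgroup X, (∀ g ∈ ι.range, ∀ m ∈ M, g * m * g⁻¹ ∈ M) → (∀ g, π g = 1 → ι g ∈ M) →
      (∃ g, π g ≠ 1 ∧ ι g ∈ M) → ι.range ≤ M) : IsSimpleGroup Q := by
  obtain ⟨g₀, hg₀⟩ := hne
  have : Nontrivial Q := ⟨π g₀, 1, hg₀⟩
  refine ⟨fun N hN => or_iff_not_imp_left.2 fun hbot => (Subgroup.eq_top_iff' _).2 fun n => ?_⟩
  obtain ⟨k, hk, hk1⟩ := N.bot_or_exists_ne_one.resolve_left hbot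
  obtain ⟨k, rfl⟩ := hπ k
  obtain ⟨n, rfl⟩ := hπ n
  obtain ⟨n', hn', e⟩ := h ((N.comap π).map ι) (fun g hg m => conj_mem_map (hN.comap π) ι hg)
    (fun g hg => ⟨g, by simp [hg], rfl⟩) ⟨k, hk1, k, hk, rfl⟩ ⟨n, rfl⟩
  rw [← hι e]
  exact hn'

theorem isSimpleGroup_of_injective {G X : Type*} [Group G] [Group X] {ι : G →* X}
    (hι : Function.Injective ι) (hne : ι.range ≠ ⊥)
    (h : ∀ M : Subgroup X, (∀ g ∈ ι.range, ∀ m ∈ M, g * m * g⁻¹ ∈ M) →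
      (∃ g ∈ ι.range, g ≠ 1 ∧ g ∈ M) → ι.range ≤ M) : IsSimpleGroup G := by
  have hι1 : ∀ g, g ≠ 1 → ι g ≠ 1 := fun g hg h => hg (hι (h.trans (map_one ι).symm))
  refine isSimpleGroup_of_surjective (π := MonoidHom.id G) Function.surjective_id hι ?_
    fun M hM _ ⟨g, hg, hgM⟩ => h M hM ⟨ι g, ⟨g, rfl⟩, hι1 g hg, hgM⟩
  obtain ⟨_, ⟨g, rfl⟩, hg⟩ := ι.range.bot_or_exists_ne_one.resolve_left hne
  exact ⟨g, fun h => hg (by rw [show g = 1 from h, map_one])⟩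

/-- Start at a moved point p. If g p < p, right continuity keeps nearby images below p; if g p > p,
monotonicity keeps them at or above g p. -/
theorem exists_displaced_of_ne_one {g : Perm ℝ} (hg : g ∈ (generalisedIET a b).map (extend a b))
    (h1 : g ≠ 1) : ∃ p q, a ≤ p ∧ p < q ∧ q ≤ b ∧ ∀ x ∈ Ico p q, g x ∉ Ico p q := by
  obtain ⟨hfix, P, hP, hgood⟩ := mem_generalisedIET_extend.1 hg
  obtain ⟨p, hp⟩ : ∃ p, g p ≠ p := by
    by_contra! h
    exact h1 (Equiv.ext h)
  have hpJ : p ∈ Ico a b := by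
    by_contra h
    exact hp (hfix p h)
  obtain ⟨y, hpy, hyb, -, hgap⟩ := exists_gap_right hP p hpJ.2
  obtain ⟨hc, hm⟩ := hgood p y hpJ.1 hpy hyb hgap
  have hpm : p ∈ Ico p y := ⟨le_rfl, hpy⟩
  rcases lt_or_gt_of_ne hp with h | h
  · have hev := (hc p hpm).eventually_lt_const h
    rw [nhdsWithin_Ico_eq_nhdsGE hpy, Filter.Eventually, mem_nhdsGE_iff_exists_Ico_subset] at hev
    obtain ⟨u, hu, hsub⟩ := hev
    refine ⟨p, min u y, hpJ.1, lt_min hu hpy, (min_le_right _ _).trans hyb, fun x hx hgx => ?_⟩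
    have : g x < p := hsub ⟨hx.1, hx.2.trans_le (min_le_left _ _)⟩
    exact absurd hgx.1 (not_le.2 this)
  · refine ⟨p, min (g p) y, hpJ.1, lt_min h hpy, (min_le_right _ _).trans hyb, fun x hx hgx => ?_⟩
    have := hm.monotoneOn hpm ⟨hx.1, hx.2.trans_le (min_le_right _ _)⟩ hx.1
    exact absurd (hgx.2.trans_le (min_le_left _ _)) (not_lt.2 this)

/-- Infinitely many moved points leave one that is not a cut point, and near it g is an isometry. An
interval of length at most half the displacement of that point is then moved off itself. -/
theorem exists_displaced_of_infinite {g : Perm ℝ} (hg : g ∈ (flipBijections a b).map (extend a b))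
    (hinf : {x | g x ≠ x}.Infinite) :
    ∃ p q, a ≤ p ∧ p < q ∧ q ≤ b ∧ ∀ x ∈ Ico p q, g x ∉ Ico p q := by
  obtain ⟨hfix, P, hP, hgood⟩ := mem_flipBijections_extend.1 hg
  obtain ⟨x, hx, hxP⟩ := hinf.exists_notMem_finite (hP.insert a)
  rw [mem_insert_iff, not_or] at hxP
  have hxJ : x ∈ Ico a b := by
    by_contra h
    exact hx (hfix x h)
  obtain ⟨y, hxy, hyb, -, hgr⟩ := exists_gap_right hP x hxJ.2
  obtain ⟨z, hzx, haz, hgl⟩ := exists_gap_left hP x (lt_of_le_of_ne hxJ.1 (Ne.symm hxP.1))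
  obtain ⟨l, β, hl, h⟩ := hgood z y haz (hzx.trans hxy) hyb fun p hp => by
    rcases hgr p hp with h1 | h1
    · refine (hgl p hp).imp_right fun h2 => ?_
      exact absurd (le_antisymm h1 h2 ▸ hp) hxP.2
    · exact Or.inr h1
  have hε : 0 < |g x - x| := abs_pos.2 (sub_ne_zero.2 hx)
  refine ⟨x, min y (x + |g x - x| / 2), hxJ.1, lt_min hxy (by linarith),
    (min_le_left _ _).trans hyb, fun w hw hgw => ?_⟩
  have hwy := hw.2.trans_le (min_le_left _ _)
  have hwε := hw.2.trans_le (min_le_right _ _)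
  have hgε := hgw.2.trans_le (min_le_right _ _)
  have hw1 := hw.1
  have hg1 := hgw.1
  have e : |g x - x| ≤ |g x - g w| + |g w - x| := abs_sub_le _ _ _
  have e1 : |g x - g w| = |w - x| := by
    rw [h x ⟨hzx, hxy⟩, h w ⟨hzx.trans_le hw.1, hwy⟩]
    rcases hl with rfl | rfl
    · rw [abs_sub_comm w x]; congr 1; ring
    · congr 1; ring
  rw [e1, abs_of_nonneg (by linarith : 0 ≤ w - x), abs_of_nonneg (by linarith : 0 ≤ g w - x)] at e
  linarith

theorem exists_mem_derivedIET_infinite (hab : a < b) :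
    ∃ t ∈ derivedIET a b, {x | t x ≠ x}.Infinite := by
  have hA : Apart ((b - a) / 2) a (a + (b - a) / 2) := Or.inl le_rfl
  refine ⟨tsw ((b - a) / 2) a (a + (b - a) / 2), tsw_mem_commutator (by linarith) hA le_rfl
    (by linarith) (by linarith) (by linarith), (Ico_infinite (show a < a + (b - a) / 2 by
      linarith)).mono fun x hx h => ?_⟩
  rw [tsw_left hA hx.1 hx.2] at h
  linarith

theorem derivedIET_ne_bot (hab : a < b) : derivedIET a b ≠ ⊥ := by
  obtain ⟨t, ht, hinf⟩ := exists_mem_derivedIET_infinite hab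
  intro h
  rw [h, Subgroup.mem_bot] at ht
  obtain ⟨x, hx⟩ := hinf.nonempty
  exact hx (by rw [ht]; rfl)

theorem derivedIET_le_of_exists_ne_one (hab : a < b) {M : Subgroup (Perm ℝ)}
    (hM : ∀ d ∈ derivedIET a b, ∀ m ∈ M, d * m * d⁻¹ ∈ M)
    (hne : ∃ g ∈ (generalisedIET a b).map (extend a b), g ≠ 1 ∧ g ∈ M) : derivedIET a b ≤ M := by
  obtain ⟨g, hg, hg1, hgM⟩ := hne
  obtain ⟨p, q, hp, hpq, hq, hI⟩ := exists_displaced_of_ne_one hg hg1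
  exact derivedIET_le_of_displaced hab hM hgM hp hpq hq hI

theorem range_extend_comp_subtype (H : Subgroup (Perm (Ico a b))) :
    ((extend a b).comp H.subtype).range = H.map (extend a b) := by
  rw [MonoidHom.range_comp, Subgroup.range_subtype]

theorem isSimpleGroup_affineIET (hab : a < b) : IsSimpleGroup (affineIET a b) := by
  have hD := derivedIET_le.trans (iet_le_affineIET_extend (a := a) (b := b))
  refine isSimpleGroup_of_injective (ι := (extend a b).comp (affineIET a b).subtype)
    (extend_injective.comp (Subgroup.subtype_injective _)) ?_ ?_ <;>
    rw [range_extend_comp_subtype]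
  · exact ne_bot_of_le_ne_bot (derivedIET_ne_bot hab) hD
  · intro M hM ⟨g, hg, hg1, hgM⟩
    exact affineIET_le_of_derivedIET_le hab hM (derivedIET_le_of_exists_ne_one hab
      (fun d hd => hM d (hD hd)) ⟨g, affineIET_le_generalisedIET_extend hg, hg1, hgM⟩)

theorem isSimpleGroup_generalisedIET (hab : a < b) : IsSimpleGroup (generalisedIET a b) := by
  have hA := affineIET_le_generalisedIET_extend (a := a) (b := b)
  have hD := (derivedIET_le.trans iet_le_affineIET_extend).trans hA
  refine isSimpleGroup_of_injective (ι := (extend a b).comp (generalisedIET a b).subtype)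
    (extend_injective.comp (Subgroup.subtype_injective _)) ?_ ?_ <;>
    rw [range_extend_comp_subtype]
  · exact ne_bot_of_le_ne_bot (derivedIET_ne_bot hab) hD
  · intro M hM ⟨g, hg, hg1, hgM⟩
    exact generalisedIET_le_of_affineIET_le hab hM
      (affineIET_le_of_derivedIET_le hab (fun g hg => hM g (hA hg))
        (derivedIET_le_of_exists_ne_one hab (fun d hd => hM d (hD hd)) ⟨g, hg, hg1, hgM⟩))

theorem isSimpleGroup_commutator_iet (hab : a < b) : IsSimpleGroup (commutator (iet a b)) := by
  have e : (((extend a b).comp (iet a b).subtype).comp (commutator (iet a b)).subtype).range =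
      derivedIET a b := by
    rw [MonoidHom.range_comp, Subgroup.range_subtype, ← Subgroup.map_map,
      Subgroup.map_subtype_commutator, Subgroup.map_commutator, derivedIET]
  refine isSimpleGroup_of_injective
    (ι := ((extend a b).comp (iet a b).subtype).comp (commutator (iet a b)).subtype)
    ((extend_injective.comp (Subgroup.subtype_injective _)).comp (Subgroup.subtype_injective _))
    ?_ ?_ <;> rw [e]
  · exact derivedIET_ne_bot hab
  · intro M hM ⟨g, hg, hg1, hgM⟩
    exact derivedIET_le_of_exists_ne_one hab hM ⟨g, affineIET_le_generalisedIET_extend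
      (iet_le_affineIET_extend (derivedIET_le hg)), hg1, hgM⟩

theorem not_isSimpleGroup_iet (hab : a < b) : ¬ IsSimpleGroup (iet a b) := by
  intro h
  rcases h.eq_bot_or_eq_top_of_normal (commutator (iet a b)) inferInstance with h | h
  · apply derivedIET_ne_bot hab
    rw [derivedIET, ← Subgroup.map_commutator, ← Subgroup.map_subtype_commutator, h,
      Subgroup.map_bot, Subgroup.map_bot]
  · exact commutator_iet_ne_top hab h

theorem finite_moved_extend_iff {g : Perm (Ico a b)} :
    {x | extend a b g x ≠ x}.Finite ↔ g ∈ finiteSupport a b := by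
  have e : {x | extend a b g x ≠ x} = Subtype.val '' {x | g x ≠ x} := by
    ext x
    constructor
    · intro hx
      have hxJ : x ∈ Ico a b := by
        by_contra h
        exact hx (extend_apply_of_notMem g h)
      exact ⟨⟨x, hxJ⟩, fun h => hx ((extend_apply g ⟨x, hxJ⟩).trans (congrArg _ h)), rfl⟩
    · rintro ⟨y, hy, rfl⟩ h
      exact hy (Subtype.ext ((extend_apply g y).symm.trans h))
  rw [e, finite_image_iff Subtype.val_injective.injOn]
  rfl

/-- The class of an interval exchange transformation with flips. -/
def toFlipIET (a b : ℝ) : flipBijections a b →* flipIET a b :=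
  (QuotientGroup.mk' (finiteSupport a b)).subgroupMap (flipBijections a b)

theorem toFlipIET_surjective : Function.Surjective (toFlipIET a b) :=
  MonoidHom.subgroupMap_surjective _ _

theorem toFlipIET_eq_one_iff (g : flipBijections a b) :
    toFlipIET a b g = 1 ↔ {x | extend a b g x ≠ x}.Finite := by
  rw [finite_moved_extend_iff, ← QuotientGroup.eq_one_iff]
  exact Subtype.ext_iff

theorem isSimpleGroup_flipIET (hab : a < b) : IsSimpleGroup (flipIET a b) := by
  have hD := derivedIET_le.trans (iet_le_flipBijections_extend (a := a) (b := b))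
  refine isSimpleGroup_of_surjective toFlipIET_surjective
    (ι := (extend a b).comp (flipBijections a b).subtype)
    (extend_injective.comp (Subgroup.subtype_injective _)) ?_ ?_
  · obtain ⟨t, ht, hinf⟩ := exists_mem_derivedIET_infinite hab
    obtain ⟨g, hg, rfl⟩ := hD ht
    exact ⟨⟨g, hg⟩, mt (toFlipIET_eq_one_iff ⟨g, hg⟩).1 hinf⟩
  · rw [range_extend_comp_subtype]
    rintro M hM hK ⟨k, hk, hkM⟩
    obtain ⟨p, q, hp, hpq, hq, hI⟩ := exists_displaced_of_infinite
      (Subgroup.mem_map_of_mem (extend a b) k.2) (mt (toFlipIET_eq_one_iff k).2 hk)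
    refine flipBijections_le_of_derivedIET_le hab hM ?_
      (derivedIET_le_of_displaced hab (fun d hd => hM d (hD hd)) hkM hp hpq hq hI)
    rintro _ ⟨g, hg, rfl⟩ hfin
    exact hK ⟨g, hg⟩ ((toFlipIET_eq_one_iff ⟨g, hg⟩).2 hfin)

end Simplicity

end IntervalExchange

theorem propositionA2 (a b : ℝ) (hab : a < b) :
    IsSimpleGroup (IntervalExchange.affineIET a b) ∧
      IsSimpleGroup (IntervalExchange.generalisedIET a b) ∧
      IsSimpleGroup (IntervalExchange.flipIET a b) ∧
      ¬ IsSimpleGroup (IntervalExchange.iet a b) ∧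
      IsSimpleGroup (commutator (IntervalExchange.iet a b)) :=
  ⟨IntervalExchange.isSimpleGroup_affineIET hab, IntervalExchange.isSimpleGroup_generalisedIET hab,
    IntervalExchange.isSimpleGroup_flipIET hab, IntervalExchange.not_isSimpleGroup_iet hab,
    IntervalExchange.isSimpleGroup_commutator_iet hab⟩
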